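/- **Definitions.** All groups are finite. For a group $G$ and $x\in G$ let ${\rm Cyc}_G(x)=\{g\in G \mid \langle x,g\rangle \text{ is cyclic}\}$; $G$ is *tidy* if ${\rm Cyc}_G(x)$ is a subgroup of $G$ for every $x\in G$. A $\{p,q\}$-group is a finite group whose order has no prime divisors other than $p$ and $q$. $O_r(G)$ denotes the largest normal $r$-subgroup of $G$, $Z(G)$ the centre, and $Z_\infty(G)$ the hypercentre (the last term of the upper central series). A group is a *Frobenius group* with kernel $N$ and complement $A$ if $N$ is a nontrivial normal subgroup, $A$ is a nontrivial subgroup with $NA=G$ and $N\cap A=1$, and no nonidentity element of $A$ centralizes a nonidentity element of $N$. $\widetilde{{\rm GL}_2(3)}$ denotes the nonsplit extension of ${\rm SL}_2(3)$ by $Z_2$, i.e. the group (unique up to isomorphism) that has a normal subgroup of index $2$ which is isomorphic to ${\rm SL}_2(3)$ and has no complement. **Theorem.** Let $G$ be a $\{p,q\}$-group for distinct primes $p$ and $q$. Then $G$ is tidy if and only if the Sylow $p$-subgroups and the Sylow $q$-subgroups of $G$ are tidy and one of the following occurs: 1. $G$ is nilpotent. 2. Up to relabeling $p$ and $q$, $Z_\infty(G)$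 is a $q$-group and $G/Z_\infty(G)$ is a Frobenius group whose Frobenius kernel is the Sylow $p$-subgroup of $G/Z_\infty(G)$. 3. $\{p,q\}=\{2,3\}$, $O_2(G)$ is a Klein $4$-group, $G/O_3(G)\cong S_4$, and $G/O_2(G)$ is a Frobenius group whose Frobenius kernel is the Sylow $3$-subgroup of $G/O_2(G)$ and whose Frobenius complement has order $2$. Also, $Z(G)=1$. 4. $\{p,q\}=\{2,3\}$, $O_2(G)$ is a Sylow $2$-subgroup of $G$ and is the quaternion group of order $8$, and $G/O_3(G)\cong {\rm SL}_2(3)$. Also, $Z_\infty(G)=Z(O_2(G))\times O_3(G)$. 5. $\{p,q\}=\{2,3\}$, $O_2(G)$ is the quaternion group of order $8$, $G/O_3(G)\cong\widetilde{{\rm GL}_2(3)}$, and $G/O_2(G)$ is a Frobenius group whose Frobenius kernel is the Sylow $3$-subgroup of $G/O_2(G)$ and whose Frobenius complement has order $2$. Additionally, $Z_\infty(G)=Z(G)=Z(O_2(G))$. -/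

import Mathlib

/-- The set `Cyc_G(x)` of all `g` such that `⟨x, g⟩` is cyclic. -/
def cyc (G : Type*) [Group G] (x : G) : Set G :=
  {g | IsCyclic (Subgroup.closure ({x, g} : Set G))}

/-- `G` is tidy if `Cyc_G(x)` is a subgroup of `G` for every `x`. -/
def IsTidy (G : Type*) [Group G] : Prop :=
  ∀ x : G, ∃ H : Subgroup G, (H : Set G) = cyc G x

theorem iSup_normal_aux {G : Type*} [Group G] {ι : Sort*} (S : ι → Subgroup G)
    (hS : ∀ i, (S i).Normal) : (⨆ i, S i).Normal := by
  refine ⟨fun n hn g => ?_⟩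
  have h : (⨆ i, S i) ≤ (⨆ i, S i).comap (MulAut.conj g).toMonoidHom :=
    iSup_le fun i x hx => Subgroup.mem_iSup_of_mem i ((hS i).conj_mem x hx g)
  exact h hn

/-- `O_p(G)`, the subgroup generated by all normal `p`-subgroups of `G`
(for finite `G`, the largest normal `p`-subgroup). -/
def pCore (p : ℕ) (G : Type*) [Group G] : Subgroup G :=
  ⨆ N : {N : Subgroup G // N.Normal ∧ IsPGroup p N}, N.1

instance pCore_normal (p : ℕ) (G : Type*) [Group G] : (pCore p G).Normal :=
  iSup_normal_aux _ fun N => N.2.1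

/-- The hypercentre `Z_∞(G)`, the union of the upper central series. -/
def hypercenter (G : Type*) [Group G] : Subgroup G :=
  ⨆ n : ℕ, Subgroup.upperCentralSeries G n

instance hypercenter_normal (G : Type*) [Group G] : (hypercenter G).Normal :=
  iSup_normal_aux _ fun _ => inferInstance

/-- `Z(H)` for a subgroup `H` of `G`, regarded as a subgroup of `G`. -/
def centerOf {G : Type*} [Group G] (H : Subgroup G) : Subgroup G :=
  (Subgroup.center H).map H.subtype

/-- `G` is a Frobenius group with Frobenius kernel `N` and Frobenius complement `A`: the subgroup
`N` is normal, `N` and `A` are nontrivial, `A` complements `N`, and no nonidentity element of `A`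
centralizes a nonidentity element of `N`. -/
structure IsFrobenius {G : Type*} [Group G] (N A : Subgroup G) : Prop where
  normal : N.Normal
  kernel_ne_bot : N ≠ ⊥
  complement_ne_bot : A ≠ ⊥
  isComplement : Subgroup.IsComplement' N A
  fixedPointFree : ∀ a ∈ A, a ≠ 1 → ∀ n ∈ N, a * n * a⁻¹ = n → n = 1

/-- `K` is the internal direct product of its subgroups `H₁` and `H₂`. -/
structure IsInternalProd {G : Type*} [Group G] (K H₁ H₂ : Subgroup G) : Prop where
  sup_eq : H₁ ⊔ H₂ = K
  disjoint : Disjoint H₁ H₂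
  commute : ∀ x ∈ H₁, ∀ y ∈ H₂, x * y = y * x

/-- `G` is a nonsplit extension of `SL₂(3)` by a group of order two: it has a normal subgroup of
index two that is isomorphic to `SL₂(3)` and has no complement. There is exactly one such group up
to isomorphism (the double cover of `S₄`, of order 48, with generalized quaternion Sylow
2-subgroups); it is isoclinic to `GL₂(3)`. -/
def IsTildeGL23 (G : Type*) [Group G] : Prop :=
  ∃ N : Subgroup G, N.Normal ∧ N.index = 2 ∧
    Nonempty (N ≃* Matrix.SpecialLinearGroup (Fin 2) (ZMod 3)) ∧
    ¬ ∃ K : Subgroup G, Subgroup.IsComplement' N K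

open Subgroup

/-! ### Sums of roots of unity and matrices of finite order -/

section Burnside

open Polynomial

/-! The heart of the forward direction is a trichotomy, `IsTidy.action_cases`, for an `s`-element
`y` normalising an `r`-subgroup `N` of a tidy group. If `y` fixes `v ∈ N` of order `r`, then
`Cyc(v)` is a subgroup in which `⟨v⟩` is the only subgroup of order `r`, and it contains `y` and all
conjugates of `y` under `C_N(v)`. So `[m, y]` lies in `D = N ∩ Cyc(v)` for `m ∈ C_N(v)`. A
nontrivial coprime action on such a `D` occurs only for `r = 2`, on a quaternion group and with `s =
3`, and tidiness then makes `N` itself quaternion (`exists_quatTriple`, `QuatTriple.eq_closure`).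
Otherwise `y` centralises `D`, hence `C_N(v)`, hence a central element of order `r` of `N`;
repeating the argument there, `y` centralises `N`. So the action is free, trivial, or the one on
`Q₈`.

Burnside's theorem makes `G` solvable, so the cores control their centralisers. If `O_q` contains
all `q`-elements, the trichotomy for `p`-elements acting on `O_q` yields a nilpotent group, a
Frobenius quotient by `O_p = Z_∞(G)`, or `O_2 = Q₈`. In the last situation `G` permutes the three
cyclic subgroups of order four of `O_2` with kernel `O_2 O_3`; the image `A₃` leads to `SL₂(3)` and
the image `S₃` to its nonsplit extension.

If neither Sylow subgroup is normal, then, up to exchanging the primes, `O_p(G / O_q)` is larger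
than the image of `O_p`. Unless `O_2` is again quaternion, a Sylow `p`-subgroup `R` of its preimage
satisfies `G = N(R) O_q`, acts freely on `O_q` outside `O_p`, and is acted on freely by the
`q`-elements of `N(R)`. A norm computation in the centre of `O_q` gives `y` of order `q` and a
central `a` with `(a y) ^ q ≠ 1`; tidiness then forces `|O_q| ≤ q ^ 2`, whence `q = 2`, `p = 3`,
`O_2` is a Klein four-group, and the four cosets of `N(R)` exhibit `G / O_3` as `S₄`.

Conversely, tidiness need only be tested on nontrivial elements `x` of prime power order. If the
elements of the other prime power order commuting with `x` lie in a normal subgroup of that prime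
power order, then `Cyc(x)` is governed by tidy Sylow subgroups (`mul_mem_cyc_of_normal`). Each
structure in the list supplies such a subgroup, except for the involution of a quaternion core,
which is unique in `G` and has cyclicizer `G`. -/

theorem multiset_norm_sum_re_le (m : Multiset ℂ) (u : ℂ) (hu : ‖u‖ = 1) (hm : ∀ z ∈ m, ‖z‖ = 1) :
    (m.sum * (starRingEnd ℂ) u).re ≤ m.card ∧
      ((m.sum * (starRingEnd ℂ) u).re = m.card → ∀ z ∈ m, z = u) := by
  induction m using Multiset.induction_on with
  | empty => simp
  | cons a m ih =>
    have ih' := ih fun z hz => hm z (Multiset.mem_cons_of_mem hz)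
    have ha : ‖a‖ = 1 := hm a (Multiset.mem_cons_self a m)
    have hle : (a * (starRingEnd ℂ) u).re ≤ 1 := by
      refine (Complex.re_le_norm _).trans ?_
      rw [norm_mul, ha, RCLike.norm_conj, hu, one_mul]
    rw [Multiset.sum_cons, add_mul, Complex.add_re, Multiset.card_cons]
    push_cast
    refine ⟨by linarith [ih'.1], fun h => ?_⟩
    have h1 : (a * (starRingEnd ℂ) u).re = 1 := by linarith [ih'.1]
    have h2 : (m.sum * (starRingEnd ℂ) u).re = m.card := by linarith [ih'.1]
    intro z hz
    rcases Multiset.mem_cons.1 hz with rfl | hz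
    · have hn : ‖z * (starRingEnd ℂ) u‖ = 1 := by rw [norm_mul, ha, RCLike.norm_conj, hu, one_mul]
      have h3 : z * (starRingEnd ℂ) u = 1 := by
        have h4 := Complex.sq_norm (z * (starRingEnd ℂ) u)
        rw [hn, Complex.normSq_apply, h1] at h4
        apply Complex.ext
        · simpa using h1
        · have : (z * (starRingEnd ℂ) u).im * (z * (starRingEnd ℂ) u).im = 0 := by linarith
          simpa using this
      have h5 : (starRingEnd ℂ) u * u = 1 := by
        rw [mul_comm, Complex.mul_conj, Complex.normSq_eq_norm_sq, hu]; simp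
      calc z = z * ((starRingEnd ℂ) u * u) := by rw [h5, mul_one]
        _ = u := by rw [← mul_assoc, h3, one_mul]
    · exact ih'.2 h2 z hz

theorem multiset_norm_sum_le (m : Multiset ℂ) (hm : ∀ z ∈ m, ‖z‖ = 1) :
    ‖m.sum‖ ≤ m.card := by
  refine (norm_multiset_sum_le m).trans ?_
  have : m.map (fun z => ‖z‖) = m.map fun _ => (1 : ℝ) := Multiset.map_congr rfl hm
  rw [this]; simp

/-- A mean of roots of unity that is an algebraic integer is zero or a root of unity. -/
theorem norm_mean_eq_one_of_isIntegral (m : Multiset ℂ) {n : ℕ} (hn : n ≠ 0)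
    (hm : ∀ z ∈ m, z ^ n = 1) (hint : IsIntegral ℤ (m.sum / m.card)) (h0 : m.sum / m.card ≠ 0) :
    ‖m.sum / m.card‖ = 1 := by
  classical
  let S : Set ℂ := {z | z ∈ m}
  have hSf : Finite S := by
    have : S = (m.toFinset : Set ℂ) := by ext; simp [S]
    rw [this]; infer_instance
  let K := IntermediateField.adjoin ℚ S
  have : FiniteDimensional ℚ K := IntermediateField.finiteDimensional_adjoin fun x hx =>
    IsIntegral.of_pow (Nat.pos_of_ne_zero hn) (by rw [hm x hx]; exact isIntegral_one)
  have : NumberField K := { to_charZero := inferInstance, to_finiteDimensional := this }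
  have hex : ∀ s : Multiset ℂ, (∀ z ∈ s, z ∈ m) →
      ∃ t : Multiset K, t.map (fun z : K => (z : ℂ)) = s := by
    intro s
    induction s using Multiset.induction_on with
    | empty => exact fun _ => ⟨0, rfl⟩
    | cons a s ih =>
      intro h
      obtain ⟨t, ht⟩ := ih fun z hz => h z (Multiset.mem_cons_of_mem hz)
      refine ⟨⟨a, IntermediateField.subset_adjoin ℚ S (h a (Multiset.mem_cons_self a s))⟩ ::ₘ t, ?_⟩
      simp [ht]
  obtain ⟨t, ht⟩ := hex m fun _ h => h
  have hcard : t.card = m.card := by rw [← ht, Multiset.card_map]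
  have htp : ∀ z ∈ t, z ^ n = 1 := by
    intro z hz
    have : (z : ℂ) ∈ m := by rw [← ht]; exact Multiset.mem_map_of_mem _ hz
    exact Subtype.ext (by simpa using hm _ this)
  have hval : ((t.sum / t.card : K) : ℂ) = m.sum / m.card := by
    rw [hcard]; push_cast
    rw [show t.map Subtype.val = m from ht]
  have hx0 : (t.sum / t.card : K) ≠ 0 := fun h => h0 (by rw [← hval, h]; rfl)
  have hxi : IsIntegral ℤ (t.sum / t.card : K) := by
    rw [← hval] at hint
    exact (isIntegral_algebraMap_iff (B := ℂ) (algebraMap K ℂ).injective).1 hint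
  have hmc : (m.card : ℝ) ≠ 0 := by
    intro h; apply h0; have : m.card = 0 := by exact_mod_cast h
    simp [this]
  -- Kronecker: each embedding maps the mean to a mean of roots of unity, so all conjugates have
  -- modulus at most one, and a nonzero algebraic integer of this kind is a root of unity.
  obtain ⟨k, hk, hxk⟩ := NumberField.Embeddings.pow_eq_one_of_norm_le_one K ℂ hx0 hxi fun φ => by
    rw [map_div₀, map_natCast, hcard, norm_div, map_multiset_sum]
    have h1 := multiset_norm_sum_le (t.map φ) (by
      intro z hz
      obtain ⟨w, hw, rfl⟩ := Multiset.mem_map.1 hz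
      exact Complex.norm_eq_one_of_pow_eq_one (by rw [← map_pow, htp w hw, map_one]) hn)
    rw [Multiset.card_map, hcard] at h1
    rw [RCLike.norm_natCast]
    exact div_le_one_of_le₀ h1 (by positivity)
  refine Complex.norm_eq_one_of_pow_eq_one (n := k) ?_ hk.ne'
  rw [← hval]
  exact_mod_cast congrArg (fun z : K => (z : ℂ)) hxk

/-- A complex matrix of finite order whose normalized trace is a nonzero algebraic integer is
scalar. -/
theorem Matrix.eq_smul_one_of_isIntegral {d : ℕ} (A : Matrix (Fin d) (Fin d) ℂ) {n : ℕ}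
    (hn : n ≠ 0) (hA : A ^ n = 1) (hint : IsIntegral ℤ (A.trace / d)) (h0 : A.trace ≠ 0) :
    ∃ c : ℂ, A = c • 1 := by
  have hd : d ≠ 0 := by
    rintro rfl; exact h0 (by simp [Matrix.trace])
  have hNe : Nonempty (Fin d) := ⟨⟨0, Nat.pos_of_ne_zero hd⟩⟩
  have hroots : ∀ z ∈ A.charpoly.roots, z ^ n = 1 := by
    intro z hz
    have h1 : z ∈ spectrum ℂ A := Matrix.mem_spectrum_iff_isRoot_charpoly.2 (isRoot_of_mem_roots hz)
    have h2 : z ^ n ∈ spectrum ℂ (A ^ n) := spectrum.pow_mem_pow A n h1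
    rw [hA] at h2
    have := Matrix.mem_spectrum_iff_isRoot_charpoly.1 h2
    simpa [Matrix.charpoly_one, IsRoot, sub_eq_zero, hd] using this
  have hcard : A.charpoly.roots.card = d := by
    rw [← (IsAlgClosed.splits A.charpoly).natDegree_eq_card_roots, Matrix.charpoly_natDegree_eq_dim,
      Fintype.card_fin]
  have htr := Matrix.trace_eq_sum_roots_charpoly A
  have hdc : (d : ℂ) ≠ 0 := by exact_mod_cast hd
  have h1 := norm_mean_eq_one_of_isIntegral A.charpoly.roots hn hroots
    (by rw [hcard, ← htr]; exact hint) (by rw [hcard, ← htr]; exact div_ne_zero h0 hdc)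
  rw [hcard, ← htr] at h1
  set u := A.trace / d with hu
  -- Equality in the triangle inequality: unit eigenvalues whose mean `u` has modulus one all equal
  -- `u`.
  have h2 : ∀ z ∈ A.charpoly.roots, z = u := by
    refine (multiset_norm_sum_re_le _ u h1 fun z hz =>
      Complex.norm_eq_one_of_pow_eq_one (hroots z hz) hn).2 ?_
    rw [← htr, hcard]
    have h3 : A.trace = d * u := by rw [hu]; field_simp
    rw [h3, mul_assoc, Complex.mul_conj, Complex.normSq_eq_norm_sq, h1]
    simp
  refine ⟨u, ?_⟩
  have h3 : A.charpoly = (X - C u) ^ d := by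
    have h4 := (IsAlgClosed.splits A.charpoly).eq_prod_roots_of_monic (Matrix.charpoly_monic A)
    rw [h4, Multiset.eq_replicate.2 ⟨hcard, h2⟩]; simp
  let f : Module.End ℂ (Fin d → ℂ) := Matrix.toLinAlgEquiv' A
  -- `f - u` is nilpotent by Cayley–Hamilton and semisimple because `f` is annihilated by the
  -- separable polynomial `X ^ n - 1`; so it vanishes.
  have hnil : IsNilpotent (f - u • 1) := by
    refine ⟨d, ?_⟩
    have h5 := Matrix.aeval_self_charpoly A
    rw [h3] at h5
    simp only [map_pow, map_sub, aeval_X, aeval_C] at h5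
    have h6 : f - u • 1 = Matrix.toLinAlgEquiv' (A - algebraMap ℂ _ u) := by
      rw [map_sub, AlgEquiv.commutes, Algebra.algebraMap_eq_smul_one]
    rw [h6, ← map_pow, h5, map_zero]
  have hss : f.IsSemisimple := by
    have hsq : Squarefree (X ^ n - 1 : ℂ[X]) := by
      have := Polynomial.separable_X_pow_sub_C (n := n) (1 : ℂ) (by exact_mod_cast hn) one_ne_zero
      simpa using this.squarefree
    refine Module.End.isSemisimple_of_squarefree_aeval_eq_zero hsq ?_
    simp only [map_sub, map_pow, aeval_X, map_one]
    rw [show f ^ n = Matrix.toLinAlgEquiv' (A ^ n) from (map_pow _ _ _).symm, hA, map_one, sub_self]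
  have hss' : (f - u • 1).IsSemisimple := by
    rw [← Algebra.algebraMap_eq_smul_one]
    exact (Module.End.isSemisimple_sub_algebraMap_iff).2 hss
  have h7 := Module.End.eq_zero_of_isNilpotent_isSemisimple hnil hss'
  have h8 : Matrix.toLinAlgEquiv' A = Matrix.toLinAlgEquiv' (u • (1 : Matrix (Fin d) (Fin d) ℂ)) := by
    rw [map_smul, map_one]; exact sub_eq_zero.1 h7
  exact Matrix.toLinAlgEquiv'.injective h8

end Burnside

/-! ### Burnside's theorem on groups whose order has two prime divisors -/

section Burnside

universe u

open Polynomial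

/-- The trace of left multiplication on a product of matrix algebras. -/
theorem trace_mulLeft_pi_matrix {n : ℕ} (d : Fin n → ℕ)
    (x : ∀ i, Matrix (Fin (d i)) (Fin (d i)) ℂ) :
    LinearMap.trace ℂ _ (LinearMap.mulLeft ℂ x) = ∑ i, (d i : ℂ) * (x i).trace := by
  classical
  let b := Pi.basis fun i => Matrix.stdBasis ℂ (Fin (d i)) (Fin (d i))
  rw [LinearMap.trace_eq_matrix_trace ℂ b, Matrix.trace, Fintype.sum_sigma]
  refine Finset.sum_congr rfl fun i _ => ?_
  rw [Fintype.sum_prod_type]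
  have h : ∀ r s : Fin (d i), (LinearMap.toMatrix b b (LinearMap.mulLeft ℂ x)).diag ⟨i, (r, s)⟩
      = x i r r := by
    intro r s
    rw [Matrix.diag_apply, LinearMap.toMatrix_apply, LinearMap.mulLeft_apply, Pi.basis_apply,
      Pi.basis_repr, Pi.mul_apply, Pi.single_eq_same, Matrix.stdBasis_eq_single,
      Matrix.stdBasis]
    simp [Module.Basis.map_repr, Pi.basis_repr, Matrix.mul_apply, Matrix.single_apply]
  simp only [h, Finset.sum_const, Finset.card_univ, Fintype.card_fin, nsmul_eq_mul, Matrix.trace,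
    Matrix.diag_apply, Finset.mul_sum]

/-- Left multiplication by `g ≠ 1` permutes the group basis without fixed points, so the diagonal of
its matrix is zero. -/
theorem trace_mulLeft_monoidAlgebra {G : Type*} [Group G] [Finite G] (g : G) (hg : g ≠ 1) :
    LinearMap.trace ℂ _ (LinearMap.mulLeft ℂ (MonoidAlgebra.single g (1 : ℂ))) = 0 := by
  classical
  have := Fintype.ofFinite G
  let b : Module.Basis G ℂ (MonoidAlgebra ℂ G) := MonoidAlgebra.basis ..
  rw [LinearMap.trace_eq_matrix_trace ℂ b, Matrix.trace]
  refine Finset.sum_eq_zero fun h _ => ?_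
  rw [Matrix.diag_apply, LinearMap.toMatrix_apply, LinearMap.mulLeft_apply]
  have h1 : b h = MonoidAlgebra.single h 1 := by simp [b]
  rw [h1, MonoidAlgebra.single_mul_single, one_mul]
  have h2 : b.repr (MonoidAlgebra.single (g * h) 1) = Finsupp.single (g * h) 1 := by
    rw [← b.repr_self]; simp [b]
  rw [h2, Finsupp.single_apply, if_neg]
  simpa using hg


/-- **Burnside's lemma on class sizes**: a finite simple group has no conjugacy class whose size is
a nontrivial prime power. -/
theorem not_isSimpleGroup_of_ncard_conj {G : Type*} [Group G] [Finite G] (g : G) {q k : ℕ}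
    (hq : q.Prime) (hk : k ≠ 0) (hcard : (MulAction.orbit (ConjAct G) g).ncard = q ^ k) :
    ¬ IsSimpleGroup G := by
  classical
  intro hsimple
  have := Fintype.ofFinite G
  have hg1 : g ≠ 1 := by
    rintro rfl
    have : MulAction.orbit (ConjAct G) (1 : G) = {1} := by
      ext x; simp [MulAction.mem_orbit_iff, eq_comm]
    rw [this, Set.ncard_singleton] at hcard
    exact absurd hcard.symm (Nat.one_lt_pow hk hq.one_lt).ne'
  have : NeZero (Nat.card G : ℂ) := ⟨by exact_mod_cast Nat.card_pos.ne'⟩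
  obtain ⟨n, d, hd, ⟨e⟩⟩ :=
    IsSemisimpleRing.exists_algEquiv_pi_matrix_of_isAlgClosed ℂ (MonoidAlgebra ℂ G)
  let s : G → MonoidAlgebra ℂ G := fun x => MonoidAlgebra.single x 1
  have hs_mul : ∀ x y, s x * s y = s (x * y) := fun x y => by
    simp [s, MonoidAlgebra.single_mul_single]
  have hs_one : s 1 = 1 := rfl
  let ρ : ∀ i, G →* Matrix (Fin (d i)) (Fin (d i)) ℂ := fun i =>
    { toFun := fun x => e (s x) i
      map_one' := by rw [hs_one, map_one]; rfl
      map_mul' := fun x y => by rw [← hs_mul, map_mul]; rfl }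
  have htrace : ∀ x : MonoidAlgebra ℂ G, LinearMap.trace ℂ _ (LinearMap.mulLeft ℂ x) =
      ∑ i, (d i : ℂ) * (e x i).trace := by
    intro x
    rw [← trace_mulLeft_pi_matrix d (e x), ← LinearMap.trace_conj' _ e.toLinearEquiv]
    congr 1
    refine LinearMap.ext fun y => ?_
    simp [LinearEquiv.conj_apply]
  -- The regular character vanishes off the identity, which is column orthogonality against `1`.
  have horth : ∀ x : G, x ≠ 1 → ∑ i, (d i : ℂ) * (ρ i x).trace = 0 := fun x hx => by
    rw [← trace_mulLeft_monoidAlgebra x hx]; exact (htrace _).symm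
  -- a central element acts as a scalar in each factor
  have hscalar : ∀ z : MonoidAlgebra ℂ G, (∀ x, s x * z = z * s x) → ∀ i, ∃ c : ℂ, e z i = c • 1 := by
    intro z hz i
    have hcomm : ∀ x : MonoidAlgebra ℂ G, x * z = z * x := by
      intro x
      induction x using MonoidAlgebra.induction_linear with
      | zero => simp
      | add f g hf hg => rw [add_mul, mul_add, hf, hg]
      | single a b =>
        have : MonoidAlgebra.single a b = b • s a := by simp [s]
        rw [this, smul_mul_assoc, hz, mul_smul_comm]
    have h1 : ∀ M : Matrix (Fin (d i)) (Fin (d i)) ℂ, M * e z i = e z i * M := by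
      intro M
      have h2 := congrArg (fun w => e w i) (hcomm (e.symm (Pi.single i M)))
      simpa using h2
    have h3 : e z i ∈ Subalgebra.center ℂ (Matrix (Fin (d i)) (Fin (d i)) ℂ) :=
      Subalgebra.mem_center_iff.2 fun M => h1 M
    have h4 : (e z i) ∈ Set.range (Matrix.scalar (Fin (d i))) :=
      Matrix.mem_range_scalar_of_commute_single fun a b _ => (h1 _)
    obtain ⟨c, hc⟩ := h4
    exact ⟨c, by rw [← hc, Matrix.scalar_apply, Matrix.smul_one_eq_diagonal]⟩
  have hρ : ∀ i x, e (s x) i = ρ i x := fun _ _ => rfl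
  have hint_tr : ∀ i x, IsIntegral ℤ (ρ i x).trace := by
    intro i x
    have : Nonempty (Fin (d i)) := ⟨⟨0, Nat.pos_of_ne_zero (hd i).out⟩⟩
    rw [Matrix.trace_eq_sum_roots_charpoly]
    refine IsIntegral.multiset_sum fun z hz => ?_
    have h1 : z ∈ spectrum ℂ (ρ i x) :=
      Matrix.mem_spectrum_iff_isRoot_charpoly.2 (isRoot_of_mem_roots hz)
    have h2 := spectrum.pow_mem_pow (ρ i x) (Nat.card G) h1
    rw [← map_pow, pow_card_eq_one', map_one] at h2
    have h3 : z ^ Nat.card G = 1 := by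
      have := Matrix.mem_spectrum_iff_isRoot_charpoly.1 h2
      simpa [Matrix.charpoly_one, IsRoot, sub_eq_zero, (hd i).out] using this
    exact IsIntegral.of_pow (n := Nat.card G) Nat.card_pos (by rw [h3]; exact isIntegral_one)
  have hker : ∀ i, (∀ x, ρ i x = 1) ∨ Function.Injective (ρ i) := by
    intro i
    rcases (MonoidHom.normal_ker (ρ i)).eq_bot_or_eq_top with h | h
    · exact Or.inr ((MonoidHom.ker_eq_bot_iff _).1 h)
    · exact Or.inl fun x => MonoidHom.mem_ker.1 (h ▸ Subgroup.mem_top x)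
  let O : Finset G := (MulAction.orbit (ConjAct G) g).toFinset
  have hOmem : ∀ x, x ∈ O ↔ ∃ y : G, y * g * y⁻¹ = x := by
    intro x
    rw [Set.mem_toFinset, MulAction.mem_orbit_iff]
    exact ⟨fun ⟨y, hy⟩ => ⟨ConjAct.ofConjAct y, hy⟩, fun ⟨y, hy⟩ => ⟨ConjAct.toConjAct y, hy⟩⟩
  have hOcard : O.card = q ^ k := by
    rw [← hcard, Set.ncard_eq_toFinset_card']
  -- The class sum acts on a factor by an integral scalar. If `q ∤ d i`, a Bézout relation between
  -- `q ^ k` and `d i` makes `χ(g) / d i` an algebraic integer; were it nonzero, `ρ i g` would be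
  -- scalar and, `ρ i` being faithful, `g` central, against the size of its class.
  have hzero : ∀ i, ¬ (∀ x, ρ i x = 1) → ¬ q ∣ d i → (ρ i g).trace = 0 := by
    intro i hi hqd
    have hinj := (hker i).resolve_left hi
    by_contra htr
    have hdc : (d i : ℂ) ≠ 0 := by exact_mod_cast (hd i).out
    obtain ⟨c, hc⟩ := hscalar (∑ x ∈ O, s x) (by
      intro y
      rw [Finset.mul_sum, Finset.sum_mul]
      refine Finset.sum_bij (fun x _ => y * x * y⁻¹) ?_ ?_ ?_ ?_
      · intro x hx
        obtain ⟨w, rfl⟩ := (hOmem x).1 hx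
        exact (hOmem _).2 ⟨y * w, by group⟩
      · intro a _ b _ h
        exact mul_left_cancel (mul_right_cancel h)
      · intro x hx
        obtain ⟨w, rfl⟩ := (hOmem x).1 hx
        exact ⟨y⁻¹ * w * g * (y⁻¹ * w)⁻¹, (hOmem _).2 ⟨y⁻¹ * w, rfl⟩, by group⟩
      · intro x _
        rw [hs_mul, hs_mul]; congr 1; group) i
    have hcint : IsIntegral ℤ c := by
      have h1 : IsIntegral ℤ (∑ x ∈ O, s x) := by
        have h2 : ∑ x ∈ O, s x = MonoidAlgebra.mapRingHom G (Int.castRingHom ℂ)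
            (∑ x ∈ O, MonoidAlgebra.single x 1) := by
          rw [map_sum]; simp [s]
        rw [h2]
        have := Algebra.IsIntegral.of_finite ℤ (MonoidAlgebra ℤ G)
        exact (Algebra.IsIntegral.isIntegral (R := ℤ) (∑ x ∈ O, MonoidAlgebra.single x (1 : ℤ))).map
          (MonoidAlgebra.mapRingHom G (Int.castRingHom ℂ)).toIntAlgHom
      have h3 : IsIntegral ℤ (e (∑ x ∈ O, s x) i) :=
        IsIntegral.map (A := ℂ) ((Pi.evalAlgHom ℂ (fun i => Matrix (Fin (d i)) (Fin (d i)) ℂ) i).comp e.toAlgHom) h1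
      rw [hc, ← Algebra.algebraMap_eq_smul_one] at h3
      have : Nonempty (Fin (d i)) := ⟨⟨0, Nat.pos_of_ne_zero (hd i).out⟩⟩
      exact (isIntegral_algebraMap_iff
        (algebraMap ℂ (Matrix (Fin (d i)) (Fin (d i)) ℂ)).injective).1 h3
    have hctr : c * d i = (q : ℂ) ^ k * (ρ i g).trace := by
      have h1 := congrArg Matrix.trace hc
      rw [Matrix.trace_smul, Matrix.trace_one, Fintype.card_fin, map_sum, Finset.sum_apply,
        Matrix.trace_sum] at h1
      rw [← smul_eq_mul, ← h1, Finset.sum_congr rfl (g := fun _ => (ρ i g).trace),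
        Finset.sum_const, hOcard, nsmul_eq_mul]
      · push_cast; rfl
      · intro x hx
        obtain ⟨w, rfl⟩ := (hOmem x).1 hx
        rw [hρ, map_mul, Matrix.trace_mul_comm, ← map_mul, inv_mul_cancel_left]
    have hmean : IsIntegral ℤ ((ρ i g).trace / d i) := by
      have hcop : IsCoprime ((q ^ k : ℕ) : ℤ) (d i : ℤ) :=
        Nat.isCoprime_iff_coprime.2 (((Nat.Prime.coprime_iff_not_dvd hq).2 hqd).pow_left k)
      obtain ⟨a, b, hab⟩ := hcop
      have h1 : (ρ i g).trace / d i = a * c + b * (ρ i g).trace := by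
        have h2 : (a : ℂ) * (q : ℂ) ^ k + b * d i = 1 := by exact_mod_cast hab
        have h3 : c = (q : ℂ) ^ k * (ρ i g).trace / d i := by
          rw [← hctr]; field_simp
        rw [h3]
        field_simp
        linear_combination -h2
      rw [h1]
      exact ((isIntegral_algebraMap (R := ℤ) (A := ℂ) (x := a)).mul hcint).add
        ((isIntegral_algebraMap (R := ℤ) (A := ℂ) (x := b)).mul (hint_tr i g))
    obtain ⟨c', hc'⟩ := Matrix.eq_smul_one_of_isIntegral (ρ i g) (n := Nat.card G)
      Nat.card_pos.ne' (by rw [← map_pow, pow_card_eq_one', map_one]) hmean htr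
    have hcen : ∀ y : G, y * g * y⁻¹ = g := by
      intro y
      rw [mul_inv_eq_iff_eq_mul]
      apply hinj
      rw [map_mul, map_mul, hc']
      simp
    have : O = {g} := by
      ext x
      rw [hOmem, Finset.mem_singleton]
      exact ⟨fun ⟨y, hy⟩ => by rw [← hy, hcen], fun h => ⟨1, by simp [h]⟩⟩
    rw [this, Finset.card_singleton] at hOcard
    exact absurd hOcard (Nat.one_lt_pow hk hq.one_lt).ne
  -- The factors with trivial action contribute `1` in total: compare traces of multiplication by
  -- the sum of all group elements, which is zero on every other factor. That there is just one such
  -- factor is not needed.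
  have htriv : ∑ i, (if ∀ x, ρ i x = 1 then (d i : ℂ) * d i else 0) = 1 := by
    have hN : ∀ y, s y * ∑ x, s x = ∑ x, s x := by
      intro y
      rw [Finset.mul_sum]
      simp only [hs_mul]
      exact Fintype.sum_equiv (Equiv.mulLeft y) _ _ fun _ => rfl
    have hN' : ∀ y, (∑ x, s x) * s y = ∑ x, s x := by
      intro y
      rw [Finset.sum_mul]
      simp only [hs_mul]
      exact Fintype.sum_equiv (Equiv.mulRight y) _ _ fun _ => rfl
    have h1 := htrace (∑ x, s x)
    have h2 : LinearMap.trace ℂ _ (LinearMap.mulLeft ℂ (∑ x, s x)) = Nat.card G := by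
      have h3 : LinearMap.mulLeft ℂ (∑ x, s x) = ∑ x, LinearMap.mulLeft ℂ (s x) :=
        map_sum (LinearMap.mul ℂ (MonoidAlgebra ℂ G)) _ _
      rw [h3, map_sum, Finset.sum_eq_single 1]
      · rw [hs_one, LinearMap.mulLeft_one, LinearMap.trace_id, Module.finrank_eq_card_basis
          (MonoidAlgebra.basis G ℂ), ← Nat.card_eq_fintype_card]
      · exact fun x _ hx => trace_mulLeft_monoidAlgebra x hx
      · simp
    rw [h2] at h1
    have hGc : (Nat.card G : ℂ) ≠ 0 := by exact_mod_cast Nat.card_pos.ne'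
    have h4 : ∀ i, (d i : ℂ) * (e (∑ x, s x) i).trace =
        Nat.card G * (if ∀ x, ρ i x = 1 then (d i : ℂ) * d i else 0) := by
      intro i
      split_ifs with hi
      · rw [map_sum, Finset.sum_apply, Matrix.trace_sum, Finset.sum_congr rfl fun x _ => by
          rw [hρ, hi, Matrix.trace_one]]
        simp
        ring
      · obtain ⟨c, hc⟩ := hscalar (∑ x, s x) (fun x => by rw [hN, hN']) i
        push Not at hi
        obtain ⟨x, hx⟩ := hi
        have h5 : ρ i x * e (∑ x, s x) i = e (∑ x, s x) i := by
          rw [← hρ, ← Pi.mul_apply, ← map_mul, hN]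
        rw [hc, mul_smul_comm, mul_one] at h5
        have h6 : c = 0 := by
          by_contra hc0
          exact hx (smul_right_injective _ hc0 h5)
        rw [hc, h6]; simp
    rw [Finset.sum_congr rfl fun i _ => h4 i, ← Finset.mul_sum] at h1
    exact mul_left_cancel₀ hGc (by rw [← h1, mul_one])
  have h1 := horth g hg1
  -- Trivial factors add up to `1`, nontrivial ones of degree prime to `q` give `0`, and the rest
  -- are `q` times algebraic integers. Orthogonality becomes `1 + q w = 0`, which would make `-1 /
  -- q` an algebraic integer.
  have h2 : ∀ i, (d i : ℂ) * (ρ i g).trace = (if ∀ x, ρ i x = 1 then (d i : ℂ) * d i else 0) +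
      q * (if (∀ x, ρ i x = 1) ∨ ¬ q ∣ d i then 0 else ((d i / q : ℕ) : ℂ) * (ρ i g).trace) := by
    intro i
    by_cases hi : ∀ x, ρ i x = 1
    · simp [hi, Matrix.trace_one]
    · by_cases hqd : q ∣ d i
      · obtain ⟨m, hm⟩ := hqd
        have : d i / q = m := by rw [hm]; exact Nat.mul_div_cancel_left m hq.pos
        rw [if_neg hi, if_neg (by simp only [not_or, not_not]; exact ⟨hi, m, hm⟩), this,
          show (d i : ℂ) = q * m by rw [hm]; push_cast; rfl]
        ring
      · rw [hzero i hi hqd]; simp [hi, hqd]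
  rw [Finset.sum_congr rfl fun i _ => h2 i, Finset.sum_add_distrib, htriv, ← Finset.mul_sum] at h1
  set w := ∑ i, (if (∀ x, ρ i x = 1) ∨ ¬ q ∣ d i then 0 else ((d i / q : ℕ) : ℂ) * (ρ i g).trace)
    with hw
  have hwint : IsIntegral ℤ w := by
    refine IsIntegral.sum _ fun i _ => ?_
    split_ifs
    · exact isIntegral_zero
    · have : IsIntegral ℤ ((d i / q : ℕ) : ℂ) := by
        generalize d i / q = m
        simpa using isIntegral_algebraMap (R := ℤ) (A := ℂ) (x := (m : ℤ))
      exact this.mul (hint_tr i g)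
  have hqc : (q : ℚ) ≠ 0 := by exact_mod_cast hq.ne_zero
  have h3 : w = algebraMap ℚ ℂ (-1 / q) := by
    have hqc' : (q : ℂ) ≠ 0 := by exact_mod_cast hq.ne_zero
    simp only [map_div₀, map_neg, map_one, map_natCast]
    rw [eq_div_iff hqc']
    linear_combination h1
  rw [h3, isIntegral_algebraMap_iff (algebraMap ℚ ℂ).injective] at hwint
  obtain ⟨m, hm⟩ := IsIntegrallyClosed.isIntegral_iff.1 hwint
  have h4 : (m : ℚ) * q = -1 := by
    rw [eq_div_iff hqc] at hm; simpa using hm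
  have h5 : m * (q : ℤ) = -1 := by exact_mod_cast h4
  have h6 : (q : ℤ) ∣ 1 := ⟨-m, by linarith⟩
  exact hq.one_lt.ne' (by exact_mod_cast Int.eq_one_of_dvd_one (by positivity) h6)

/-- **Burnside's theorem**: a finite group whose order has at most two prime divisors is
solvable. -/
theorem isSolvable_of_two_primes {p q : ℕ} (n : ℕ) :
    ∀ (G : Type u) [Group G] [Finite G], Nat.card G = n →
      (∀ r : ℕ, r.Prime → r ∣ Nat.card G → r = p ∨ r = q) → Group.IsSolvable G := by
  induction n using Nat.strong_induction_on with
  | _ n ih =>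
  intro G _ _ hn hG
  by_cases htriv : Subsingleton G
  · exact Group.isSolvable_of_comm fun a b => Subsingleton.elim _ _
  rw [not_subsingleton_iff_nontrivial] at htriv
  by_cases hnorm : ∃ N : Subgroup G, N.Normal ∧ N ≠ ⊥ ∧ N ≠ ⊤
  · obtain ⟨N, hN, hbot, htop⟩ := hnorm
    have h1 : Nat.card N < n := by
      rw [← hn]
      refine lt_of_le_of_ne (Nat.le_of_dvd Nat.card_pos N.card_subgroup_dvd_card) fun h => htop ?_
      exact Subgroup.eq_top_of_card_eq N h
    have h2 : Nat.card (G ⧸ N) < n := by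
      rw [← hn, Subgroup.card_eq_card_quotient_mul_card_subgroup N]
      refine lt_mul_of_one_lt_right Nat.card_pos ?_
      exact Subgroup.one_lt_card_iff_ne_bot N |>.2 hbot
    have s1 := ih _ h1 N rfl fun r hr hd => hG r hr (hd.trans N.card_subgroup_dvd_card)
    have s2 := ih _ h2 (G ⧸ N) rfl fun r hr hd => hG r hr (hd.trans N.card_quotient_dvd_card)
    exact (Group.isSolvable_iff_subgroup_quotient N).2 ⟨s1, s2⟩
  · push Not at hnorm
    have hsimple : IsSimpleGroup G := ⟨fun N hN => by
      by_cases h : N = ⊥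
      · exact Or.inl h
      · exact Or.inr (hnorm N hN h)⟩
    by_cases hcomm : ∀ a b : G, a * b = b * a
    · exact Group.isSolvable_of_comm hcomm
    exfalso
    obtain ⟨r, hr, hrd⟩ := Nat.exists_prime_and_dvd (Finite.one_lt_card (α := G)).ne'
    have : Fact r.Prime := ⟨hr⟩
    obtain ⟨P⟩ := Sylow.nonempty (p := r) (G := G)
    have hPne : (P : Subgroup G) ≠ ⊥ := P.ne_bot_of_dvd_card hrd
    have hPn : Nontrivial P := (Subgroup.nontrivial_iff_ne_bot _).2 hPne
    -- A nontrivial central element of a Sylow `r`-subgroup has a class of size prime to `r`, hence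
    -- a power of the other prime.
    have hcn := P.isPGroup'.center_nontrivial
    obtain ⟨z, hz⟩ := exists_ne (1 : Subgroup.center P)
    let g : G := ((z : P) : G)
    have hg1 : g ≠ 1 := fun h => hz (Subtype.ext (Subtype.ext h))
    have hPc : (P : Subgroup G) ≤ Subgroup.centralizer {g} := by
      intro x hx
      rw [Subgroup.mem_centralizer_singleton_iff]
      exact (congrArg Subtype.val (Subgroup.mem_center_iff.1 z.2 ⟨x, hx⟩))
    have hidx : (MulAction.orbit (ConjAct G) g).ncard = (Subgroup.centralizer {g}).index := by
      have h1 := MulAction.index_stabilizer (ConjAct G) g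
      rw [← h1]
      have h2 := Subgroup.nat_card_centralizer_nat_card_stabilizer g
      have h3 := Subgroup.card_mul_index (Subgroup.centralizer {g})
      have h4 := Subgroup.card_mul_index (MulAction.stabilizer (ConjAct G) g)
      rw [← h2] at h4
      have h5 : Nat.card (ConjAct G) = Nat.card G := rfl
      rw [h5, ← h3] at h4
      exact Nat.eq_of_mul_eq_mul_left Nat.card_pos h4
    have hdvd : (Subgroup.centralizer {g}).index ∣ (P : Subgroup G).index :=
      Subgroup.index_dvd_of_le hPc
    have hrnd : ¬ r ∣ (Subgroup.centralizer {g}).index := fun h => P.not_dvd_index (h.trans hdvd)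
    have hone : (Subgroup.centralizer {g}).index ≠ 1 := by
      intro h
      rw [Subgroup.index_eq_one] at h
      have hgc : g ∈ Subgroup.center G := by
        rw [Subgroup.mem_center_iff]
        intro x
        exact Subgroup.mem_centralizer_singleton_iff.1 (h ▸ Subgroup.mem_top x)
      have h1 : Subgroup.center G = ⊤ := by
        rcases (inferInstance : (Subgroup.center G).Normal).eq_bot_or_eq_top with h2 | h2
        · rw [h2, Subgroup.mem_bot] at hgc; exact absurd hgc hg1
        · exact h2
      refine hcomm fun a b => ?_
      exact (Subgroup.mem_center_iff.1 (h1 ▸ Subgroup.mem_top b) a)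
    obtain ⟨l, hl, hld⟩ := Nat.exists_prime_and_dvd hone
    have hpow : ∃ k, (Subgroup.centralizer {g}).index = l ^ k := by
      refine ⟨_, Nat.eq_prime_pow_of_unique_prime_dvd Subgroup.index_ne_zero_of_finite ?_⟩
      intro t ht htd
      have hdG : ∀ {t}, t ∣ (Subgroup.centralizer {g}).index → t ∣ Nat.card G :=
        fun h => h.trans (Subgroup.index_dvd_card _)
      have a1 := hG t ht (hdG htd)
      have a2 := hG l hl (hdG hld)
      have a3 := hG r hr hrd
      have b1 : t ≠ r := by rintro rfl; exact hrnd htd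
      have b2 : l ≠ r := by rintro rfl; exact hrnd hld
      grind
    obtain ⟨k, hk⟩ := hpow
    refine not_isSimpleGroup_of_ncard_conj g hl (k := k) ?_ (hidx.trans hk) hsimple
    rintro rfl
    exact hone (by rw [hk, pow_zero])

end Burnside

/-! ### Elements of prime power order -/

section Elements

variable {G : Type*} [Group G]

/-- `x` is an `r`-element: its order is a power of `r`. -/
def IsPElt (r : ℕ) (x : G) : Prop := ∃ k : ℕ, x ^ r ^ k = 1

theorem IsPElt.one (r : ℕ) : IsPElt r (1 : G) := ⟨0, one_pow _⟩

theorem IsPElt.pow {r : ℕ} {x : G} (h : IsPElt r x) (n : ℕ) : IsPElt r (x ^ n) := by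
  obtain ⟨k, hk⟩ := h
  exact ⟨k, by rw [← pow_mul, mul_comm, pow_mul, hk, one_pow]⟩

theorem IsPElt.zpow {r : ℕ} {x : G} (h : IsPElt r x) (n : ℤ) : IsPElt r (x ^ n) := by
  obtain ⟨k, hk⟩ := h
  exact ⟨k, by rw [← zpow_natCast, ← zpow_mul, mul_comm, zpow_mul, zpow_natCast, hk, one_zpow]⟩

theorem IsPElt.inv {r : ℕ} {x : G} (h : IsPElt r x) : IsPElt r x⁻¹ := by
  simpa using h.zpow (-1)

theorem IsPElt.of_mem_zpowers {r : ℕ} {x y : G} (h : IsPElt r x) (hy : y ∈ zpowers x) :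
    IsPElt r y := by
  obtain ⟨n, rfl⟩ := hy
  exact h.zpow n

theorem IsPElt.map {r : ℕ} {x : G} (h : IsPElt r x) {H : Type*} [Group H] (f : G →* H) :
    IsPElt r (f x) := by
  obtain ⟨k, hk⟩ := h
  exact ⟨k, by rw [← map_pow, hk, map_one]⟩

theorem IsPElt.mul_of_commute {r : ℕ} {x y : G} (hx : IsPElt r x) (hy : IsPElt r y)
    (h : Commute x y) : IsPElt r (x * y) := by
  obtain ⟨k, hk⟩ := hx
  obtain ⟨l, hl⟩ := hy
  exact ⟨k + l, by
    rw [h.mul_pow, pow_add, pow_mul, hk, one_pow, one_mul, mul_comm, pow_mul, hl, one_pow]⟩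

theorem IsPGroup.isPElt {r : ℕ} {H : Subgroup G} (hH : IsPGroup r H) {x : G} (hx : x ∈ H) :
    IsPElt r x := by
  obtain ⟨k, hk⟩ := isPGroup_iff_pow_pow_eq_one.1 hH ⟨x, hx⟩
  exact ⟨k, by simpa using congrArg Subtype.val hk⟩

theorem isPGroup_of_isPElt {r : ℕ} {H : Subgroup G} (h : ∀ x ∈ H, IsPElt r x) : IsPGroup r H := by
  rw [isPGroup_iff_pow_pow_eq_one]
  rintro ⟨x, hx⟩
  obtain ⟨k, hk⟩ := h x hx
  exact ⟨k, Subtype.ext (by simpa using hk)⟩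

theorem IsPElt.isPGroup_zpowers {r : ℕ} {x : G} (h : IsPElt r x) : IsPGroup r (zpowers x) :=
  isPGroup_of_isPElt fun _ hy => h.of_mem_zpowers hy

theorem isPElt_coe {r : ℕ} {H : Subgroup G} {x : H} : IsPElt r (x : G) ↔ IsPElt r x :=
  ⟨fun ⟨k, hk⟩ => ⟨k, Subtype.ext (by simpa using hk)⟩, fun h => h.map H.subtype⟩

/-- A power prime to `r` of an `r`-element generates the same cyclic subgroup. -/
theorem IsPElt.mem_zpowers_pow {r : ℕ} {x : G} (h : IsPElt r x) {n : ℕ} (hn : r.Coprime n) :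
    x ∈ zpowers (x ^ n) := by
  obtain ⟨k, hk⟩ := h
  have hc : IsCoprime ((r ^ k : ℕ) : ℤ) (n : ℤ) := Nat.isCoprime_iff_coprime.2 (hn.pow_left k)
  obtain ⟨a, b, hab⟩ := hc
  refine ⟨b, ?_⟩
  have h1 : x ^ ((r ^ k : ℕ) : ℤ) = 1 := by rw [zpow_natCast]; exact hk
  calc (x ^ n) ^ b = (x ^ ((r ^ k : ℕ) : ℤ)) ^ a * (x ^ (n : ℤ)) ^ b := by
        rw [h1, one_zpow, one_mul, zpow_natCast]
    _ = x ^ (a * ((r ^ k : ℕ) : ℤ) + b * n) := by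
        rw [← zpow_mul, ← zpow_mul, ← zpow_add]; ring_nf
    _ = x := by rw [hab, zpow_one]

theorem IsPElt.eq_one_of_pow {r : ℕ} {x : G} (h : IsPElt r x) {n : ℕ} (hn : r.Coprime n)
    (hx : x ^ n = 1) : x = 1 := by
  have := h.mem_zpowers_pow hn
  rw [hx] at this
  simpa using this

theorem IsPElt.eq_one_of_ne {r s : ℕ} (hr : r.Prime) (hs : s.Prime) (hrs : r ≠ s) {x : G}
    (h : IsPElt r x) (h' : IsPElt s x) : x = 1 := by
  obtain ⟨k, hk⟩ := h'
  exact h.eq_one_of_pow (((Nat.coprime_primes hr hs).2 hrs).pow_right k) hk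

theorem IsPElt.exists_orderOf_eq {r : ℕ} (hr : r.Prime) {x : G} (h : IsPElt r x) (hx : x ≠ 1) :
    ∃ n : ℕ, orderOf (x ^ n) = r := by
  classical
  have hf : Fact r.Prime := ⟨hr⟩
  have hex : ∃ k, x ^ r ^ k = 1 := h
  have h1 := Nat.find_spec hex
  have h0 : Nat.find hex ≠ 0 := fun h0 => hx (by simpa [h0] using h1)
  obtain ⟨m, hm⟩ := Nat.exists_eq_succ_of_ne_zero h0
  refine ⟨r ^ m, orderOf_eq_prime ?_ ?_⟩
  · rw [← pow_mul, ← pow_succ]; rwa [hm] at h1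
  · exact Nat.find_min hex (by omega)

theorem IsPElt.of_orderOf_eq {r : ℕ} {x : G} (h : orderOf x = r) : IsPElt r x :=
  ⟨1, by rw [pow_one, ← h, pow_orderOf_eq_one]⟩

/-- If `yny⁻¹ = nc` where `c` commutes with `y` and has order prime to that of `y`, then `y` and `n`
commute. -/
theorem commute_of_commutator_commute {r s : ℕ} (hr : r.Prime) (hs : s.Prime) (hrs : r ≠ s)
    {y n : G} (hy : IsPElt s y) (hc : IsPElt r (n⁻¹ * (y * n * y⁻¹)))
    (hcomm : Commute y (n⁻¹ * (y * n * y⁻¹))) : Commute y n := by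
  set c := n⁻¹ * (y * n * y⁻¹) with hcdef
  -- As `c` commutes with `y`, conjugating `k` times by `y` multiplies `n` by `c ^ k`; the order of
  -- `y` therefore kills `c`.
  have h1 : ∀ k : ℕ, y ^ k * n * (y ^ k)⁻¹ = n * c ^ k := by
    intro k
    induction k with
    | zero => simp
    | succ k ih =>
      calc y ^ (k + 1) * n * (y ^ (k + 1))⁻¹ = y * (y ^ k * n * (y ^ k)⁻¹) * y⁻¹ := by
            rw [pow_succ']; group
        _ = (y * n * y⁻¹) * (y * c ^ k * y⁻¹) := by rw [ih]; group
        _ = n * c * c ^ k := by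
            rw [(hcomm.pow_right k).eq, mul_inv_cancel_right]; simp [hcdef, mul_assoc]
        _ = n * c ^ (k + 1) := by rw [pow_succ', mul_assoc]
  obtain ⟨k, hk⟩ := hy
  have h2 := h1 (s ^ k)
  rw [hk] at h2
  have h3 : c ^ s ^ k = 1 := by simpa using h2.symm
  have h4 : c = 1 := hc.eq_one_of_pow (((Nat.coprime_primes hr hs).2 hrs).pow_right k) h3
  rw [hcdef, inv_mul_eq_one, eq_mul_inv_iff_mul_eq] at h4
  exact h4.symm

variable [Finite G]

/-- An element of a finite group whose order has at most two prime divisors `p` and `q` is the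
product of its `p`-part and its `q`-part. -/
theorem exists_pow_mul_pow {p q : ℕ} (hp : p.Prime) (hq : q.Prime) (hpq : p ≠ q)
    (hG : ∀ r : ℕ, r.Prime → r ∣ Nat.card G → r = p ∨ r = q) (g : G) :
    ∃ a b : ℕ, g = g ^ a * g ^ b ∧ IsPElt p (g ^ a) ∧ IsPElt q (g ^ b) := by
  obtain ⟨i, m, hm, hi⟩ := Nat.exists_eq_pow_mul_and_not_dvd (orderOf_pos g).ne' p hp.ne_one
  have hmq : ∃ j, m = q ^ j := by
    refine ⟨_, Nat.eq_prime_pow_of_unique_prime_dvd ?_ ?_⟩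
    · rintro rfl; simp at hm
    · intro d hd hdm
      rcases hG d hd (((hdm.mul_left _).trans hi.symm.dvd).trans (orderOf_dvd_natCard g)) with h | h
      · exact absurd (h ▸ hdm) hm
      · exact h
  obtain ⟨j, rfl⟩ := hmq
  have hc : IsCoprime ((p ^ i : ℕ) : ℤ) ((q ^ j : ℕ) : ℤ) :=
    Nat.isCoprime_iff_coprime.2 (((Nat.coprime_primes hp hq).2 hpq).pow i j)
  obtain ⟨a, b, hab⟩ := hc
  have hpw : ∀ z : ℤ, ∃ n : ℕ, g ^ z = g ^ n := fun z => by
    obtain ⟨n, hn⟩ := (mem_powers_iff_mem_zpowers (x := g)).2 ⟨z, rfl⟩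
    exact ⟨n, hn.symm⟩
  obtain ⟨n₁, h₁⟩ := hpw (b * ((q ^ j : ℕ) : ℤ))
  obtain ⟨n₂, h₂⟩ := hpw (a * ((p ^ i : ℕ) : ℤ))
  have ho : g ^ (((p ^ i : ℕ) : ℤ) * ((q ^ j : ℕ) : ℤ)) = 1 := by
    rw [← Nat.cast_mul, zpow_natCast, ← hi, pow_orderOf_eq_one]
  refine ⟨n₁, n₂, ?_, ⟨i, ?_⟩, ⟨j, ?_⟩⟩
  · rw [← h₁, ← h₂, ← zpow_add, add_comm, hab, zpow_one]
  · rw [← h₁, ← zpow_natCast, ← zpow_mul]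
    rw [show b * ((q ^ j : ℕ) : ℤ) * ((p ^ i : ℕ) : ℤ)
      = (((p ^ i : ℕ) : ℤ) * ((q ^ j : ℕ) : ℤ)) * b by ring, zpow_mul, ho, one_zpow]
  · rw [← h₂, ← zpow_natCast, ← zpow_mul]
    rw [show a * ((p ^ i : ℕ) : ℤ) * ((q ^ j : ℕ) : ℤ)
      = (((p ^ i : ℕ) : ℤ) * ((q ^ j : ℕ) : ℤ)) * a by ring, zpow_mul, ho, one_zpow]

end Elements

/-! ### Cyclicizers and tidiness -/

section Cyc

variable {G : Type*} [Group G]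

theorem mem_cyc_of_mem_zpowers {x g z : G} (hx : x ∈ zpowers z) (hg : g ∈ zpowers z) :
    g ∈ cyc G x := by
  have h : closure ({x, g} : Set G) ≤ zpowers z := by
    rw [closure_le]
    rintro a (rfl | rfl)
    · exact hx
    · exact hg
  exact isCyclic_of_injective (inclusion h) (inclusion_injective h)

/-- The generator can be taken inside `⟨x, g⟩`; it then inherits membership in subgroups and
commutation relations from `x` and `g`. -/
theorem mem_cyc_iff {x g : G} :
    g ∈ cyc G x ↔ ∃ z ∈ closure ({x, g} : Set G), x ∈ zpowers z ∧ g ∈ zpowers z := by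
  refine ⟨fun h => ?_, fun ⟨z, _, hx, hg⟩ => mem_cyc_of_mem_zpowers hx hg⟩
  have h' : IsCyclic (closure ({x, g} : Set G)) := h
  obtain ⟨⟨z, hz⟩, hgen⟩ := h'.exists_generator
  have key : ∀ a ∈ closure ({x, g} : Set G), a ∈ zpowers z := by
    intro a ha
    obtain ⟨n, hn⟩ := hgen ⟨a, ha⟩
    exact ⟨n, by simpa using congrArg Subtype.val hn⟩
  exact ⟨z, hz, key x (subset_closure (by simp)), key g (subset_closure (by simp))⟩

theorem mem_cyc_iff' {x g : G} : g ∈ cyc G x ↔ ∃ z, x ∈ zpowers z ∧ g ∈ zpowers z :=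
  ⟨fun h => let ⟨z, _, h⟩ := mem_cyc_iff.1 h; ⟨z, h⟩, fun ⟨_, h⟩ => mem_cyc_of_mem_zpowers h.1 h.2⟩

theorem one_mem_cyc (x : G) : 1 ∈ cyc G x :=
  mem_cyc_of_mem_zpowers (mem_zpowers x) (one_mem _)

theorem inv_mem_cyc {x g : G} (h : g ∈ cyc G x) : g⁻¹ ∈ cyc G x := by
  obtain ⟨z, hx, hg⟩ := mem_cyc_iff'.1 h
  exact mem_cyc_of_mem_zpowers hx (inv_mem hg)

theorem commute_of_mem_zpowers {x g z : G} (hx : x ∈ zpowers z) (hg : g ∈ zpowers z) :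
    Commute x g := by
  obtain ⟨m, rfl⟩ := hx
  obtain ⟨n, rfl⟩ := hg
  exact (Commute.refl z).zpow_zpow m n

theorem commute_of_mem_cyc {x g : G} (h : g ∈ cyc G x) : Commute x g := by
  obtain ⟨z, hx, hg⟩ := mem_cyc_iff'.1 h
  exact commute_of_mem_zpowers hx hg

theorem mem_cyc_of_mem_zpowers_right {x g w : G} (h : g ∈ cyc G x) (hw : w ∈ zpowers g) :
    w ∈ cyc G x := by
  obtain ⟨z, hx, hg⟩ := mem_cyc_iff'.1 h
  exact mem_cyc_of_mem_zpowers hx (zpowers_le.2 hg hw)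

theorem mem_cyc_of_mem_zpowers_left {x g w : G} (h : g ∈ cyc G x) (hw : w ∈ zpowers x) :
    g ∈ cyc G w := by
  obtain ⟨z, hx, hg⟩ := mem_cyc_iff'.1 h
  exact mem_cyc_of_mem_zpowers (zpowers_le.2 hx hw) hg

theorem map_mem_cyc {x g : G} (h : g ∈ cyc G x) {H : Type*} [Group H] (f : G →* H) :
    f g ∈ cyc H (f x) := by
  obtain ⟨z, ⟨m, rfl⟩, ⟨n, rfl⟩⟩ := mem_cyc_iff'.1 h
  exact mem_cyc_of_mem_zpowers (z := f z) ⟨m, by simp⟩ ⟨n, by simp⟩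

theorem conj_mem_cyc {x g : G} (h : g ∈ cyc G x) {a : G} (ha : Commute a x) :
    a * g * a⁻¹ ∈ cyc G x := by
  have := map_mem_cyc h (MulAut.conj a).toMonoidHom
  simpa [ha.eq] using this

theorem coe_mem_cyc {H : Subgroup G} {x g : H} : (g : G) ∈ cyc G (x : G) ↔ g ∈ cyc H x := by
  refine ⟨fun h => ?_, fun h => map_mem_cyc h H.subtype⟩
  obtain ⟨z, hz, ⟨m, hm⟩, ⟨n, hn⟩⟩ := mem_cyc_iff.1 h
  have hzH : z ∈ H := by
    refine (closure_le H).2 ?_ hz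
    rintro a (rfl | rfl)
    · exact x.2
    · exact g.2
  exact mem_cyc_of_mem_zpowers (z := ⟨z, hzH⟩) ⟨m, Subtype.ext (by simpa using hm)⟩
    ⟨n, Subtype.ext (by simpa using hn)⟩

theorem isTidy_iff : IsTidy G ↔ ∀ x a b : G, a ∈ cyc G x → b ∈ cyc G x → a * b ∈ cyc G x := by
  constructor
  · intro h x a b ha hb
    obtain ⟨H, hH⟩ := h x
    rw [← hH] at ha hb ⊢
    exact mul_mem ha hb
  · exact fun h x => ⟨{ carrier := cyc G x, mul_mem' := fun ha hb => h x _ _ ha hb,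
                        one_mem' := one_mem_cyc x, inv_mem' := fun ha => inv_mem_cyc ha }, rfl⟩

theorem IsTidy.mul_mem (h : IsTidy G) {x a b : G} (ha : a ∈ cyc G x) (hb : b ∈ cyc G x) :
    a * b ∈ cyc G x :=
  isTidy_iff.1 h x a b ha hb

theorem IsTidy.subgroup (h : IsTidy G) (H : Subgroup G) : IsTidy H :=
  isTidy_iff.2 fun _ _ _ ha hb => coe_mem_cyc.1 (h.mul_mem (coe_mem_cyc.2 ha) (coe_mem_cyc.2 hb))

theorem IsTidy.mul_mem_of_mem {H : Subgroup G} (h : IsTidy H) {x a b : G} (hx : x ∈ H)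
    (ha : a ∈ H) (hb : b ∈ H) (hax : a ∈ cyc G x) (hbx : b ∈ cyc G x) : a * b ∈ cyc G x := by
  have h1 : (⟨a, ha⟩ : H) ∈ cyc H ⟨x, hx⟩ := coe_mem_cyc.1 hax
  have h2 : (⟨b, hb⟩ : H) ∈ cyc H ⟨x, hx⟩ := coe_mem_cyc.1 hbx
  have h3 := map_mem_cyc (h.mul_mem h1 h2) H.subtype
  rwa [map_mul] at h3

/-- In a tidy group the cyclicizer of an element, as a subgroup. -/
def IsTidy.cycSubgroup (h : IsTidy G) (x : G) : Subgroup G where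
  carrier := cyc G x
  mul_mem' := h.mul_mem
  one_mem' := one_mem_cyc x
  inv_mem' := inv_mem_cyc

theorem mem_zpowers_mul_of_coprime {p q : ℕ} (hp : p.Prime) (hq : q.Prime) (hpq : p ≠ q) {w₁ w₂ : G}
    (h₁ : IsPElt p w₁) (h₂ : IsPElt q w₂) (hc : Commute w₁ w₂) : w₁ ∈ zpowers (w₁ * w₂) := by
  obtain ⟨k, hk⟩ := h₂
  have h := h₁.mem_zpowers_pow (((Nat.coprime_primes hp hq).2 hpq).pow_right k)
  have h3 : (w₁ * w₂) ^ q ^ k = w₁ ^ q ^ k := by rw [hc.mul_pow, hk, mul_one]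
  rw [← h3] at h
  exact zpowers_le.2 (pow_mem (mem_zpowers _) _) h

theorem mem_cyc_of_coprime {p q : ℕ} (hp : p.Prime) (hq : q.Prime) (hpq : p ≠ q) {x g : G}
    (hx : IsPElt p x) (hg : IsPElt q g) (hc : Commute x g) : g ∈ cyc G x := by
  refine mem_cyc_of_mem_zpowers (mem_zpowers_mul_of_coprime hp hq hpq hx hg hc) ?_
  rw [hc.eq]
  exact mem_zpowers_mul_of_coprime hq hp hpq.symm hg hx hc.symm

/-- The `p`-part of a cyclic pair can be joined with the `q`-part of a cyclic pair. -/
theorem mul_mem_cyc_mul {p q : ℕ} (hp : p.Prime) (hq : q.Prime) (hpq : p ≠ q) {x₁ g₁ x₂ g₂ : G}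
    (hx₁ : IsPElt p x₁) (hg₁ : IsPElt p g₁) (hx₂ : IsPElt q x₂) (hg₂ : IsPElt q g₂)
    (h₁ : g₁ ∈ cyc G x₁) (h₂ : g₂ ∈ cyc G x₂) (c₁ : Commute x₁ x₂) (c₂ : Commute x₁ g₂)
    (c₃ : Commute g₁ x₂) (c₄ : Commute g₁ g₂) : g₁ * g₂ ∈ cyc G (x₁ * x₂) := by
  obtain ⟨w₁, hw₁, hxw₁, hgw₁⟩ := mem_cyc_iff.1 h₁
  obtain ⟨w₂, hw₂, hxw₂, hgw₂⟩ := mem_cyc_iff.1 h₂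
  -- The two generators lie in the respective closures, so the four commutation hypotheses pass to
  -- them.
  have hcl : closure ({x₁, g₁} : Set G) ≤ centralizer (closure ({x₂, g₂} : Set G) : Set G) := by
    rw [closure_le, centralizer_closure]
    rintro a (rfl | rfl) <;> rw [SetLike.mem_coe, mem_centralizer_iff] <;> rintro b (rfl | rfl)
    exacts [c₁.eq.symm, c₂.eq.symm, c₃.eq.symm, c₄.eq.symm]
  have hcw : Commute w₁ w₂ := ((mem_centralizer_iff.1 (hcl hw₁)) w₂ hw₂).symm
  have hcc : Commute x₁ g₁ := commute_of_mem_cyc h₁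
  have hcc₂ : Commute x₂ g₂ := commute_of_mem_cyc h₂
  have gen : ∀ {r : ℕ} {x g : G}, Commute x g → IsPElt r x → IsPElt r g →
      ∀ w ∈ closure ({x, g} : Set G), IsPElt r w := by
    intro r x g hxg hx hg w hw
    have h1 : zpowers x ≤ normalizer (zpowers g : Set G) := by
      rw [zpowers_le]
      refine centralizer_le_normalizer _ ?_
      rw [mem_centralizer_iff]
      rintro b ⟨n, rfl⟩
      exact (hxg.zpow_right n).eq.symm
    have h2 := hx.isPGroup_zpowers.to_sup_of_normal_right' hg.isPGroup_zpowers h1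
    refine h2.isPElt ((closure_le _).2 ?_ hw)
    rintro a (rfl | rfl)
    · exact mem_sup_left (mem_zpowers _)
    · exact mem_sup_right (mem_zpowers _)
  have hp₁ := gen hcc hx₁ hg₁ w₁ hw₁
  have hp₂ := gen hcc₂ hx₂ hg₂ w₂ hw₂
  have m₁ := zpowers_le.2 (mem_zpowers_mul_of_coprime hp hq hpq hp₁ hp₂ hcw)
  have m₂ := zpowers_le.2 (mem_zpowers_mul_of_coprime hq hp hpq.symm hp₂ hp₁ hcw.symm)
  rw [← hcw.eq] at m₂
  exact mem_cyc_of_mem_zpowers (mul_mem (m₁ hxw₁) (m₂ hxw₂)) (mul_mem (m₁ hgw₁) (m₂ hgw₂))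

/-- A cyclic group has at most one subgroup of prime order `r`. -/
theorem mem_zpowers_of_mem_cyc [Finite G] {r : ℕ} (hr : r.Prime) {x g : G} (hx : orderOf x = r)
    (hg : g ^ r = 1) (h : g ∈ cyc G x) : g ∈ zpowers x := by
  classical
  obtain ⟨z, hxz, hgz⟩ := mem_cyc_iff'.1 h
  have := Fintype.ofFinite (zpowers z)
  let x' : zpowers z := ⟨x, hxz⟩
  let g' : zpowers z := ⟨g, hgz⟩
  have h1 := IsCyclic.card_pow_eq_one_le (α := zpowers z) hr.pos
  have hx' : orderOf x' = r := by rw [← hx]; exact (orderOf_mk x hxz)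
  have h2 : (Finset.univ.filter fun a : zpowers z => a ∈ zpowers x').card = r := by
    rw [← hx', ← Nat.card_zpowers, Nat.card_eq_fintype_card, Fintype.card_subtype]
  have h3 : (Finset.univ.filter fun a : zpowers z => a ∈ zpowers x') ⊆
      Finset.univ.filter fun a : zpowers z => a ^ r = 1 := by
    intro a ha
    rw [Finset.mem_filter] at ha ⊢
    obtain ⟨n, hn⟩ := ha.2
    refine ⟨Finset.mem_univ _, ?_⟩
    dsimp only at hn
    rw [← hn, ← hx', ← zpow_natCast, ← zpow_mul, mul_comm, zpow_mul, zpow_natCast,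
      pow_orderOf_eq_one, one_zpow]
  have h4 := Finset.eq_of_subset_of_card_le h3 (by rw [h2]; exact h1)
  have h5 : g' ∈ Finset.univ.filter fun a : zpowers z => a ^ r = 1 := by
    rw [Finset.mem_filter]
    exact ⟨Finset.mem_univ _, Subtype.ext hg⟩
  rw [← h4, Finset.mem_filter] at h5
  obtain ⟨n, hn⟩ := h5.2
  exact ⟨n, by simpa [x', g'] using congrArg Subtype.val hn⟩

/-- Tidiness of a finite `{p, q}`-group can be checked on nontrivial elements of prime power
order. -/
theorem isTidy_of_isPElt [Finite G] {p q : ℕ} (hp : p.Prime) (hq : q.Prime) (hpq : p ≠ q)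
    (hG : ∀ r : ℕ, r.Prime → r ∣ Nat.card G → r = p ∨ r = q)
    (h : ∀ x : G, x ≠ 1 → IsPElt p x ∨ IsPElt q x →
      ∀ a b : G, a ∈ cyc G x → b ∈ cyc G x → a * b ∈ cyc G x) : IsTidy G := by
  have key : ∀ x : G, ∃ x₁ x₂ : G, IsPElt p x₁ ∧ IsPElt q x₂ ∧ x₁ ∈ zpowers x ∧ x₂ ∈ zpowers x ∧
      x = x₁ * x₂ := by
    intro x
    obtain ⟨a, b, h1, h2, h3⟩ := exists_pow_mul_pow hp hq hpq hG x
    exact ⟨_, _, h2, h3, ⟨a, by simp⟩, ⟨b, by simp⟩, h1⟩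
  have h' : ∀ x : G, IsPElt p x ∨ IsPElt q x →
      ∀ a b : G, a ∈ cyc G x → b ∈ cyc G x → a * b ∈ cyc G x := by
    intro x hx a b ha hb
    by_cases h1 : x = 1
    · subst h1
      exact mem_cyc_of_mem_zpowers (one_mem _) (mem_zpowers _)
    · exact h x h1 hx a b ha hb
  rw [isTidy_iff]
  intro x a b ha hb
  obtain ⟨x₁, x₂, hx₁, hx₂, hm₁, hm₂, hx⟩ := key x
  have c₁ := h' x₁ (Or.inl hx₁) a b (mem_cyc_of_mem_zpowers_left ha hm₁)
    (mem_cyc_of_mem_zpowers_left hb hm₁)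
  have c₂ := h' x₂ (Or.inr hx₂) a b (mem_cyc_of_mem_zpowers_left ha hm₂)
    (mem_cyc_of_mem_zpowers_left hb hm₂)
  obtain ⟨g₁, g₂, hg₁, hg₂, hn₁, hn₂, hg⟩ := key (a * b)
  have e₁ := mem_cyc_of_mem_zpowers_right c₁ hn₁
  have e₂ := mem_cyc_of_mem_zpowers_right c₂ hn₂
  rw [hx, hg]
  exact mul_mem_cyc_mul hp hq hpq hx₁ hg₁ hx₂ hg₂ e₁ e₂ (commute_of_mem_zpowers hm₁ hm₂)
    (commute_of_mem_cyc (mem_cyc_of_mem_zpowers_right c₁ hn₂))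
    (commute_of_mem_cyc (mem_cyc_of_mem_zpowers_right c₂ hn₁)).symm
    (commute_of_mem_zpowers hn₁ hn₂)

/-- Membership in the cyclicizer of a `p`-element can be tested modulo a normal `q`-subgroup. -/
theorem mem_cyc_of_mk_mem_cyc [Finite G] {p q : ℕ} (hp : p.Prime) (hq : q.Prime) (hpq : p ≠ q)
    (hG : ∀ r : ℕ, r.Prime → r ∣ Nat.card G → r = p ∨ r = q) (N : Subgroup G) [N.Normal]
    (hN : IsPGroup q N) {x g : G} (hx : IsPElt p x) (hxg : Commute x g)
    (h : (g : G ⧸ N) ∈ cyc (G ⧸ N) (x : G ⧸ N)) : g ∈ cyc G x := by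
  obtain ⟨a, b, hg, hga, hgb⟩ := exists_pow_mul_pow hp hq hpq hG g
  have h1 : ((g ^ a : G) : G ⧸ N) ∈ cyc (G ⧸ N) (x : G ⧸ N) :=
    mem_cyc_of_mem_zpowers_right h ⟨a, by simp⟩
  -- `x` and the `p`-part of `g` generate a `p`-group, which meets the `q`-group `N` trivially and
  -- so embeds in the quotient.
  have h2 : g ^ a ∈ cyc G x := by
    have hc : zpowers x ≤ normalizer (zpowers (g ^ a) : Set G) := by
      rw [zpowers_le]
      refine centralizer_le_normalizer _ ?_
      rw [mem_centralizer_iff]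
      rintro b ⟨n, rfl⟩
      exact ((hxg.pow_right a).zpow_right n).eq.symm
    have hP := hx.isPGroup_zpowers.to_sup_of_normal_right' hga.isPGroup_zpowers hc
    have hle : closure ({x, g ^ a} : Set G) ≤ zpowers x ⊔ zpowers (g ^ a) := by
      rw [closure_le]
      rintro y (rfl | rfl)
      · exact mem_sup_left (mem_zpowers _)
      · exact mem_sup_right (mem_zpowers _)
    have hcl : IsCyclic (closure ({(x : G ⧸ N), ((g ^ a : G) : G ⧸ N)} : Set (G ⧸ N))) := h1
    have hmap : (closure ({x, g ^ a} : Set G)).map (QuotientGroup.mk' N) =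
        closure ({(x : G ⧸ N), ((g ^ a : G) : G ⧸ N)} : Set (G ⧸ N)) := by
      rw [MonoidHom.map_closure, Set.image_pair]; rfl
    rw [← hmap] at hcl
    refine isCyclic_of_injective ((QuotientGroup.mk' N).subgroupMap (closure ({x, g ^ a} : Set G)))
      ?_
    rw [injective_iff_map_eq_one]
    rintro ⟨y, hy⟩ hy1
    have hyN : y ∈ N := by
      rw [← QuotientGroup.eq_one_iff]
      simpa using congrArg Subtype.val hy1
    exact Subtype.ext ((hP.isPElt (hle hy)).eq_one_of_ne hp hq hpq (hN.isPElt hyN))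
  rw [hg]
  have := mul_mem_cyc_mul hp hq hpq hx hga (IsPElt.one q) hgb h2
    (mem_cyc_of_mem_zpowers (one_mem _) (mem_zpowers _)) (Commute.one_right _)
    (hxg.pow_right b) (Commute.one_right _) ((Commute.refl g).pow_pow a b)
  rwa [mul_one] at this

/-- If the `q`-elements commuting with the `p`-element `x` all lie in a normal `q`-subgroup and the
Sylow `p`-subgroups are tidy, then the cyclicizer of `x` is multiplicatively closed. -/
theorem mul_mem_cyc_of_normal [Finite G] {p q : ℕ} (hp : p.Prime) (hq : q.Prime) (hpq : p ≠ q)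
    (hG : ∀ r : ℕ, r.Prime → r ∣ Nat.card G → r = p ∨ r = q)
    (hP : ∀ P : Sylow p G, IsTidy (P : Subgroup G)) (N : Subgroup G) [N.Normal]
    (hN : IsPGroup q N) {x : G} (hx : IsPElt p x)
    (hxN : ∀ g : G, IsPElt q g → Commute x g → g ∈ N) {a b : G} (ha : a ∈ cyc G x)
    (hb : b ∈ cyc G x) : a * b ∈ cyc G x := by
  have hfp : Fact p.Prime := ⟨hp⟩
  let C := centralizer ({x} : Set G)
  have hC : ∀ g, g ∈ C ↔ Commute x g := fun g => by
    rw [mem_centralizer_singleton_iff]; exact ⟨fun h => h.symm, fun h => h.symm⟩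
  -- Here `C = S K`, and `S` contains the central element `x` of `C`. Every member of `Cyc(x)` is
  -- congruent modulo `N` to one lying in `S`, where tidiness of a Sylow subgroup permits
  -- multiplication; the product is then lifted back.
  obtain ⟨S⟩ := Sylow.nonempty (p := p) (G := C)
  let K := N.subgroupOf C
  have hxS : (⟨x, (hC x).2 (Commute.refl x)⟩ : C) ∈ S := by
    have hxn : (zpowers (⟨x, (hC x).2 (Commute.refl x)⟩ : C)).Normal := by
      refine ⟨fun n hn g => ?_⟩
      obtain ⟨m, rfl⟩ := hn
      have : Commute g (⟨x, (hC x).2 (Commute.refl x)⟩ : C) :=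
        Subtype.ext ((hC _).1 g.2).eq.symm
      rw [(this.zpow_right m).eq, mul_inv_cancel_right]
      exact ⟨m, rfl⟩
    exact IsPGroup.le_sylow_of_normal
      ((isPElt_coe (x := (⟨x, (hC x).2 (Commute.refl x)⟩ : C))).1 hx).isPGroup_zpowers S
      (mem_zpowers _)
  have hsup : (S : Subgroup C) ⊔ K = ⊤ := by
    rw [← index_eq_one]
    by_contra hne
    obtain ⟨r, hr, hrd⟩ := Nat.exists_prime_and_dvd hne
    have h1 : r ∣ (S : Subgroup C).index := hrd.trans (index_dvd_of_le le_sup_left)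
    have h2 : r ∣ K.index := hrd.trans (index_dvd_of_le le_sup_right)
    have h3 : IsPGroup p (C ⧸ K) := by
      rw [isPGroup_iff_pow_pow_eq_one]
      intro c
      induction c using QuotientGroup.induction_on with
      | H c =>
        obtain ⟨a, b, hc, hca, hcb⟩ := exists_pow_mul_pow hp hq hpq hG (c : G)
        have h4 : c ^ b ∈ K := hxN _ hcb (((hC _).1 c.2).pow_right b)
        obtain ⟨k, hk⟩ := hca
        refine ⟨k, ?_⟩
        have h5 : (c : C ⧸ K) = ((c ^ a : C) : C ⧸ K) := by
          rw [QuotientGroup.eq]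
          have h6 : c ^ b = (c ^ a)⁻¹ * c := by
            rw [eq_inv_mul_iff_mul_eq]; exact (Subtype.ext hc).symm
          have h7 : c⁻¹ * c ^ a = (c ^ b)⁻¹ := by rw [h6]; group
          rw [h7]; exact inv_mem h4
        rw [h5, ← QuotientGroup.mk_pow]
        have : (c ^ a) ^ p ^ k = 1 := Subtype.ext hk
        rw [this]; rfl
    obtain ⟨n, hn⟩ := IsPGroup.iff_card.1 h3
    have h8 : r = p := by
      rw [index_eq_card, hn] at h2
      exact (Nat.prime_dvd_prime_iff_eq hr hp).1 (hr.dvd_of_dvd_pow h2)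
    exact S.not_dvd_index (h8 ▸ h1)
  have hred : ∀ g : G, g ∈ cyc G x → ∃ s : C, s ∈ S ∧ (s : G) ∈ cyc G x ∧
      ((s : G) : G ⧸ N) = (g : G ⧸ N) := by
    intro g hg
    have hgc := commute_of_mem_cyc hg
    obtain ⟨s, hs, k, hk, hsk⟩ := mem_sup_of_normal_right.1
      (hsup ▸ mem_top (⟨g, (hC g).2 hgc⟩ : C))
    have h1 : ((s : G) : G ⧸ N) = (g : G ⧸ N) := by
      rw [QuotientGroup.eq]
      have h2 : (s : G) * k = g := congrArg Subtype.val hsk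
      rw [← h2, inv_mul_cancel_left]; exact hk
    refine ⟨s, hs, ?_, h1⟩
    refine mem_cyc_of_mk_mem_cyc hp hq hpq hG N hN hx ((hC _).1 s.2) ?_
    rw [h1]
    exact map_mem_cyc hg (QuotientGroup.mk' N)
  obtain ⟨s, hs, hsx, hsa⟩ := hred a ha
  obtain ⟨t, ht, htx, htb⟩ := hred b hb
  have hSP : IsPGroup p ((S : Subgroup C).map C.subtype) := S.isPGroup'.map _
  obtain ⟨P, hPS⟩ := hSP.exists_le_sylow
  have hmem : ∀ c : C, c ∈ S → (c : G) ∈ P := fun c hc => hPS (mem_map_of_mem C.subtype hc)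
  have hst : (s * t : G) ∈ cyc G x :=
    (hP P).mul_mem_of_mem (hmem _ hxS) (hmem s hs) (hmem t ht) hsx htx
  refine mem_cyc_of_mk_mem_cyc hp hq hpq hG N hN hx
    ((commute_of_mem_cyc ha).mul_right (commute_of_mem_cyc hb)) ?_
  have hq1 : ((a * b : G) : G ⧸ N) = (((s : G) * (t : G) : G) : G ⧸ N) := by
    rw [QuotientGroup.mk_mul, QuotientGroup.mk_mul, hsa, htb]
  rw [hq1]
  exact map_mem_cyc hst (QuotientGroup.mk' N)

end Cyc

/-! ### Coprime action on a group with one subgroup of prime order -/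

section Quaternion

variable {G : Type*} [Group G]

/-- `a` and `b` generate a quaternion group of order `8`. -/
structure QuatPair (a b : G) : Prop where
  sq_eq : b ^ 2 = a ^ 2
  conj : b * a * b⁻¹ = a⁻¹
  ne_one : a ^ 2 ≠ 1

/-- `a` and `b` generate a quaternion group of order `8` on which `y` acts as the automorphism of
order three `a ↦ b ↦ ab ↦ a`. -/
structure QuatTriple (y a b : G) : Prop extends QuatPair a b where
  map_a : y * a * y⁻¹ = b
  map_b : y * b * y⁻¹ = a * b

/-- Each exchange of `y` with `x` costs one central factor `z`, and `n * (n - 1) / 2` exchanges are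
needed to collect `(x * y) ^ n`. -/
theorem mul_pow_of_central {x y z : G} (hz : y * x = x * y * z) (hx : Commute z x)
    (hy : Commute z y) (n : ℕ) :
    y ^ n * x = x * y ^ n * z ^ n ∧ (x * y) ^ n = x ^ n * y ^ n * z ^ (n * (n - 1) / 2) := by
  have h1 : ∀ n : ℕ, y ^ n * x = x * y ^ n * z ^ n := by
    intro n
    induction n with
    | zero => simp
    | succ n ih =>
      calc y ^ (n + 1) * x = y ^ n * (y * x) := by rw [pow_succ, mul_assoc]
        _ = (y ^ n * x) * (y * z) := by rw [hz]; simp only [mul_assoc]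
        _ = x * y ^ n * (z ^ n * y) * z := by rw [ih]; simp only [mul_assoc]
        _ = x * y ^ n * (y * z ^ n) * z := by rw [(hy.pow_left n).eq]
        _ = x * y ^ (n + 1) * z ^ (n + 1) := by rw [pow_succ, pow_succ]; simp only [mul_assoc]
  refine ⟨h1 n, ?_⟩
  induction n with
  | zero => simp
  | succ n ih =>
    have hexp : (n + 1) * (n + 1 - 1) / 2 = n * (n - 1) / 2 + n := by
      rw [Nat.add_sub_cancel, ← Nat.add_mul_div_left _ _ (by norm_num : 0 < 2)]
      congr 1
      rcases n with _ | n
      · rfl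
      · simp only [Nat.add_sub_cancel]; ring
    set e := n * (n - 1) / 2
    calc (x * y) ^ (n + 1) = x ^ n * y ^ n * (z ^ e * x) * y := by
          rw [pow_succ, ih]; simp only [mul_assoc]
      _ = x ^ n * (y ^ n * x) * (z ^ e * y) := by
          rw [(hx.pow_left e).eq]; simp only [mul_assoc]
      _ = x ^ n * x * y ^ n * (z ^ n * z ^ e * y) := by rw [h1]; simp only [mul_assoc]
      _ = x ^ n * x * y ^ n * (y * (z ^ n * z ^ e)) := by
          rw [((hy.pow_left n).mul_left (hy.pow_left e)).eq]
      _ = x ^ (n + 1) * y ^ (n + 1) * z ^ ((n + 1) * (n + 1 - 1) / 2) := by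
          rw [hexp, pow_succ, pow_succ, add_comm e n, pow_add]; simp only [mul_assoc]

/-- A nontrivial `r`-subgroup `L` has a proper subgroup containing all commutators and all `r`-th
powers. -/
theorem closure_pow_commutator_lt [Finite G] {r : ℕ} (hr : r.Prime) {L : Subgroup G}
    (hL : IsPGroup r L) (hne : L ≠ ⊥) :
    closure ({x | ∃ a ∈ L, a ^ r = x} ∪ {x | ∃ a ∈ L, ∃ b ∈ L, a * b * a⁻¹ * b⁻¹ = x}) < L := by
  have hf : Fact r.Prime := ⟨hr⟩
  obtain ⟨n, hn⟩ := IsPGroup.iff_card.1 hL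
  have hn0 : n ≠ 0 := by
    rintro rfl
    exact hne (L.card_eq_one.1 (by simpa using hn))
  obtain ⟨m, rfl⟩ := Nat.exists_eq_succ_of_ne_zero hn0
  -- A subgroup of index `r` in an `r`-group is normal with cyclic quotient of order `r`, so it
  -- absorbs all commutators and `r`-th powers.
  obtain ⟨X, hX⟩ := Sylow.exists_subgroup_card_pow_prime (G := L) r (n := m)
    (by rw [hn]; exact pow_dvd_pow r (Nat.le_succ m))
  have hXi : X.index = r := by
    have := X.card_mul_index
    rw [hX, hn, pow_succ] at this
    exact Nat.eq_of_mul_eq_mul_left (pow_pos hr.pos m) this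
  have hXn : X.Normal := normal_of_index_eq_minFac_card (by
    rw [hXi, hn, Nat.Prime.pow_minFac hr (by omega)])
  have hXc : Nat.card (L ⧸ X) = r := by rw [← index_eq_card, hXi]
  have hcyc : IsCyclic (L ⧸ X) := isCyclic_of_prime_card hXc
  have hcomm : ∀ a b : L ⧸ X, a * b = b * a := fun a b =>
    (IsCyclic.isMulCommutative (α := L ⧸ X)).is_comm.comm a b
  have hle : closure ({x | ∃ a ∈ L, a ^ r = x} ∪
      {x | ∃ a ∈ L, ∃ b ∈ L, a * b * a⁻¹ * b⁻¹ = x}) ≤ X.map L.subtype := by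
    rw [closure_le]
    rintro x (⟨a, ha, rfl⟩ | ⟨a, ha, b, hb, rfl⟩)
    · refine ⟨⟨a, ha⟩ ^ r, ?_, by simp⟩
      rw [SetLike.mem_coe, ← QuotientGroup.eq_one_iff, QuotientGroup.mk_pow, ← hXc,
        pow_card_eq_one']
    · refine ⟨⟨a, ha⟩ * ⟨b, hb⟩ * ⟨a, ha⟩⁻¹ * ⟨b, hb⟩⁻¹, ?_, by simp⟩
      rw [SetLike.mem_coe, ← QuotientGroup.eq_one_iff, QuotientGroup.mk_mul, QuotientGroup.mk_mul,
        QuotientGroup.mk_mul, QuotientGroup.mk_inv, QuotientGroup.mk_inv,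
        hcomm (⟨a, ha⟩ : L) (⟨b, hb⟩ : L), mul_inv_cancel_right, mul_inv_cancel]
  refine lt_of_le_of_lt hle (lt_of_le_of_ne (map_subtype_le X) fun h => ?_)
  have : X = ⊤ := by
    refine map_injective L.subtype_injective ?_
    rw [h, ← MonoidHom.range_eq_map, L.range_subtype]
  rw [this, index_top] at hXi
  exact hr.one_lt.ne hXi


/-- Let `y` be an `s`-element normalising the `r`-group `D`, which has a unique subgroup of order
`r`, centralised by `y`. If `y` does not centralise `D`, then `D` contains a quaternion group on
which `y` acts nontrivially. -/
theorem exists_quatTriple [Finite G] {r s : ℕ} (hr : r.Prime) (hs : s.Prime) (hrs : r ≠ s)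
    {D : Subgroup G} (hD : IsPGroup r D) {y v : G} (hy : IsPElt s y)
    (hyD : ∀ d ∈ D, y * d * y⁻¹ ∈ D) (hvr : orderOf v = r) (hyv : Commute y v)
    (huniq : ∀ u ∈ D, u ^ r = 1 → u ∈ zpowers v) {d₀ : G} (hd₀ : d₀ ∈ D)
    (hyd₀ : ¬ Commute y d₀) :
    r = 2 ∧ ∃ a ∈ D, ∃ b ∈ D, a ^ 2 = v ∧ QuatTriple y a b := by
  classical
  -- Take `L` minimal among the `y`-invariant subgroups of `D` not centralised by `y`; its proper
  -- `y`-invariant subgroups are then centralised.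
  let S : Set (Subgroup G) := {L | L ≤ D ∧ (∀ d ∈ L, y * d * y⁻¹ ∈ L) ∧ ∃ d ∈ L, ¬ Commute y d}
  obtain ⟨L, hLS, hmin⟩ := (wellFounded_lt (α := Subgroup G)).has_min S
    ⟨D, le_rfl, hyD, d₀, hd₀, hyd₀⟩
  obtain ⟨hLD, hyL, l₀, hl₀, hyl₀⟩ := hLS
  have hmin' : ∀ K : Subgroup G, K < L → (∀ d ∈ K, y * d * y⁻¹ ∈ K) → ∀ d ∈ K, Commute y d := by
    intro K hK hyK d hd
    by_contra h
    exact hmin K ⟨hK.le.trans hLD, hyK, d, hd, h⟩ hK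
  have hLr : IsPGroup r L := hD.to_le hLD
  -- `y` commutes with `a` as soon as the commutator commutes with `y`
  have hcl : ∀ a ∈ L, Commute y (a⁻¹ * (y * a * y⁻¹)) → Commute y a := fun a ha h =>
    commute_of_commutator_commute hr hs hrs hy
      (hLr.isPElt (mul_mem (inv_mem ha) (hyL a ha))) h
  have closure_inv : ∀ T : Set G, (∀ x ∈ T, y * x * y⁻¹ ∈ T) →
      ∀ d ∈ closure T, y * d * y⁻¹ ∈ closure T := by
    intro T hT d hd
    have : closure T ≤ (closure T).comap (MulAut.conj y).toMonoidHom := by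
      rw [closure_le]
      exact fun x hx => subset_closure (hT x hx)
    exact this hd
  -- `[L, y] = L`: a proper `[L, y]` would be centralised by `y`, and coprimality would make `y`
  -- centralise `l₀`.
  have hM : closure {x | ∃ l ∈ L, l⁻¹ * (y * l * y⁻¹) = x} = L := by
    have hle : closure {x | ∃ l ∈ L, l⁻¹ * (y * l * y⁻¹) = x} ≤ L := by
      rw [closure_le]
      rintro x ⟨l, hl, rfl⟩
      exact mul_mem (inv_mem hl) (hyL l hl)
    by_contra hne
    refine hyl₀ (hcl l₀ hl₀ ?_)
    refine hmin' _ (lt_of_le_of_ne hle hne) (closure_inv _ ?_) _ (subset_closure ⟨l₀, hl₀, rfl⟩)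
    rintro x ⟨l, hl, rfl⟩
    exact ⟨y * l * y⁻¹, hyL l hl, by group⟩
  let K := closure ({x | ∃ a ∈ L, a ^ r = x} ∪ {x | ∃ a ∈ L, ∃ b ∈ L, a * b * a⁻¹ * b⁻¹ = x})
  have hKL : K < L := closure_pow_commutator_lt hr hLr (by
    rintro rfl
    rw [mem_bot] at hl₀
    exact hyl₀ (hl₀ ▸ Commute.one_right y))
  have hKconj : ∀ l : G, (∀ d ∈ L, l * d * l⁻¹ ∈ L) → ∀ k ∈ K, l * k * l⁻¹ ∈ K := by
    intro l hl k hk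
    have : K ≤ K.comap (MulAut.conj l).toMonoidHom := by
      rw [closure_le]
      rintro x (⟨a, ha, rfl⟩ | ⟨a, ha, b, hb, rfl⟩)
      · exact subset_closure (Or.inl ⟨l * a * l⁻¹, hl a ha, by simp⟩)
      · exact subset_closure (Or.inr ⟨l * a * l⁻¹, hl a ha, l * b * l⁻¹, hl b hb, by simp [mul_assoc]⟩)
    exact this hk
  have hyK : ∀ k ∈ K, Commute y k := hmin' K hKL (hKconj y hyL)
  -- A three-subgroups argument: `y` centralises `K`, which is normalised by `L`, so all `l⁻¹ (y l
  -- y⁻¹)` centralise `K`, and these generate `L`.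
  have hKZ : ∀ k ∈ K, ∀ l ∈ L, Commute k l := by
    intro k hk l hl
    have h1 : L ≤ centralizer {k} := by
      rw [← hM, closure_le]
      rintro x ⟨l, hl, rfl⟩
      rw [SetLike.mem_coe, mem_centralizer_singleton_iff]
      have e1 : Commute y (l * k * l⁻¹) :=
        hyK _ (hKconj l (fun d hd => mul_mem (mul_mem hl hd) (inv_mem hl)) k hk)
      have e2 := hyK k hk
      have e3 : y * l * y⁻¹ * k = l * k * l⁻¹ * (y * l * y⁻¹) := by
        calc y * l * y⁻¹ * k = y * l * (k * y⁻¹) := by rw [← e2.inv_left.eq]; group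
          _ = (y * (l * k * l⁻¹)) * l * y⁻¹ := by group
          _ = l * k * l⁻¹ * (y * l * y⁻¹) := by rw [e1.eq]; group
      calc l⁻¹ * (y * l * y⁻¹) * k = l⁻¹ * (y * l * y⁻¹ * k) := by group
        _ = k * (l⁻¹ * (y * l * y⁻¹)) := by rw [e3]; group
    exact (mem_centralizer_singleton_iff.1 (h1 hl)).symm
  have hpowK : ∀ a ∈ L, a ^ r ∈ K := fun a ha => subset_closure (Or.inl ⟨a, ha, rfl⟩)
  -- commutators are central of exponent `r`
  have hcomm : ∀ x ∈ L, ∀ w ∈ L, ∃ z ∈ K, w * x = x * w * z ∧ z ^ r = 1 := by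
    intro x hx w hw
    have hzK : w⁻¹ * x⁻¹ * w * x ∈ K := subset_closure (Or.inr ⟨w⁻¹, inv_mem hw, x⁻¹, inv_mem hx,
      by simp⟩)
    refine ⟨_, hzK, by group, ?_⟩
    have h1 := (mul_pow_of_central (x := x) (y := w) (z := w⁻¹ * x⁻¹ * w * x) (by group)
      (hKZ _ hzK x hx) (hKZ _ hzK w hw) r).1
    rw [(hKZ _ (hpowK w hw) x hx).eq] at h1
    exact (mul_eq_left.1 h1.symm)
  have hmulpow : ∀ x ∈ L, ∀ w ∈ L, ∀ n, r ∣ n * (n - 1) / 2 → (x * w) ^ n = x ^ n * w ^ n := by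
    intro x hx w hw n ⟨m, hm⟩
    obtain ⟨z, hz, hxw, hzr⟩ := hcomm x hx w hw
    rw [(mul_pow_of_central hxw (hKZ z hz x hx) (hKZ z hz w hw) n).2, hm, pow_mul, hzr, one_pow,
      mul_one]
  have hcpow : ∀ a ∈ L, ∀ n, r ∣ n → r ∣ n * (n - 1) / 2 → (a⁻¹ * (y * a * y⁻¹)) ^ n = 1 := by
    intro a ha n hn hn'
    have h1 := hmulpow a ha _ (mul_mem (inv_mem ha) (hyL a ha)) n hn'
    rw [mul_inv_cancel_left, conj_pow] at h1
    obtain ⟨m, rfl⟩ := hn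
    have h2 : Commute y (a ^ (r * m)) := by
      rw [pow_mul]; exact (hyK _ (hpowK a ha)).pow_right m
    rw [h2.eq, mul_inv_cancel_right] at h1
    exact (mul_eq_left.1 h1.symm)
  have hvy : ∀ u ∈ L, u ^ r = 1 → Commute y u := by
    intro u hu hur
    obtain ⟨n, rfl⟩ := huniq u (hLD hu) hur
    exact hyv.zpow_right n
  -- For odd `r` the `r`-th power map on `L` is multiplicative, so `[l₀, y]` has trivial `r`-th
  -- power. It then lies in `⟨v⟩` and is fixed by `y`, and hence so is `l₀`.
  have hr2 : r = 2 := by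
    by_contra hr2
    have hodd := hr.odd_of_ne_two hr2
    refine hyl₀ (hcl l₀ hl₀ (hvy _ (mul_mem (inv_mem hl₀) (hyL l₀ hl₀)) (hcpow l₀ hl₀ r dvd_rfl ?_)))
    obtain ⟨m, hm⟩ := hodd
    refine ⟨m, ?_⟩
    rw [hm, Nat.add_sub_cancel, show (2 * m + 1) * (2 * m) = 2 * ((2 * m + 1) * m) by ring,
      Nat.mul_div_cancel_left _ (by norm_num)]
  subst hr2
  refine ⟨rfl, ?_⟩
  have h4 : ∀ x ∈ L, x ^ 4 = 1 := by
    intro x hx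
    have hx' := hx
    rw [← hM] at hx'
    have hgoal : x ∈ L ∧ x ^ 4 = 1 := by
      induction hx' using closure_induction with
      | mem w hw =>
        obtain ⟨l, hl, rfl⟩ := hw
        exact ⟨mul_mem (inv_mem hl) (hyL l hl), hcpow l hl 4 (by norm_num) (by norm_num)⟩
      | one => exact ⟨one_mem L, one_pow _⟩
      | mul a b _ _ ha hb =>
        have ha' := ha (by rw [← hM]; assumption)
        have hb' := hb (by rw [← hM]; assumption)
        exact ⟨mul_mem ha'.1 hb'.1, by
          rw [hmulpow a ha'.1 b hb'.1 4 (by norm_num), ha'.2, hb'.2, one_mul]⟩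
      | inv a _ ha =>
        have ha' := ha (by rw [← hM]; assumption)
        exact ⟨inv_mem ha'.1, by rw [inv_pow, ha'.2, inv_one]⟩
    exact hgoal.2
  have hv2 : v ^ 2 = 1 := by rw [← hvr, pow_orderOf_eq_one]
  have hv1 : v ≠ 1 := by
    rintro rfl
    rw [orderOf_one] at hvr
    exact absurd hvr (by norm_num)
  have hvpow : ∀ u ∈ zpowers v, u = 1 ∨ u = v := by
    rintro u ⟨n, rfl⟩
    rcases Int.even_or_odd' n with ⟨k, rfl | rfl⟩
    · left; dsimp only; rw [zpow_mul]; norm_cast; rw [hv2, one_zpow]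
    · right; dsimp only; rw [zpow_add, zpow_mul]; norm_cast; rw [hv2, one_zpow]; simp
  -- From exponent four and the uniqueness of the involution `v`, every element of `L` outside `{1,
  -- v}` is a square root of `v`.
  have hsq : ∀ x ∈ L, x = 1 ∨ x = v ∨ x ^ 2 = v := by
    intro x hx
    have h5 : (x ^ 2) ^ 2 = 1 := by rw [← pow_mul]; exact h4 x hx
    rcases hvpow _ (huniq _ (hLD (pow_mem hx 2)) h5) with h | h
    · rcases hvpow _ (huniq _ (hLD hx) h) with h' | h'
      · exact Or.inl h'
      · exact Or.inr (Or.inl h')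
    · exact Or.inr (Or.inr h)
  have hnv : ∀ x, ¬ Commute y x → x ≠ 1 ∧ x ≠ v := fun x hx =>
    ⟨fun h => hx (h ▸ Commute.one_right y), fun h => hx (h ▸ hyv)⟩
  obtain ⟨hl1, hlv⟩ := hnv l₀ hyl₀
  have ha2 : l₀ ^ 2 = v := by have := hsq l₀ hl₀; tauto
  have hvK : v ∈ K := ha2 ▸ hpowK l₀ hl₀
  have hvL : v ∈ L := hKL.le hvK
  have hinv : ∀ x : G, x ^ 2 = v → x⁻¹ = x * v := by
    intro x hx
    rw [inv_eq_iff_mul_eq_one, ← hx]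
    calc x * (x * x ^ 2) = (x ^ 2) ^ 2 := by simp only [pow_two, mul_assoc]
      _ = 1 := by rw [hx, hv2]
  have hcommsq : ∀ x ∈ L, ∀ w ∈ L, x ^ 2 = v → w ^ 2 = v → Commute x w → w = x ∨ w = x * v := by
    intro x hx w hw hx2 hw2 hc
    have h6 : (x * w) ^ 2 = 1 := by rw [hc.mul_pow, hx2, hw2, ← pow_two, hv2]
    rcases hvpow _ (huniq _ (hLD (mul_mem hx hw)) h6) with h | h
    · right; rw [← hinv x hx2]; exact (inv_eq_of_mul_eq_one_right h).symm
    · left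
      have : w = x⁻¹ * v := by rw [← h, inv_mul_cancel_left]
      rw [this, hinv x hx2, mul_assoc, ← pow_two, hv2, mul_one]
  have hncomm : ∀ x ∈ L, ∀ w ∈ L, ¬ Commute x w → w * x * w⁻¹ = x * v := by
    intro x hx w hw hc
    obtain ⟨z, hz, hwx, hz2⟩ := hcomm x hx w hw
    rcases hvpow _ (huniq _ (hLD (hKL.le hz)) hz2) with h | h
    · rw [h, mul_one] at hwx
      exact absurd hwx.symm hc
    · rw [hwx, h, mul_assoc x w v, (hKZ v hvK w hw).symm.eq, ← mul_assoc, mul_inv_cancel_right]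
  -- `y` does not map `a` into `⟨a⟩`
  have hyaL : y * l₀ * y⁻¹ ∈ L := hyL l₀ hl₀
  have hsq_conj : ∀ x : G, x ^ 2 = v → (y * x * y⁻¹) ^ 2 = v := by
    intro x hx
    rw [conj_pow, hx, hyv.eq, mul_inv_cancel_right]
  have hb2 := hsq_conj l₀ ha2
  have hnot : ∀ x ∈ L, ¬ Commute y x → y * x * y⁻¹ ≠ x ∧ y * x * y⁻¹ ≠ x * v := by
    intro x hx hxy
    refine ⟨fun h => hxy (mul_inv_eq_iff_eq_mul.1 h), fun h => hxy (hcl x hx ?_)⟩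
    rw [h, inv_mul_cancel_left]
    exact hyv
  set a := l₀ with hadef
  set b := y * a * y⁻¹ with hbdef
  have hab : ¬ Commute a b := by
    intro h
    have := hcommsq a hl₀ b hyaL ha2 hb2 h
    have := hnot a hl₀ hyl₀
    tauto
  have hyb : ¬ Commute y b := by
    intro h
    have h7 : y * b * y⁻¹ = b := by rw [h.eq, mul_inv_cancel_right]
    have h8 : b = a := by
      have : y * b * y⁻¹ = y * a * y⁻¹ := h7.trans hbdef
      simpa using this
    exact hyl₀ (h8 ▸ h)
  have hbab : b * a * b⁻¹ = a * v := hncomm a hl₀ b hyaL hab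
  have hcL : y * b * y⁻¹ ∈ L := hyL b hyaL
  have hc2 := hsq_conj b hb2
  -- If `y ^ 2 a y ^ (-2)` commuted with `a`, then `y ^ 2` would centralise `a`, and so would `y`,
  -- whose order is odd.
  have hca : ¬ Commute (y * b * y⁻¹) a := by
    intro h
    have hy2 : Commute (y ^ 2) a := by
      have e : y * b * y⁻¹ = y ^ 2 * a * (y ^ 2)⁻¹ := by rw [hbdef, pow_two]; group
      rcases hcommsq a hl₀ _ hcL ha2 hc2 h.symm with h' | h'
      · rw [e] at h'; exact mul_inv_eq_iff_eq_mul.1 h'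
      · refine commute_of_commutator_commute hr hs hrs (hy.pow 2) ?_ ?_
        · rw [← e, h', inv_mul_cancel_left]; exact hLr.isPElt hvL
        · rw [← e, h', inv_mul_cancel_left]; exact hyv.pow_left 2
    obtain ⟨m, hm⟩ := hy.mem_zpowers_pow (n := 2) ((Nat.coprime_primes hs hr).2 hrs.symm)
    dsimp only at hm
    exact hyl₀ (hm ▸ hy2.zpow_left m)
  have hcb : ¬ Commute (y * b * y⁻¹) b := by
    intro h
    have := hcommsq b hyaL _ hcL hb2 hc2 h.symm
    have := hnot b hyaL hyb
    tauto
  have hav : Commute v a := hKZ v hvK a hl₀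
  have hbv : Commute v b := hKZ v hvK b hyaL
  have hba : b * a = a * b * v := by
    rw [mul_inv_eq_iff_eq_mul] at hbab
    rw [hbab, mul_assoc, hbv.eq, ← mul_assoc]
  -- `yby⁻¹` is `ab` or its inverse
  have hc : y * b * y⁻¹ = a * b ∨ y * b * y⁻¹ = a * b * v := by
    set c := y * b * y⁻¹
    have hw : Commute a (b⁻¹ * c) := by
      have e1 : c * a * c⁻¹ = a * v := hncomm a hl₀ c hcL fun h => hca h.symm
      have e2 : b⁻¹ * (a * v) * b = a := by rw [← hbab]; group
      have e3 : (b⁻¹ * c) * a * (b⁻¹ * c)⁻¹ = a := by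
        calc (b⁻¹ * c) * a * (b⁻¹ * c)⁻¹ = b⁻¹ * (c * a * c⁻¹) * b := by group
          _ = a := by rw [e1, e2]
      exact (mul_inv_eq_iff_eq_mul.1 e3).symm
    have hwL : b⁻¹ * c ∈ L := mul_mem (inv_mem hyaL) hcL
    rcases hsq _ hwL with h | h | h
    · exact absurd (show Commute c b by rw [inv_mul_eq_one.1 h]) hcb
    · exact absurd (show Commute c b by
        rw [inv_mul_eq_iff_eq_mul.1 h]; exact (Commute.refl b).mul_left hbv) hcb
    · rcases hcommsq a hl₀ _ hwL ha2 h hw with h | h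
      · right; rw [inv_mul_eq_iff_eq_mul.1 h, hba]
      · left; rw [inv_mul_eq_iff_eq_mul.1 h, ← mul_assoc, hba, mul_assoc _ v v, ← pow_two, hv2, mul_one]
  have ha1 : a⁻¹ = a * v := hinv a ha2
  rcases hc with hc | hc
  · exact ⟨a, hLD hl₀, b, hLD hyaL, ha2,
      ⟨hb2.trans ha2.symm, by rw [hbab, ha1], by rw [ha2]; exact hv1⟩, rfl, hc⟩
  -- Passing to the inverses of `a` and `b` removes the extra factor `v`.
  · refine ⟨a⁻¹, hLD (inv_mem hl₀), b⁻¹, hLD (inv_mem hyaL), ?_, ⟨?_, ?_, ?_⟩, ?_, ?_⟩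
    · rw [inv_pow, ha2, inv_eq_iff_mul_eq_one, ← pow_two, hv2]
    · rw [inv_pow, inv_pow, ha2, hb2]
    · have hbab' : b * a * b⁻¹ = a⁻¹ := by rw [hbab, ha1]
      nth_rewrite 1 [← hbab']; group
    · rw [inv_pow, ha2, inv_ne_one]; exact hv1
    · rw [hbdef]; group
    · have : y * b⁻¹ * y⁻¹ = (y * b * y⁻¹)⁻¹ := by group
      rw [this, hc, ← hba, mul_inv_rev]

end Quaternion

/-! ### Quaternion groups of order eight -/

section Quaternion

variable {G : Type*} [Group G]

set_option maxRecDepth 100000 in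
-- Two distinct transpositions of three letters have a product of order three, so no nontrivial
-- `2`-subgroup of `S₃` is stable under a `3`-cycle.
theorem perm_fin_three_eq_one : ∀ σ τ : Equiv.Perm (Fin 3), (τ ^ 3 = 1 ∧ τ ≠ 1 ∧ σ ^ 2 = 1 ∧
    (σ * (τ * σ * τ⁻¹)) ^ 2 = 1) → σ = 1 := by decide

namespace QuatPair

variable {a b : G}

theorem pow_four (h : QuatPair a b) : a ^ 4 = 1 := by
  have h1 : b * a ^ 2 * b⁻¹ = (a ^ 2)⁻¹ := by rw [← conj_pow, h.conj, inv_pow]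
  rw [← h.sq_eq, pow_two, mul_assoc, mul_inv_cancel_right, ← pow_two, h.sq_eq,
    eq_inv_iff_mul_eq_one, ← pow_add] at h1
  exact h1

theorem sq_sq (h : QuatPair a b) : a ^ 2 * a ^ 2 = 1 := by rw [← pow_add]; exact h.pow_four

theorem orderOf_sq (h : QuatPair a b) : orderOf (a ^ 2) = 2 :=
  orderOf_eq_prime (by rw [pow_two]; exact h.sq_sq) h.ne_one

theorem inv_a (h : QuatPair a b) : a⁻¹ = a * a ^ 2 := by
  rw [inv_eq_iff_mul_eq_one, ← pow_succ', ← pow_succ']; exact h.pow_four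

theorem inv_b (h : QuatPair a b) : b⁻¹ = b * a ^ 2 := by
  rw [inv_eq_iff_mul_eq_one, ← h.sq_eq, ← pow_succ', ← pow_succ',
    show b ^ (2 + 1 + 1) = b ^ 2 * b ^ 2 by rw [← pow_add], h.sq_eq, h.sq_sq]

theorem comm_b (h : QuatPair a b) : Commute (a ^ 2) b := by rw [← h.sq_eq]; exact Commute.pow_self b 2

theorem b_mul_a (h : QuatPair a b) : b * a = a⁻¹ * b := mul_inv_eq_iff_eq_mul.1 h.conj

theorem b_mul_zpow (h : QuatPair a b) (i : ℤ) : b * a ^ i = a ^ (-i) * b := by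
  rw [← mul_inv_eq_iff_eq_mul, ← conj_zpow, h.conj, inv_zpow, zpow_neg]

theorem not_commute (h : QuatPair a b) : ¬ Commute a b := by
  intro hc
  have h1 := h.conj
  rw [← hc.eq, mul_inv_cancel_right, eq_inv_iff_mul_eq_one, ← pow_two] at h1
  exact h.ne_one h1

theorem sq_mul (h : QuatPair a b) : (a * b) ^ 2 = a ^ 2 := by
  rw [pow_two, mul_assoc, ← mul_assoc b a b, h.b_mul_a, mul_assoc a⁻¹, mul_inv_cancel_left,
    ← pow_two, h.sq_eq]

theorem mem_closure_iff (h : QuatPair a b) {x : G} :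
    x ∈ closure ({a, b} : Set G) ↔ (∃ i : ℤ, x = a ^ i) ∨ ∃ i : ℤ, x = a ^ i * b := by
  constructor
  · intro hx
    induction hx using closure_induction_right with
    | one => exact Or.inl ⟨0, by simp⟩
    | mul_right x _ y hy ih =>
      rcases hy with rfl | rfl
      · rcases ih with ⟨i, rfl⟩ | ⟨i, rfl⟩
        · exact Or.inl ⟨i + 1, by rw [zpow_add, zpow_one]⟩
        · exact Or.inr ⟨i - 1, by rw [mul_assoc, h.b_mul_a, ← mul_assoc, zpow_sub, zpow_one]⟩
      · rcases ih with ⟨i, rfl⟩ | ⟨i, rfl⟩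
        · exact Or.inr ⟨i, rfl⟩
        · exact Or.inl ⟨i + 2, by rw [mul_assoc, ← pow_two, h.sq_eq, zpow_add, zpow_ofNat]⟩
    | mul_inv_cancel x _ y hy ih =>
      rcases hy with rfl | rfl
      · rcases ih with ⟨i, rfl⟩ | ⟨i, rfl⟩
        · exact Or.inl ⟨i - 1, by rw [zpow_sub, zpow_one]⟩
        · refine Or.inr ⟨i + 1, ?_⟩
          have := h.b_mul_zpow (-1)
          rw [zpow_neg_one, neg_neg, zpow_one] at this
          rw [mul_assoc, this, ← mul_assoc, zpow_add, zpow_one]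
      · rcases ih with ⟨i, rfl⟩ | ⟨i, rfl⟩
        · exact Or.inr ⟨i + 2, by rw [h.inv_b, ← h.comm_b.eq, ← mul_assoc, zpow_add, zpow_ofNat]⟩
        · exact Or.inl ⟨i, by rw [mul_inv_cancel_right]⟩
  · have ha : a ∈ closure ({a, b} : Set G) := subset_closure (by simp)
    have hb : b ∈ closure ({a, b} : Set G) := subset_closure (by simp)
    rintro (⟨i, rfl⟩ | ⟨i, rfl⟩)
    · exact zpow_mem ha i
    · exact mul_mem (zpow_mem ha i) hb

theorem zpow_cases (h : QuatPair a b) (i : ℤ) : a ^ i = 1 ∨ a ^ i = a ∨ a ^ i = a ^ 2 ∨ a ^ i = a⁻¹ := by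
  have h1 : a ^ (i % 4) = a ^ i := by
    conv_rhs => rw [← Int.emod_add_mul_ediv i 4, zpow_add, zpow_mul]
    have : a ^ (4 : ℤ) = 1 := by rw [zpow_ofNat]; exact h.pow_four
    rw [this, one_zpow, mul_one]
  rw [← h1]
  have h2 : i % 4 = 0 ∨ i % 4 = 1 ∨ i % 4 = 2 ∨ i % 4 = 3 := by omega
  rcases h2 with h2 | h2 | h2 | h2 <;> rw [h2]
  · simp
  · simp
  · right; right; left; rw [zpow_ofNat]
  · right; right; right
    rw [h.inv_a, ← pow_succ', zpow_ofNat]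

theorem inv_mul (h : QuatPair a b) : (a * b)⁻¹ = a⁻¹ * b := by
  rw [mul_inv_rev, h.inv_b, ← h.comm_b.eq, mul_assoc, show b * a⁻¹ = a * b by
    have := h.b_mul_zpow (-1); simpa using this, ← mul_assoc, ← pow_succ, h.inv_a, ← pow_succ']

/-- The elements of the quaternion group generated by `a` and `b`. -/
theorem mem_cases (h : QuatPair a b) {x : G} (hx : x ∈ closure ({a, b} : Set G)) :
    (x = 1 ∨ x = a ^ 2) ∨ ∃ j : Fin 3, x = ![a, b, a * b] j ∨ x = (![a, b, a * b] j)⁻¹ := by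
  rcases h.mem_closure_iff.1 hx with ⟨i, rfl⟩ | ⟨i, rfl⟩
  · rcases h.zpow_cases i with h1 | h1 | h1 | h1 <;> rw [h1]
    · simp
    · exact Or.inr ⟨0, Or.inl rfl⟩
    · simp
    · exact Or.inr ⟨0, Or.inr rfl⟩
  · rcases h.zpow_cases i with h1 | h1 | h1 | h1 <;> rw [h1]
    · exact Or.inr ⟨1, Or.inl (one_mul b)⟩
    · exact Or.inr ⟨2, Or.inl rfl⟩
    · exact Or.inr ⟨1, Or.inr (h.comm_b.eq.trans h.inv_b.symm)⟩
    · exact Or.inr ⟨2, Or.inr h.inv_mul.symm⟩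

theorem vec_mem (j : Fin 3) : ![a, b, a * b] j ∈ closure ({a, b} : Set G) := by
  have ha : a ∈ closure ({a, b} : Set G) := subset_closure (by simp)
  have hb : b ∈ closure ({a, b} : Set G) := subset_closure (by simp)
  fin_cases j
  exacts [ha, hb, mul_mem ha hb]

theorem vec_sq (h : QuatPair a b) (j : Fin 3) : (![a, b, a * b] j) ^ 2 = a ^ 2 := by
  fin_cases j
  exacts [rfl, h.sq_eq, h.sq_mul]

theorem vec_commute_iff (h : QuatPair a b) {i j : Fin 3} : Commute (![a, b, a * b] i) (![a, b, a * b] j) ↔ i = j := by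
  refine ⟨fun hc => ?_, fun hij => hij ▸ Commute.refl _⟩
  have hn := h.not_commute
  have h1 : ¬ Commute a (a * b) := fun hc => hn (by
    have := (Commute.refl a).inv_right.mul_right hc
    rwa [inv_mul_cancel_left] at this)
  have h2 : ¬ Commute b (a * b) := fun hc => hn (by
    have := hc.mul_right (Commute.refl b).inv_right
    rw [mul_inv_cancel_right] at this
    exact this.symm)
  fin_cases i <;> fin_cases j
  exacts [rfl, absurd hc hn, absurd hc h1, absurd hc.symm hn, rfl, absurd hc h2, absurd hc.symm h1,
    absurd hc.symm h2, rfl]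

theorem vec_eq (h : QuatPair a b) {i j : Fin 3} (hij : ![a, b, a * b] i = ![a, b, a * b] j ∨
    ![a, b, a * b] i = (![a, b, a * b] j)⁻¹) : i = j := by
  rw [← h.vec_commute_iff]
  rcases hij with h1 | h1 <;> rw [h1]
  exact (Commute.refl _).inv_left

/-- Conjugation permutes the three cyclic subgroups of order four of a normal quaternion group. -/
theorem exists_perm (h : QuatPair a b) (hL : (closure ({a, b} : Set G)).Normal) :
    ∃ f : G →* Equiv.Perm (Fin 3), ∀ g i, g * ![a, b, a * b] i * g⁻¹ = ![a, b, a * b] (f g i) ∨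
      g * ![a, b, a * b] i * g⁻¹ = (![a, b, a * b] (f g i))⁻¹ := by
  set u := ![a, b, a * b] with hu
  have hex : ∀ (g : G) (i : Fin 3), ∃ j, g * u i * g⁻¹ = u j ∨ g * u i * g⁻¹ = (u j)⁻¹ := by
    intro g i
    have hsq : (g * u i * g⁻¹) ^ 2 ≠ 1 := by
      rw [conj_pow, h.vec_sq, ne_eq, conj_eq_one_iff]
      exact h.ne_one
    rcases h.mem_cases (hL.conj_mem _ (vec_mem i) g) with (h1 | h1) | h1
    · exact absurd (by rw [h1, one_pow]) hsq
    · exact absurd (by rw [h1, pow_two, h.sq_sq]) hsq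
    · exact h1
  choose F hF using hex
  have huniq : ∀ (x : G) (i j : Fin 3), (x = u i ∨ x = (u i)⁻¹) → (x = u j ∨ x = (u j)⁻¹) →
      i = j := by
    rintro x i j (rfl | rfl) h2
    · exact h.vec_eq h2
    · refine h.vec_eq ?_
      rcases h2 with h2 | h2
      · exact Or.inr (inv_eq_iff_eq_inv.1 h2)
      · exact Or.inl (inv_injective h2)
  let F' : G →* Function.End (Fin 3) :=
    { toFun := F
      map_one' := by
        funext i
        refine huniq (u i) _ _ ?_ (Or.inl rfl)
        simpa using hF 1 i
      map_mul' := by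
        intro g k
        funext i
        refine huniq (g * k * u i * (g * k)⁻¹) _ _ (hF _ i) ?_
        have e : g * k * u i * (g * k)⁻¹ = g * (k * u i * k⁻¹) * g⁻¹ := by group
        rw [e]
        change _ = u (F g (F k i)) ∨ _ = (u (F g (F k i)))⁻¹
        rcases hF k i with h1 | h1 <;> rw [h1]
        · exact hF g _
        · have e2 : g * (u (F k i))⁻¹ * g⁻¹ = (g * u (F k i) * g⁻¹)⁻¹ := by group
          rw [e2]
          rcases hF g (F k i) with h2 | h2 <;> rw [h2]
          · exact Or.inr rfl
          · exact Or.inl (inv_inv _) }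
  exact ⟨F'.toHomPerm, fun g i => hF g i⟩

/-- An automorphism fixing the three cyclic subgroups of order four is inner. -/
theorem exists_mul_commute (h : QuatPair a b) {g : G} (ha : g * a * g⁻¹ = a ∨ g * a * g⁻¹ = a⁻¹)
    (hb : g * b * g⁻¹ = b ∨ g * b * g⁻¹ = b⁻¹) :
    ∃ l ∈ closure ({a, b} : Set G), Commute (l⁻¹ * g) a ∧ Commute (l⁻¹ * g) b := by
  have ma : a ∈ closure ({a, b} : Set G) := subset_closure (by simp)
  have mb : b ∈ closure ({a, b} : Set G) := subset_closure (by simp)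
  have key : ∀ l x w : G, g * x * g⁻¹ = w → l * x * l⁻¹ = w → Commute (l⁻¹ * g) x := by
    intro l x w h1 h2
    have : l⁻¹ * g * x * (l⁻¹ * g)⁻¹ = x := by
      calc l⁻¹ * g * x * (l⁻¹ * g)⁻¹ = l⁻¹ * (g * x * g⁻¹) * l := by group
        _ = x := by rw [h1, ← h2]; group
    exact mul_inv_eq_iff_eq_mul.1 this
  have hab : a * b * a⁻¹ = b⁻¹ := by
    have h1 := h.b_mul_zpow (-1)
    rw [zpow_neg_one, neg_neg, zpow_one] at h1
    rw [mul_assoc, h1, ← mul_assoc, ← pow_two, h.comm_b.eq, h.inv_b]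
  -- The four sign patterns are realised by conjugation with `1`, `a`, `b` and `a * b`.
  rcases ha with ha | ha <;> rcases hb with hb | hb
  · exact ⟨1, one_mem _, key 1 a _ ha (by simp), key 1 b _ hb (by simp)⟩
  · exact ⟨a, ma, key a a _ ha (by simp), key a b _ hb hab⟩
  · exact ⟨b, mb, key b a _ ha h.conj, key b b _ hb (by simp)⟩
  · refine ⟨a * b, mul_mem ma mb, key _ a _ ha ?_, key _ b _ hb ?_⟩
    · calc a * b * a * (a * b)⁻¹ = a * (b * a * b⁻¹) * a⁻¹ := by group
        _ = a⁻¹ := by rw [h.conj]; group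
    · calc a * b * b * (a * b)⁻¹ = a * b * a⁻¹ := by group
        _ = b⁻¹ := hab

/-- In a tidy group only the centre of a quaternion subgroup of order `8` consists of `2`-elements
centralising it. -/
theorem eq_of_commute (h : QuatPair a b) [Finite G] (hT : IsTidy G) {c : G} (hc : IsPElt 2 c) (hca : Commute c a)
    (hcb : Commute c b) : c = 1 ∨ c = a ^ 2 := by
  -- All square roots of `a ^ 2` lie in the subgroup `Cyc(a ^ 2)`, whose only involution is `a ^ 2`.
  -- This applies to `a` and `a * c` when `c ^ 2 = 1`, and to `a` and `c` when `c ^ 2 = a ^ 2`.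
  have hcyc : ∀ x : G, x ^ 2 = a ^ 2 → x ∈ cyc G (a ^ 2) := fun x hx =>
    mem_cyc_of_mem_zpowers (z := x) (by rw [← hx]; exact pow_mem (mem_zpowers x) 2) (mem_zpowers x)
  have hinv : ∀ x : G, x ∈ cyc G (a ^ 2) → x ^ 2 = 1 → x = 1 ∨ x = a ^ 2 := by
    intro x hx hx2
    obtain ⟨n, hn⟩ := mem_zpowers_of_mem_cyc Nat.prime_two h.orderOf_sq hx2 hx
    have h2 : (a ^ 2) ^ (2 : ℤ) = 1 := by
      rw [zpow_ofNat, pow_two (a ^ 2)]; exact h.sq_sq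
    dsimp only at hn
    rcases Int.even_or_odd' n with ⟨k, rfl | rfl⟩
    · left; rw [← hn, zpow_mul, h2, one_zpow]
    · right; rw [← hn, zpow_add, zpow_mul, h2, one_zpow, one_mul, zpow_one]
  obtain ⟨k, hk⟩ := hc
  induction k generalizing c with
  | zero => left; simpa using hk
  | succ k ih =>
    rw [pow_succ', pow_mul] at hk
    rcases ih (hca.pow_left 2) (hcb.pow_left 2) hk with h1 | h1
    · refine hinv c ?_ h1
      have h2 : a * c ∈ cyc G (a ^ 2) := hcyc _ (by rw [hca.symm.mul_pow, h1, mul_one])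
      have h3 := hT.mul_mem (inv_mem_cyc (hcyc a rfl)) h2
      rwa [inv_mul_cancel_left] at h3
    · exfalso
      have h2 := hT.mul_mem (hcyc a rfl) (hcyc c h1)
      have h3 := hinv _ h2 (by rw [hca.symm.mul_pow, h1, h.sq_sq])
      refine h.not_commute ?_
      rcases h3 with h3 | h3
      · rw [eq_inv_of_mul_eq_one_left h3]; exact hcb.inv_left
      · rw [pow_two] at h3
        rw [← mul_left_cancel h3]; exact hcb

theorem nonempty_mulEquiv (h : QuatPair a b) :
    Nonempty (closure ({a, b} : Set G) ≃* QuaternionGroup 2) := by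
  have h4 : a ^ 4 = 1 := h.pow_four
  let α : ZMod (2 * 2) → G := fun i => a ^ i.val
  have hα : ∀ i j, α (i + j) = α i * α j := by
    intro i j
    change a ^ (i + j).val = a ^ i.val * a ^ j.val
    rw [ZMod.val_add, ← pow_add]
    exact (pow_eq_pow_mod _ h4).symm
  have hα0 : α 0 = 1 := pow_zero a
  have hbb : b * b = α 2 := by rw [← pow_two, h.sq_eq]; rfl
  have hαneg : ∀ i, α (-i) = (α i)⁻¹ := fun i =>
    eq_inv_of_mul_eq_one_left (by rw [← hα, neg_add_cancel, hα0])
  have hαb : ∀ i, α i * b = b * α (-i) := by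
    intro i
    have h1 := h.b_mul_zpow (-(i.val : ℤ))
    rw [neg_neg, zpow_natCast, zpow_neg, zpow_natCast] at h1
    rw [hαneg]; exact h1.symm
  let φ : QuaternionGroup 2 →* G :=
    { toFun := fun x => match x with
        | .a i => α i
        | .xa i => b * α i
      map_one' := hα0
      map_mul' := by
        rintro (i | i) (j | j)
        · simp only [QuaternionGroup.a_mul_a]; exact hα i j
        · simp only [QuaternionGroup.a_mul_xa]
          rw [← mul_assoc, hαb, mul_assoc, ← hα, neg_add_eq_sub]
        · simp only [QuaternionGroup.xa_mul_a]
          rw [mul_assoc, hα]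
        · simp only [QuaternionGroup.xa_mul_xa]
          rw [mul_assoc, ← mul_assoc (α i), hαb, mul_assoc b, ← hα, ← mul_assoc, hbb, ← hα]
          congr 1
          push_cast; ring }
  have hinj : Function.Injective φ := by
    rw [injective_iff_map_eq_one]
    have ha1 : a ≠ 1 := fun h1 => h.ne_one (by rw [h1, one_pow])
    have ha3 : a ^ 3 ≠ 1 := fun h1 => ha1 (by
      have : a ^ 4 = a ^ 3 * a := pow_succ a 3
      rw [h4, h1, one_mul] at this
      exact this.symm)
    rintro (i | i) hi
    · change a ^ i.val = 1 at hi
      have hlt : i.val < 4 := ZMod.val_lt i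
      have h0 : i.val = 0 := by
        interval_cases hv : i.val
        · rfl
        · exact absurd (by simpa using hi) ha1
        · exact absurd hi h.ne_one
        · exact absurd hi ha3
      rw [(ZMod.val_eq_zero i).1 h0]; rfl
    · exfalso
      change b * α i = 1 at hi
      refine h.not_commute ?_
      rw [eq_inv_of_mul_eq_one_left hi]
      exact ((Commute.refl a).pow_right i.val).inv_right
  have hrange : φ.range = closure ({a, b} : Set G) := by
    apply le_antisymm
    · rintro _ ⟨i | i, rfl⟩
      · exact h.mem_closure_iff.2 (Or.inl ⟨i.val, (zpow_natCast a i.val).symm⟩)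
      · refine mul_mem (subset_closure (by simp)) ?_
        exact pow_mem (subset_closure (by simp)) _
    · rw [closure_le]
      rintro x (rfl | rfl)
      · exact ⟨.a 1, pow_one _⟩
      · exact ⟨.xa 0, by change x * α 0 = x; rw [hα0, mul_one]⟩
  exact ⟨((MonoidHom.ofInjective hinj).trans (MulEquiv.subgroupCongr hrange)).symm⟩

theorem card_closure (h : QuatPair a b) : Nat.card (closure ({a, b} : Set G)) = 8 := by
  obtain ⟨e⟩ := h.nonempty_mulEquiv
  rw [Nat.card_congr e.toEquiv, Nat.card_eq_fintype_card, QuaternionGroup.card]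

end QuatPair

end Quaternion

/-! ### How elements of prime power order act in a tidy group -/

section Quaternion

variable {G : Type*} [Group G]

theorem mem_normalizer_of_conj_mem [Finite G] {H : Subgroup G} {g : G}
    (h : ∀ x ∈ H, g * x * g⁻¹ ∈ H) : g ∈ normalizer (H : Set G) := by
  rw [mem_normalizer_iff_map_conj_eq]
  refine eq_of_le_of_card_ge (map_le_iff_le_comap.2 h) ?_
  rw [card_map_of_injective (MulAut.conj g).injective]

/-- Normalisers grow in the nilpotent group `N`. -/
theorem exists_mem_normalizer_of_lt [Finite G] {r : ℕ} (hr : r.Prime) {L N : Subgroup G}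
    (hN : IsPGroup r N) (hlt : L < N) : ∃ g ∈ N, g ∉ L ∧ g ∈ normalizer (L : Set G) := by
  have hf : Fact r.Prime := ⟨hr⟩
  have hnil : Group.IsNilpotent N := hN.isNilpotent
  have hne : L.subgroupOf N < ⊤ := by
    rw [lt_top_iff_ne_top, ne_eq, subgroupOf_eq_top]
    exact not_le_of_gt hlt
  obtain ⟨g, hg, hgL⟩ := SetLike.exists_of_lt
    (Group.normalizerCondition_of_isNilpotent (L.subgroupOf N) hne)
  refine ⟨g, g.2, fun h => hgL (mem_subgroupOf.2 h), ?_⟩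
  rw [mem_normalizer_iff] at hg ⊢
  intro x
  by_cases hx : x ∈ N
  · exact hg ⟨x, hx⟩
  · refine ⟨fun h => absurd (hlt.le h) hx, fun h => absurd ?_ hx⟩
    have := mul_mem (mul_mem (inv_mem g.2) (hlt.le h)) g.2
    simpa [mul_assoc] using this

namespace QuatTriple

variable {y a b : G}

theorem map_mul (h : QuatTriple y a b) : y * (a * b) * y⁻¹ = a := by
  calc y * (a * b) * y⁻¹ = (y * a * y⁻¹) * (y * b * y⁻¹) := by group
    _ = (b * a) * b := by rw [h.map_a, h.map_b, mul_assoc]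
    _ = a := by rw [h.b_mul_a, mul_assoc, ← pow_two, h.sq_eq, pow_two, inv_mul_cancel_left]

theorem commute_cube_a (h : QuatTriple y a b) : Commute (y ^ 3) a := by
  rw [Commute, SemiconjBy, ← mul_inv_eq_iff_eq_mul]
  calc y ^ 3 * a * (y ^ 3)⁻¹ = y * (y * (y * a * y⁻¹) * y⁻¹) * y⁻¹ := by
        rw [pow_succ, pow_two]; group
    _ = a := by rw [h.map_a, h.map_b, h.map_mul]

/-- `y ^ 3` centralises `a`, and for `s ≠ 3` it generates the same group as `y`. -/
theorem eq_three (h : QuatTriple y a b) {s : ℕ} (hs : s.Prime) (hy : IsPElt s y) : s = 3 := by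
  by_contra hne
  have h1 := hy.mem_zpowers_pow ((Nat.coprime_primes hs Nat.prime_three).2 hne)
  have h2 : Commute y a := by
    obtain ⟨n, hn⟩ := h1
    dsimp only at hn
    rw [← hn]
    exact h.commute_cube_a.zpow_left n
  have h3 : a = b := by rw [← h.map_a, h2.eq, mul_inv_cancel_right]
  exact h.not_commute (h3 ▸ Commute.refl a)

theorem not_commute_y (h : QuatTriple y a b) : ¬ Commute y a := fun h2 =>
  h.not_commute ((show a = b by rw [← h.map_a, h2.eq, mul_inv_cancel_right]) ▸ Commute.refl a)

theorem commute_sq (h : QuatTriple y a b) : Commute y (a ^ 2) := by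
  rw [Commute, SemiconjBy, ← mul_inv_eq_iff_eq_mul, ← conj_pow, h.map_a, h.sq_eq]

theorem commute_cube_b (h : QuatTriple y a b) : Commute (y ^ 3) b := by
  have h1 := h.commute_cube_a
  have h2 : Commute (y ^ 3) (y * a * y⁻¹) :=
    ((Commute.pow_self y 3).mul_right h1).mul_right (Commute.pow_self y 3).inv_right
  rwa [h.map_a] at h2

/-- A `2`-subgroup of a tidy group that is normalised by `y` and contains a quaternion group on
which `y` acts nontrivially is that quaternion group. -/
theorem eq_closure [Finite G] (hT : IsTidy G) (h : QuatTriple y a b) {N : Subgroup G}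
    (hN : IsPGroup 2 N) (hyN : ∀ n ∈ N, y * n * y⁻¹ ∈ N) (haN : a ∈ N) (hbN : b ∈ N) :
    N = closure {a, b} := by
  set L := closure ({a, b} : Set G) with hL
  have ma : a ∈ L := subset_closure (by simp)
  have mb : b ∈ L := subset_closure (by simp)
  have hLN : L ≤ N := by
    rw [hL, closure_le]
    rintro x (rfl | rfl)
    exacts [haN, hbN]
  by_contra hne
  -- Both `g` and its conjugate by `y` lie in the `2`-group `N`, while `y` permutes the three cyclic
  -- subgroups of order four of `L` in a `3`-cycle; so `g` fixes all three. Then `g` acts on `L` as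
  -- an inner automorphism and differs from an element of `L` by a `2`-element centralising `L`,
  -- which tidiness puts into `L`.
  obtain ⟨g, hgN, hgL, hgn⟩ := exists_mem_normalizer_of_lt Nat.prime_two hN
    (lt_of_le_of_ne hLN (Ne.symm hne))
  set H := normalizer (L : Set G)
  have hLH : L ≤ H := le_normalizer
  have hyH : y ∈ H := by
    refine mem_normalizer_of_conj_mem ?_
    intro x hx
    induction hx using closure_induction with
    | mem x hx =>
      rcases hx with rfl | rfl
      · rw [h.map_a]; exact mb
      · rw [h.map_b]; exact mul_mem ma mb
    | one => simp
    | mul x z _ _ hx hz =>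
      have := mul_mem hx hz
      simpa [mul_assoc] using this
    | inv x _ hx =>
      have := inv_mem hx
      simpa [mul_assoc] using this
  let a' : H := ⟨a, hLH ma⟩
  let b' : H := ⟨b, hLH mb⟩
  have h' : QuatPair a' b' :=
    ⟨Subtype.ext h.sq_eq, Subtype.ext h.conj, fun h1 => h.ne_one (congrArg Subtype.val h1)⟩
  have hcl : closure ({a', b'} : Set H) = L.subgroupOf H := by
    apply map_injective H.subtype_injective
    rw [MonoidHom.map_closure, Set.image_pair, subgroupOf_map_subtype, inf_eq_left.2 hLH]
    rfl
  obtain ⟨f, hf⟩ := h'.exists_perm (hcl ▸ normal_in_normalizer)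
  set y' : H := ⟨y, hyH⟩
  set g' : H := ⟨g, hgn⟩
  have hτ0 : f y' 0 = 1 := by
    rcases hf y' 0 with h1 | h1
    · exact (h'.vec_eq (i := 1) (Or.inl ((Subtype.ext h.map_a : y' * a' * y'⁻¹ = b').symm.trans h1))).symm
    · exact (h'.vec_eq (i := 1) (Or.inr ((Subtype.ext h.map_a : y' * a' * y'⁻¹ = b').symm.trans h1))).symm
  have hτ1 : f y' 1 = 2 := by
    have e : y' * b' * y'⁻¹ = a' * b' := Subtype.ext h.map_b
    rcases hf y' 1 with h1 | h1
    · exact (h'.vec_eq (i := 2) (Or.inl (e.symm.trans h1))).symm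
    · exact (h'.vec_eq (i := 2) (Or.inr (e.symm.trans h1))).symm
  have hτ : f y' ^ 3 = 1 ∧ f y' ≠ 1 := by
    revert hτ0 hτ1
    generalize f y' = τ
    revert τ
    decide
  have h2 : ∀ n : H, (n : G) ∈ N → f n ^ 2 = 1 := by
    intro n hn
    have hp : IsPElt 2 (f n) := (isPElt_coe.1 (hN.isPElt hn)).map f
    have h6 : ∀ σ : Equiv.Perm (Fin 3), σ ^ 6 = 1 := fun σ => by
      have := pow_card_eq_one (x := σ)
      rwa [Fintype.card_perm] at this
    refine (hp.pow 2).eq_one_of_pow (n := 3) (by norm_num) ?_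
    rw [← pow_mul]; exact h6 _
  have hσ : f g' = 1 := by
    refine perm_fin_three_eq_one (f g') (f y') ⟨hτ.1, hτ.2, h2 g' hgN, ?_⟩
    rw [← map_inv, ← _root_.map_mul, ← _root_.map_mul, ← _root_.map_mul]
    exact h2 _ (mul_mem hgN (hyN g hgN))
  have ha1 := hf g' 0
  have hb1 := hf g' 1
  rw [hσ] at ha1 hb1
  obtain ⟨l, hl, hla, hlb⟩ := h.toQuatPair.exists_mul_commute (g := g)
    (ha1.imp (congrArg Subtype.val) (congrArg Subtype.val))
    (hb1.imp (congrArg Subtype.val) (congrArg Subtype.val))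
  have hlg : l⁻¹ * g ∈ L := by
    rcases h.toQuatPair.eq_of_commute hT (hN.isPElt (mul_mem (inv_mem (hLN hl)) hgN)) hla hlb
      with h3 | h3 <;> rw [h3]
    · exact one_mem L
    · exact pow_mem ma 2
  exact hgL (by simpa using mul_mem hl hlg)

end QuatTriple

/-- In a tidy group, an `s`-element `y` normalising an `r`-subgroup `N` acts on it without fixed
points or trivially, except that `N` may be a quaternion group of order `8`. -/
theorem IsTidy.action_cases [Finite G] (hT : IsTidy G) {r s : ℕ} (hr : r.Prime) (hs : s.Prime)
    (hrs : r ≠ s) {N : Subgroup G} (hN : IsPGroup r N) {y : G} (hy : IsPElt s y)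
    (hyN : ∀ n ∈ N, y * n * y⁻¹ ∈ N) :
    (∀ n ∈ N, Commute y n → n = 1) ∨ (∀ n ∈ N, Commute y n) ∨
      (r = 2 ∧ s = 3 ∧ ∃ a b : G, N = closure {a, b} ∧ QuatTriple y a b) := by
  have hfr : Fact r.Prime := ⟨hr⟩
  have key : ∀ v ∈ N, orderOf v = r → Commute y v → (∀ n ∈ N, Commute v n → Commute y n) ∨
      (r = 2 ∧ s = 3 ∧ ∃ a b : G, N = closure {a, b} ∧ QuatTriple y a b) := by
    intro v hv hvr hyv
    -- `⟨v⟩` is the only subgroup of order `r` in `D`, which makes the quaternion analysis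
    -- applicable.
    let D := N ⊓ hT.cycSubgroup v
    by_cases hD : ∀ d ∈ D, Commute y d
    · left
      intro m hm hvm
      -- `y` commutes with `v` and has coprime order, so `y` and its conjugate by `m ∈ C_N(v)` both
      -- belong to `Cyc(v)`. Their quotient puts `[m, y]` into `D`.
      have hyc : y ∈ hT.cycSubgroup v :=
        mem_cyc_of_coprime hr hs hrs (IsPElt.of_orderOf_eq hvr) hy hyv.symm
      have h1 : m⁻¹ * y * m ∈ hT.cycSubgroup v := by
        have := conj_mem_cyc hyc hvm.symm.inv_left
        rwa [inv_inv] at this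
      have h2 : m⁻¹ * (y * m * y⁻¹) ∈ D := by
        refine ⟨Subgroup.mul_mem _ (inv_mem hm) (hyN m hm), ?_⟩
        have := Subgroup.mul_mem _ h1 (inv_mem hyc)
        simpa [mul_assoc] using this
      exact commute_of_commutator_commute hr hs hrs hy (hN.isPElt h2.1) (hD _ h2)
    · right
      push Not at hD
      obtain ⟨d₀, hd₀, hyd₀⟩ := hD
      obtain ⟨hr2, a, ha, b, hb, -, hq⟩ := exists_quatTriple hr hs hrs (hN.to_le inf_le_left) hy
        (D := D) (fun d hd => ⟨hyN d hd.1, conj_mem_cyc hd.2 hyv⟩) hvr hyv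
        (fun u hu hur => mem_zpowers_of_mem_cyc hr hvr hur hu.2) hd₀ hyd₀
      subst hr2
      exact ⟨rfl, hq.eq_three hs hy, a, b, hq.eq_closure hT hN hyN ha.1 hb.1, hq⟩
  by_cases hfix : ∀ n ∈ N, Commute y n → n = 1
  · exact Or.inl hfix
  right
  push Not at hfix
  obtain ⟨n, hn, hyn, hn1⟩ := hfix
  obtain ⟨k, hk⟩ := (hN.isPElt hn).exists_orderOf_eq hr hn1
  rcases key _ (pow_mem hn k) hk (hyn.pow_right k) with h1 | h1
  -- A central element of order `r` of `N` commutes with the fixed element and is therefore fixed by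
  -- `y` too. Applying `key` again to it covers its centraliser, which is all of `N`.
  · have : Nontrivial N := ⟨⟨n, hn⟩, 1, fun h => hn1 (congrArg Subtype.val h)⟩
    obtain ⟨z, hz⟩ := (nontrivial_iff_exists_ne_one _).1 hN.center_nontrivial
    have hzc : ∀ m ∈ N, Commute (z : G) m := fun m hm =>
      (congrArg Subtype.val (mem_center_iff.1 hz.1 ⟨m, hm⟩)).symm
    have hz1' : (z : G) ≠ 1 := fun h => hz.2 (Subtype.ext h)
    obtain ⟨l, hl⟩ := (hN.isPElt z.2).exists_orderOf_eq hr hz1'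
    have hyz := h1 _ (pow_mem z.2 l) (((hzc _ hn).pow_left l).pow_right k).symm
    rcases key _ (pow_mem z.2 l) hl hyz with h2 | h2
    · exact Or.inl fun m hm => h2 m hm ((hzc m hm).pow_left l)
    · exact Or.inr h2
  · exact Or.inr h1

end Quaternion

/-! ### The cores of a group with two prime divisors -/

section Core

variable {G : Type*} [Group G]

theorem isPGroup_pCore (r : ℕ) : IsPGroup r (pCore r G) :=
  have : ∀ N : {N : Subgroup G // N.Normal ∧ IsPGroup r N}, N.1.Normal := fun N => N.2.1
  Sylow.iSup_of_normal (fun N : {N : Subgroup G // N.Normal ∧ IsPGroup r N} => N.1) fun N => N.2.2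

theorem le_pCore {r : ℕ} {N : Subgroup G} (hn : N.Normal) (hN : IsPGroup r N) : N ≤ pCore r G :=
  le_iSup (fun N : {N : Subgroup G // N.Normal ∧ IsPGroup r N} => N.1) ⟨N, hn, hN⟩

theorem IsPElt.of_mem_pCore {r : ℕ} {x : G} (hx : x ∈ pCore r G) : IsPElt r x :=
  (isPGroup_pCore r).isPElt hx

theorem IsPElt.mem_of_sylow_normal [Finite G] {r : ℕ} (hr : r.Prime) (S : Sylow r G)
    (hS : (S : Subgroup G).Normal) {x : G} (hx : IsPElt r x) : x ∈ S := by
  have hf : Fact r.Prime := ⟨hr⟩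
  obtain ⟨T, hT⟩ := hx.isPGroup_zpowers.exists_le_sylow
  have := Sylow.unique_of_normal S hS
  rw [Subsingleton.elim S T]
  exact hT (mem_zpowers x)

theorem IsPElt.mk {r : ℕ} {x : G} (h : IsPElt r x) (N : Subgroup G) [N.Normal] :
    IsPElt r (x : G ⧸ N) := h.map (QuotientGroup.mk' N)

theorem eq_one_of_mem_of_mem {r s : ℕ} (hr : r.Prime) (hs : s.Prime) (hrs : r ≠ s)
    {A B : Subgroup G} (hA : IsPGroup r A) (hB : IsPGroup s B) {x : G} (ha : x ∈ A) (hb : x ∈ B) :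
    x = 1 :=
  (hA.isPElt ha).eq_one_of_ne hr hs hrs (hB.isPElt hb)

theorem disjoint_of_isPGroup {r s : ℕ} (hr : r.Prime) (hs : s.Prime) (hrs : r ≠ s)
    {A B : Subgroup G} (hA : IsPGroup r A) (hB : IsPGroup s B) : Disjoint A B :=
  disjoint_def.2 fun ha hb => eq_one_of_mem_of_mem hr hs hrs hA hB ha hb

theorem commute_of_mem_pCore {r s : ℕ} (hr : r.Prime) (hs : s.Prime) (hrs : r ≠ s) {x y : G}
    (hx : x ∈ pCore r G) (hy : y ∈ pCore s G) : Commute x y :=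
  commute_of_normal_of_disjoint _ _ inferInstance inferInstance
    (disjoint_of_isPGroup hr hs hrs (isPGroup_pCore r) (isPGroup_pCore s)) x y hx hy

/-- A Sylow subgroup of the nilpotent group `E` is characteristic in `E`, hence normal in `G`. -/
theorem mem_pCore_of_isNilpotent [Finite G] {r : ℕ} (hr : r.Prime) {E : Subgroup G} (hE : E.Normal)
    (hnil : Group.IsNilpotent E) {x : G} (hxE : x ∈ E) (hx : IsPElt r x) : x ∈ pCore r G := by
  have hf : Fact r.Prime := ⟨hr⟩
  obtain ⟨S⟩ := Sylow.nonempty (p := r) (G := E)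
  have hS := S.normal_of_normalizerCondition (Group.normalizerCondition_of_isNilpotent (G := E))
  have hchar := S.characteristic_of_normal hS
  have h1 : (⟨x, hxE⟩ : E) ∈ (S : Subgroup E) :=
    IsPElt.mem_of_sylow_normal hr S hS ((isPElt_coe (x := (⟨x, hxE⟩ : E))).1 hx)
  exact le_pCore (ConjAct.normal_of_characteristic_of_normal (H := E) (K := S)) (S.isPGroup'.map _)
    (mem_map_of_mem E.subtype h1)

/-- If `C` is normal, centralises `C ∩ M`, and is an `r`-group modulo `M`, then the `r`-elements of
`C` lie in the `r`-core. -/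
theorem mem_pCore_of_central [Finite G] {r : ℕ} (hr : r.Prime) {C M : Subgroup G} (hC : C.Normal)
    (hM : M.Normal) (hcomm : ∀ c ∈ C, ∀ m ∈ C, m ∈ M → Commute c m)
    (hpow : ∀ c ∈ C, ∃ k, c ^ r ^ k ∈ M) {x : G} (hxC : x ∈ C) (hx : IsPElt r x) :
    x ∈ pCore r G := by
  have hf : Fact r.Prime := ⟨hr⟩
  refine mem_pCore_of_isNilpotent hr hC ?_ hxC hx
  let f : C →* G ⧸ M := (QuotientGroup.mk' M).comp C.subtype
  have hrange : IsPGroup r f.range := by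
    refine isPGroup_of_isPElt ?_
    rintro _ ⟨c, rfl⟩
    obtain ⟨k, hk⟩ := hpow c c.2
    refine ⟨k, ?_⟩
    rw [← map_pow]
    exact (QuotientGroup.eq_one_iff _).2 hk
  have hnil : Group.IsNilpotent f.range := hrange.isNilpotent
  refine Subgroup.isNilpotent_of_ker_le_center f.rangeRestrict ?_
  intro m hm
  rw [MonoidHom.ker_rangeRestrict, MonoidHom.mem_ker] at hm
  rw [mem_center_iff]
  intro c
  exact Subtype.ext (hcomm c c.2 m m.2 ((QuotientGroup.eq_one_iff _).1 hm))

/-- A normal subgroup whose commutator subgroup is central in it has its `r`-elements in the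
`r`-core. -/
theorem mem_pCore_of_commutator [Finite G] {r : ℕ} (hr : r.Prime) {E : Subgroup G} (hE : E.Normal)
    (hcomm : ∀ c ∈ ⁅E, E⁆, ∀ e ∈ E, Commute c e) {x : G} (hxE : x ∈ E) (hx : IsPElt r x) :
    x ∈ pCore r G := by
  refine mem_pCore_of_isNilpotent hr hE ?_ hxE hx
  refine Subgroup.isNilpotent_of_ker_le_center (Abelianization.of (G := E)) ?_
  rw [Abelianization.ker_of]
  intro m hm
  rw [mem_center_iff]
  intro c
  have h1 : (m : G) ∈ ⁅E, E⁆ := by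
    rw [← map_subtype_commutator]
    exact mem_map_of_mem E.subtype hm
  exact Subtype.ext (hcomm _ h1 c c.2).eq.symm


theorem mem_of_parts [Finite G] {p q : ℕ} (hp : p.Prime) (hq : q.Prime) (hpq : p ≠ q)
    (hG : ∀ r : ℕ, r.Prime → r ∣ Nat.card G → r = p ∨ r = q) {A B : Subgroup G}
    (h₁ : ∀ x ∈ A, IsPElt p x → x ∈ B) (h₂ : ∀ x ∈ A, IsPElt q x → x ∈ B) : A ≤ B := by
  intro g hg
  obtain ⟨a, b, h, ha, hb⟩ := exists_pow_mul_pow hp hq hpq hG g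
  rw [h]
  exact mul_mem (h₁ _ (pow_mem hg a) ha) (h₂ _ (pow_mem hg b) hb)

/-- In a solvable `{p, q}`-group without normal `q`-subgroups the `p`-core contains its
centraliser. -/
theorem mem_pCore_of_commute [Finite G] {p q : ℕ} (hp : p.Prime) (hq : q.Prime) (hpq : p ≠ q)
    (hG : ∀ r : ℕ, r.Prime → r ∣ Nat.card G → r = p ∨ r = q) (hbot : pCore q G = ⊥) {x : G}
    (hx : ∀ y ∈ pCore p G, Commute x y) : x ∈ pCore p G := by
  have hsol : Group.IsSolvable G := isSolvable_of_two_primes _ G rfl hG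
  by_contra hxn
  let S : Set (Subgroup G) :=
    {E | E.Normal ∧ E ≤ centralizer (pCore p G : Set G) ∧ ¬ E ≤ pCore p G}
  have hxC : x ∈ centralizer (pCore p G : Set G) :=
    mem_centralizer_iff.2 fun y hy => (hx y hy).eq.symm
  -- By solvability and minimality `[E, E]` falls into `O_p`, which `E` centralises. So `E` has
  -- class at most two and its elements of prime power order lie in the cores; as `O_q` is trivial,
  -- `E ≤ O_p`.
  obtain ⟨E, ⟨hEn, hEC, hEp⟩, hmin⟩ := (wellFounded_lt (α := Subgroup G)).has_min S
    ⟨centralizer (pCore p G : Set G), inferInstance, le_rfl, fun h => hxn (h hxC)⟩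
  have hEb : E ≠ ⊥ := by rintro rfl; exact hEp bot_le
  have hlt := Group.IsSolvable.commutator_lt_of_ne_bot hEb
  have hle : ⁅E, E⁆ ≤ pCore p G := by
    by_contra h
    exact hmin ⁅E, E⁆ ⟨inferInstance, hlt.le.trans hEC, h⟩ hlt
  have hcomm : ∀ c ∈ ⁅E, E⁆, ∀ e ∈ E, Commute c e := fun c hc e he =>
    mem_centralizer_iff.1 (hEC he) c (hle hc)
  refine hEp (mem_of_parts hp hq hpq hG (fun y hy h => mem_pCore_of_commutator hp hEn hcomm hy h)
    fun y hy h => ?_)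
  have := mem_pCore_of_commutator hq hEn hcomm hy h
  rw [hbot, mem_bot] at this
  rw [this]
  exact one_mem _

/-- If both cores were trivial, every element would centralise `O_p` and therefore lie in it. -/
theorem exists_mem_pCore_ne_one [Finite G] {p q : ℕ} (hp : p.Prime) (hq : q.Prime) (hpq : p ≠ q)
    (hG : ∀ r : ℕ, r.Prime → r ∣ Nat.card G → r = p ∨ r = q) [Nontrivial G] :
    pCore p G ≠ ⊥ ∨ pCore q G ≠ ⊥ := by
  by_contra! h
  have : (⊤ : Subgroup G) ≤ pCore p G := fun x _ =>
    mem_pCore_of_commute hp hq hpq hG h.2 fun y hy => by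
      rw [h.1, mem_bot] at hy
      rw [hy]; exact Commute.one_right x
  rw [h.1] at this
  exact bot_ne_top (le_bot_iff.1 this).symm

theorem card_quotient_primes {p q : ℕ} (hG : ∀ r : ℕ, r.Prime → r ∣ Nat.card G → r = p ∨ r = q)
    (N : Subgroup G) [N.Normal] : ∀ r : ℕ, r.Prime → r ∣ Nat.card (G ⧸ N) → r = p ∨ r = q :=
  fun r hr h => hG r hr (h.trans (card_quotient_dvd_card N))

/-- The quotient by the `q`-core has trivial `q`-core. -/
theorem pCore_quotient_pCore (q : ℕ) : pCore q (G ⧸ pCore q G) = ⊥ := by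
  rw [eq_bot_iff]
  intro x hx
  induction x using QuotientGroup.induction_on with
  | H x =>
    have h : (pCore q (G ⧸ pCore q G)).comap (QuotientGroup.mk' (pCore q G)) ≤ pCore q G := by
      refine le_pCore inferInstance ((isPGroup_pCore q).comap_of_ker_isPGroup _ ?_)
      rw [QuotientGroup.ker_mk']
      exact isPGroup_pCore q
    exact (QuotientGroup.eq_one_iff x).2 (h hx)

end Core

/-! ### The hypercentre -/

section Hypercenter

open scoped commutatorElement

variable {G : Type*} [Group G]

theorem mem_hypercenter {x : G} : x ∈ hypercenter G ↔ ∃ n, x ∈ Subgroup.upperCentralSeries G n :=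
  mem_iSup_of_directed (Subgroup.upperCentralSeries_mono G).directed_le

theorem center_le_hypercenter : center G ≤ hypercenter G := by
  rw [← Subgroup.upperCentralSeries_one]
  exact le_iSup _ 1

/-- The hypercentre lies in every subgroup modulo which no outside element is central. -/
theorem hypercenter_le {Z : Subgroup G} (h : ∀ g, (∀ y, ⁅g, y⁆ ∈ Z) → g ∈ Z) :
    hypercenter G ≤ Z := by
  refine iSup_le fun n => ?_
  induction n with
  | zero => rw [Subgroup.upperCentralSeries_zero]; exact bot_le
  | succ n ih =>
    intro g hg
    exact h g fun y => ih (Subgroup.mem_upperCentralSeries_succ_iff.1 hg y)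

/-- In a finite group the upper central series stabilises, so the quotient by the hypercentre has
trivial centre. -/
theorem commutator_mem_hypercenter [Finite G] {g : G} (h : ∀ y, ⁅g, y⁆ ∈ hypercenter G) :
    g ∈ hypercenter G := by
  obtain ⟨n, hn⟩ : ∃ n, hypercenter G = Subgroup.upperCentralSeries G n := by
    have := Subgroup.upperCentralSeries_mono G
    obtain ⟨n, hn⟩ := WellFoundedGT.monotone_chain_condition
      (⟨_, Subgroup.upperCentralSeries_mono G⟩ : ℕ →o Subgroup G)
    refine ⟨n, le_antisymm (iSup_le fun m => ?_) (le_iSup _ n)⟩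
    rcases le_total n m with hm | hm
    · exact (hn m hm).ge
    · exact Subgroup.upperCentralSeries_mono G hm
  rw [mem_hypercenter]
  exact ⟨n + 1, Subgroup.mem_upperCentralSeries_succ_iff.2 fun y => hn ▸ h y⟩

/-- A normal `r`-subgroup centralised by all `s`-elements of an `{r, s}`-group is hypercentral. -/
theorem le_hypercenter [Finite G] {r s : ℕ} (hr : r.Prime) (hs : s.Prime) (hrs : r ≠ s)
    (hG : ∀ t : ℕ, t.Prime → t ∣ Nat.card G → t = r ∨ t = s) {N : Subgroup G} (hNn : N.Normal)
    (hN : IsPGroup r N) (hNs : ∀ n ∈ N, ∀ y, IsPElt s y → Commute y n) : N ≤ hypercenter G := by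
  have hf : Fact r.Prime := ⟨hr⟩
  by_contra hle
  let H := hypercenter G
  let f := QuotientGroup.mk' H
  let A : Subgroup (G ⧸ H) := N.map f
  have hA : IsPGroup r A := hN.map f
  obtain ⟨P⟩ := Sylow.nonempty (p := r) (G := G ⧸ H)
  have hAn : A.Normal := hNn.map f (QuotientGroup.mk'_surjective H)
  have hAP : A ≤ P := hA.le_sylow_of_normal P
  have hnontriv : Nontrivial A := by
    obtain ⟨x, hx, hxH⟩ := SetLike.not_le_iff_exists.1 hle
    exact ⟨⟨f x, mem_map_of_mem f hx⟩, 1, fun h => hxH ((QuotientGroup.eq_one_iff x).1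
      (congrArg Subtype.val h))⟩
  have hconj : ∀ (g : P) (a : A), (g : G ⧸ H) * a * (g : G ⧸ H)⁻¹ ∈ A := fun g a =>
    hAn.conj_mem a a.2 g
  let φ : P →* MulAut A := (MulAut.conjNormal (H := A)).comp (P : Subgroup (G ⧸ H)).subtype
  let act : MulAction P A := MulAction.compHom A φ
  have hdvd : r ∣ Nat.card A := by
    obtain ⟨n, hn, hc⟩ := hA.nontrivial_iff_card.1 hnontriv
    rw [hc]; exact dvd_pow_self r hn.ne'
  have h1 : (1 : A) ∈ MulAction.fixedPoints P A := fun g => map_one (φ g)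
  -- The `r`-group `P` fixes some `b ≠ 1` in the image of `N`, and `s`-elements fix it by
  -- hypothesis. So `b` is central modulo the hypercentre, which is impossible.
  obtain ⟨b, hb, hb1⟩ := P.isPGroup'.exists_fixed_point_of_prime_dvd_card_of_fixed_point A hdvd h1
  have hbf : ∀ g ∈ P, g * (b : G ⧸ H) * g⁻¹ = b := fun g hg => by
    have := congrArg Subtype.val (hb ⟨g, hg⟩)
    exact this
  obtain ⟨n, hn, hnb⟩ := b.2
  have hsb : ∀ g : G ⧸ H, IsPElt s g → g * (b : G ⧸ H) * g⁻¹ = b := by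
    intro g hg
    induction g using QuotientGroup.induction_on with
    | H g =>
      obtain ⟨i, j, hij, hi, hj⟩ := exists_pow_mul_pow hr hs hrs hG g
      have h2 : ((g ^ i : G) : G ⧸ H) = 1 :=
        (hi.mk H).eq_one_of_ne hr hs hrs (hg.pow i)
      have h3 : (g : G ⧸ H) = ((g ^ j : G) : G ⧸ H) := by
        conv_lhs => rw [hij, QuotientGroup.mk_mul, h2, one_mul]
      rw [h3, ← hnb, mul_inv_eq_iff_eq_mul]
      exact congrArg (QuotientGroup.mk' H) (hNs n hn _ hj).eq
  have hcen : ∀ g : G ⧸ H, g * (b : G ⧸ H) * g⁻¹ = b := by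
    have hle : (⊤ : Subgroup (G ⧸ H)) ≤ centralizer {(b : G ⧸ H)} := by
      have hmem : ∀ g : G ⧸ H, g ∈ centralizer {(b : G ⧸ H)} ↔ g * (b : G ⧸ H) * g⁻¹ = b :=
        fun g => by rw [mem_centralizer_singleton_iff, mul_inv_eq_iff_eq_mul]
      rw [top_le_iff, ← index_eq_one]
      by_contra hne
      obtain ⟨t, ht, htd⟩ := Nat.exists_prime_and_dvd hne
      rcases card_quotient_primes hG H t ht (htd.trans (index_dvd_card _)) with rfl | rfl
      · exact P.not_dvd_index (htd.trans (index_dvd_of_le fun g hg => (hmem g).2 (hbf g hg)))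
      · have hft : Fact t.Prime := ⟨ht⟩
        obtain ⟨Q⟩ := Sylow.nonempty (p := t) (G := G ⧸ H)
        exact Q.not_dvd_index (htd.trans (index_dvd_of_le fun g hg =>
          (hmem g).2 (hsb g (Q.isPGroup'.isPElt hg))))
    intro g
    have := hle (mem_top g)
    rwa [mem_centralizer_singleton_iff, ← mul_inv_eq_iff_eq_mul] at this
  refine hb1 (Subtype.ext ?_)
  rw [← hnb]
  refine ((QuotientGroup.eq_one_iff n).2 (commutator_mem_hypercenter fun y => ?_)).symm
  rw [← QuotientGroup.eq_one_iff]
  have h4 := hcen (QuotientGroup.mk y)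
  rw [← hnb] at h4
  change QuotientGroup.mk (n * y * n⁻¹ * y⁻¹) = (1 : G ⧸ H)
  have h5 : (QuotientGroup.mk y : G ⧸ H) * QuotientGroup.mk n * (QuotientGroup.mk y)⁻¹ = QuotientGroup.mk n := h4
  rw [mul_inv_eq_iff_eq_mul] at h5
  rw [QuotientGroup.mk_mul, QuotientGroup.mk_mul, QuotientGroup.mk_mul, QuotientGroup.mk_inv,
    QuotientGroup.mk_inv, ← h5]
  group

end Hypercenter

/-! ### Recognising `SL₂(3)` -/

section SpecialLinear

variable {G : Type*} [Group G] {y a b : G}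

namespace QuatTriple

theorem mem_normalizer (h : QuatTriple y a b) :
    y ∈ normalizer (closure ({a, b} : Set G) : Set G) := by
  have ma : a ∈ closure ({a, b} : Set G) := subset_closure (by simp)
  have mb : b ∈ closure ({a, b} : Set G) := subset_closure (by simp)
  rw [mem_normalizer_iff_map_conj_eq, MonoidHom.map_closure, Set.image_pair]
  have e1 : (MulAut.conj y : G →* G) a = b := h.map_a
  have e2 : (MulAut.conj y : G →* G) b = a * b := h.map_b
  rw [e1, e2]
  refine le_antisymm ((closure_le _).2 ?_) ((closure_le _).2 ?_)
  · rintro x (rfl | rfl)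
    exacts [mb, mul_mem ma mb]
  · have mb' : b ∈ closure ({b, a * b} : Set G) := subset_closure (by simp)
    have mab : a * b ∈ closure ({b, a * b} : Set G) := subset_closure (by simp)
    rintro x (rfl | rfl)
    · simpa using mul_mem mab (inv_mem mb')
    · exact mb'

theorem map {H : Type*} [Group H] (h : QuatTriple y a b) (f : G →* H) (hf : f a ^ 2 ≠ 1) :
    QuatTriple (f y) (f a) (f b) where
  sq_eq := by rw [← map_pow, h.sq_eq, map_pow]
  conj := by rw [← map_inv, ← _root_.map_mul, ← _root_.map_mul, h.conj, map_inv]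
  ne_one := hf
  map_a := by rw [← map_inv, ← _root_.map_mul, ← _root_.map_mul, h.map_a]
  map_b := by rw [← map_inv, ← _root_.map_mul, ← _root_.map_mul, h.map_b, _root_.map_mul]

theorem exists_eq_mul_zpow (h : QuatTriple y a b) {x : G} (hx : x ∈ closure ({y, a, b} : Set G)) :
    ∃ l ∈ closure ({a, b} : Set G), ∃ n : ℤ, x = l * y ^ n := by
  set L := closure ({a, b} : Set G)
  have hn : ∀ n : ℤ, ∀ l ∈ L, y ^ n * l * (y ^ n)⁻¹ ∈ L := fun n l hl =>
    (mem_normalizer_iff.1 (zpow_mem h.mem_normalizer n) l).1 hl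
  let T : Subgroup G :=
    { carrier := {x | ∃ l ∈ L, ∃ n : ℤ, x = l * y ^ n}
      mul_mem' := by
        rintro _ _ ⟨l, hl, n, rfl⟩ ⟨l', hl', m, rfl⟩
        exact ⟨_, mul_mem hl (hn n l' hl'), n + m, by rw [zpow_add]; group⟩
      one_mem' := ⟨1, one_mem L, 0, by simp⟩
      inv_mem' := by
        rintro _ ⟨l, hl, n, rfl⟩
        exact ⟨_, hn (-n) l⁻¹ (inv_mem hl), -n, by group⟩ }
  have hle : closure ({y, a, b} : Set G) ≤ T := by
    rw [closure_le]
    rintro x (rfl | rfl | rfl)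
    · exact ⟨1, one_mem L, 1, by simp⟩
    · exact ⟨x, subset_closure (by simp), 0, by simp⟩
    · exact ⟨x, subset_closure (by simp), 0, by simp⟩
  exact hle hx

/-- The cosets of the quaternion group by `1`, `y`, `y ^ 2` exhaust the group; they are distinct
because an element of order three is not in a group of order eight. -/
theorem card_closure_eq (h : QuatTriple y a b) (hy : y ^ 3 = 1) :
    Nat.card (closure ({y, a, b} : Set G)) = 24 := by
  set L := closure ({a, b} : Set G) with hL
  set T := closure ({y, a, b} : Set G) with hT
  have hcard : Nat.card L = 8 := h.card_closure
  have hLT : L ≤ T := closure_mono (by simp)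
  have hyT : y ∈ T := subset_closure (by simp)
  have hyL : y ∉ L := by
    intro hyL
    have h8 : y ^ 8 = 1 := by
      have := pow_card_eq_one' (x := (⟨y, hyL⟩ : L))
      rw [hcard] at this
      exact congrArg Subtype.val this
    have h1 : y = 1 := by
      calc y = (y ^ 3) ^ 3 * (y ^ 8)⁻¹ := by group
        _ = 1 := by rw [hy, h8]; simp
    exact h.not_commute_y (h1 ▸ Commute.one_left a)
  let F : L × Fin 3 → T := fun x => ⟨x.1 * y ^ (x.2 : ℕ), mul_mem (hLT x.1.2) (pow_mem hyT _)⟩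
  have hF : Function.Bijective F := by
    constructor
    · rintro ⟨l, i⟩ ⟨l', j⟩ hij
      have hij' : (l : G) * y ^ (i : ℕ) = l' * y ^ (j : ℕ) := congrArg Subtype.val hij
      have key : ∀ (l l' : L) (i j : Fin 3), (l : G) * y ^ (i : ℕ) = l' * y ^ (j : ℕ) →
          ¬ i < j := by
        intro l l' i j hij hlt
        have h1 : y ^ ((j : ℕ) - i) ∈ L := by
          have : y ^ ((j : ℕ) - i) = (l' : G)⁻¹ * l := by
            rw [eq_inv_mul_iff_mul_eq, pow_sub _ hlt.le, ← mul_assoc, ← hij, mul_inv_cancel_right]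
          rw [this]
          exact mul_mem (inv_mem l'.2) l.2
        have h2 : (j : ℕ) - i = 1 ∨ (j : ℕ) - i = 2 := by have := j.2; omega
        rcases h2 with h2 | h2 <;> rw [h2] at h1
        · exact hyL (by simpa using h1)
        · refine hyL ?_
          have : y = (y ^ 2)⁻¹ := by rw [eq_inv_iff_mul_eq_one, ← pow_succ', hy]
          rw [this]; exact inv_mem h1
      have hij'' : i = j := le_antisymm (not_lt.1 (key _ _ _ _ hij'.symm)) (not_lt.1 (key _ _ _ _ hij'))
      subst hij''
      rw [mul_left_inj] at hij'
      rw [Subtype.ext hij']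
    · rintro ⟨x, hx⟩
      obtain ⟨l, hl, n, rfl⟩ := h.exists_eq_mul_zpow hx
      have h1 : (n % 3).toNat < 3 := by omega
      refine ⟨⟨⟨l, hl⟩, ⟨(n % 3).toNat, h1⟩⟩, Subtype.ext ?_⟩
      change l * y ^ (n % 3).toNat = l * y ^ n
      rw [mul_right_inj, ← zpow_natCast, Int.toNat_of_nonneg (by omega)]
      conv_rhs => rw [← Int.emod_add_mul_ediv n 3, zpow_add, zpow_mul]
      have : y ^ (3 : ℤ) = 1 := by rw [zpow_ofNat]; exact hy
      rw [this, one_zpow, mul_one]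
  rw [← Nat.card_congr (Equiv.ofBijective F hF), Nat.card_prod, hcard, Nat.card_fin]

end QuatTriple

theorem card_specialLinearGroup_two_three :
    Nat.card (Matrix.SpecialLinearGroup (Fin 2) (ZMod 3)) = 24 := by
  rw [Nat.card_eq_fintype_card]
  decide +kernel

theorem exists_quatTriple_specialLinearGroup :
    ∃ y a b : Matrix.SpecialLinearGroup (Fin 2) (ZMod 3), QuatTriple y a b ∧ y ^ 3 = 1 ∧
      Subgroup.closure {y, a, b} = ⊤ := by
  let y : Matrix.SpecialLinearGroup (Fin 2) (ZMod 3) := ⟨!![1, 1; 0, 1], by decide⟩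
  let a : Matrix.SpecialLinearGroup (Fin 2) (ZMod 3) := ⟨!![0, 2; 1, 0], by decide⟩
  let b : Matrix.SpecialLinearGroup (Fin 2) (ZMod 3) := ⟨!![1, 1; 1, 2], by decide⟩
  have h : QuatTriple y a b :=
    { sq_eq := by decide +kernel
      conj := by
        rw [mul_inv_eq_iff_eq_mul, eq_inv_mul_iff_mul_eq]
        exact Subtype.ext (by decide +kernel)
      ne_one := by decide +kernel
      map_a := by rw [mul_inv_eq_iff_eq_mul]; decide +kernel
      map_b := by rw [mul_inv_eq_iff_eq_mul]; decide +kernel }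
  have hy : y ^ 3 = 1 := by decide +kernel
  refine ⟨y, a, b, h, hy, ?_⟩
  exact eq_top_of_card_eq _ ((h.card_closure_eq hy).trans card_specialLinearGroup_two_three.symm)

/-- Any group generated by a quaternion group and a compatible element of order three is
`SL₂(3)`. -/
theorem QuatTriple.nonempty_mulEquiv_specialLinearGroup [Finite G] (h : QuatTriple y a b)
    (hy : y ^ 3 = 1) :
    Nonempty (closure ({y, a, b} : Set G) ≃* Matrix.SpecialLinearGroup (Fin 2) (ZMod 3)) := by
  obtain ⟨Y, A, B, h', hY, htop⟩ := exists_quatTriple_specialLinearGroup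
  -- In the direct product with `SL₂(3)` the pairs again form a triple and generate a group of order
  -- `24`. Both projections of it are bijective, so it is the graph of an isomorphism.
  have hp : QuatTriple (y, Y) (a, A) (b, B) :=
    { sq_eq := Prod.ext h.sq_eq h'.sq_eq
      conj := Prod.ext h.conj h'.conj
      ne_one := fun h1 => h.ne_one (congrArg Prod.fst h1)
      map_a := Prod.ext h.map_a h'.map_a
      map_b := Prod.ext h.map_b h'.map_b }
  have hcard := hp.card_closure_eq (Prod.ext hy hY)
  set Γ := closure ({(y, Y), (a, A), (b, B)} : Set (G × Matrix.SpecialLinearGroup (Fin 2) (ZMod 3)))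
    with hΓ
  let f := (MonoidHom.fst G (Matrix.SpecialLinearGroup (Fin 2) (ZMod 3))).subgroupMap Γ
  let g := (MonoidHom.snd G (Matrix.SpecialLinearGroup (Fin 2) (ZMod 3))).comp Γ.subtype
  have h1 : Γ.map (MonoidHom.fst G (Matrix.SpecialLinearGroup (Fin 2) (ZMod 3))) =
      closure ({y, a, b} : Set G) := by
    rw [hΓ, MonoidHom.map_closure, Set.image_insert_eq, Set.image_pair]; rfl
  have h2 : Γ.map (MonoidHom.snd G (Matrix.SpecialLinearGroup (Fin 2) (ZMod 3))) = ⊤ := by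
    rw [hΓ, MonoidHom.map_closure, Set.image_insert_eq, Set.image_pair]; exact htop
  have hg : Function.Bijective g := by
    rw [Nat.bijective_iff_surjective_and_card]
    refine ⟨fun x => ?_, hcard.trans card_specialLinearGroup_two_three.symm⟩
    obtain ⟨z, hz, hzx⟩ := (h2 ▸ mem_top x :
      x ∈ Γ.map (MonoidHom.snd G (Matrix.SpecialLinearGroup (Fin 2) (ZMod 3))))
    exact ⟨⟨z, hz⟩, hzx⟩
  have hf : Function.Bijective f := by
    rw [Nat.bijective_iff_surjective_and_card]
    refine ⟨MonoidHom.subgroupMap_surjective _ Γ, ?_⟩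
    rw [hcard, h1, h.card_closure_eq hy]
  exact ⟨((MulEquiv.subgroupCongr h1.symm).trans (MulEquiv.ofBijective f hf).symm).trans
    (MulEquiv.ofBijective g hg)⟩

end SpecialLinear

/-! ### Frobenius quotients and a nilpotency criterion -/

section Frobenius

variable {G : Type*} [Group G]

theorem isFrobenius_of_disjoint {N A : Subgroup G} (hN : N.Normal) (hN₁ : N ≠ ⊥) (hA₁ : A ≠ ⊥)
    (hd : Disjoint N A) (hs : N ⊔ A = ⊤)
    (hf : ∀ a ∈ A, a ≠ 1 → ∀ n ∈ N, a * n * a⁻¹ = n → n = 1) : IsFrobenius N A where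
  normal := hN
  kernel_ne_bot := hN₁
  complement_ne_bot := hA₁
  isComplement := isComplement'_of_disjoint_and_mul_eq_univ hd (by
    rw [← normal_mul, hs]; rfl)
  fixedPointFree := hf

theorem sup_eq_top_of_index [Finite G] {A B : Subgroup G}
    (h : ∀ t : ℕ, t.Prime → t ∣ A.index → t ∣ B.index → False) : A ⊔ B = ⊤ := by
  rw [← index_eq_one]
  by_contra hne
  obtain ⟨t, ht, htd⟩ := Nat.exists_prime_and_dvd hne
  exact h t ht (htd.trans (index_dvd_of_le le_sup_left)) (htd.trans (index_dvd_of_le le_sup_right))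

theorem sylow_sup_sylow [Finite G] {p q : ℕ} (hp : p.Prime) (hq : q.Prime)
    (hG : ∀ r : ℕ, r.Prime → r ∣ Nat.card G → r = p ∨ r = q) (P : Sylow p G) (Q : Sylow q G) :
    (P : Subgroup G) ⊔ Q = ⊤ := by
  have hfp : Fact p.Prime := ⟨hp⟩
  have hfq : Fact q.Prime := ⟨hq⟩
  refine sup_eq_top_of_index fun t ht h1 h2 => ?_
  rcases hG t ht (h1.trans (index_dvd_card _)) with rfl | rfl
  · exact P.not_dvd_index h1
  · exact Q.not_dvd_index h2

theorem isPGroup_of_forall {p q : ℕ} [Finite G] (hp : p.Prime) (hq : q.Prime) (hpq : p ≠ q)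
    (hG : ∀ r : ℕ, r.Prime → r ∣ Nat.card G → r = p ∨ r = q) {H : Subgroup G}
    (h : ∀ x ∈ H, IsPElt q x → x = 1) : IsPGroup p H := by
  refine isPGroup_of_isPElt fun x hx => ?_
  obtain ⟨a, b, hab, ha, hb⟩ := exists_pow_mul_pow hp hq hpq hG x
  rw [hab, h _ (pow_mem hx b) hb, mul_one]
  exact ha

variable [Finite G] {p q : ℕ}

/-- If all `q`-elements lie in the `q`-core and all `p`-elements outside the `p`-core act on it
without fixed points, then the quotient by the hypercentre is a Frobenius group. -/
theorem isFrobenius_quotient_hypercenter (hp : p.Prime) (hq : q.Prime) (hpq : p ≠ q)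
    (hG : ∀ r : ℕ, r.Prime → r ∣ Nat.card G → r = p ∨ r = q)
    (hM : ∀ x : G, IsPElt q x → x ∈ pCore q G)
    (hfix : ∀ x : G, IsPElt p x → x ∉ pCore p G → ∀ m ∈ pCore q G, Commute x m → m = 1)
    {y : G} (hy : IsPElt p y) (hyO : y ∉ pCore p G) :
    IsPGroup p (hypercenter G) ∧ ∃ (R : Sylow q (G ⧸ hypercenter G))
      (A : Subgroup (G ⧸ hypercenter G)), IsFrobenius (R : Subgroup (G ⧸ hypercenter G)) A := by
  have hfp : Fact p.Prime := ⟨hp⟩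
  have hfq : Fact q.Prime := ⟨hq⟩
  have hdis : ∀ x, x ∈ pCore p G → x ∈ pCore q G → x = 1 := fun x h1 h2 =>
    eq_one_of_mem_of_mem hp hq hpq (isPGroup_pCore p) (isPGroup_pCore q) h1 h2
  have hQ : pCore q G ≠ ⊥ := by
    intro h
    refine hyO (le_pCore (N := ⊤) inferInstance (isPGroup_of_forall hp hq hpq hG ?_) (mem_top y))
    intro x _ hx
    have := hM x hx
    rwa [h, mem_bot] at this
  -- If `g` is central modulo `O_p`, its commutators with `O_q` lie in `O_p ∩ O_q = 1`; so its
  -- `p`-part lies in `O_p`, and its `q`-part is a fixed point of `y`, hence trivial. Conversely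
  -- `O_p` is centralised by all `q`-elements.
  have hZ : hypercenter G = pCore p G := by
    apply le_antisymm
    · refine hypercenter_le fun g hg => ?_
      have hcom : ∀ n : ℕ, ∀ m ∈ pCore q G, Commute (g ^ n) m := by
        intro n m hm
        refine Commute.pow_left ?_ n
        have h1 : g * m * g⁻¹ * m⁻¹ ∈ pCore q G :=
          mul_mem ((pCore_normal q G).conj_mem m hm g) (inv_mem hm)
        have h2 := hdis _ (hg m) h1
        exact commutatorElement_eq_one_iff_commute.1 h2
      obtain ⟨i, j, hij, hi, hj⟩ := exists_pow_mul_pow hp hq hpq hG g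
      have h1 : g ^ i ∈ pCore p G := by
        by_contra h
        refine hQ (eq_bot_iff.2 fun m hm => ?_)
        exact hfix _ hi h m hm (hcom i m hm)
      have h2 : g ^ j = 1 := by
        have hjM := hM _ hj
        refine hfix y hy hyO _ hjM ?_
        have h3 : y * g ^ j * y⁻¹ * (g ^ j)⁻¹ ∈ pCore q G :=
          mul_mem ((pCore_normal q G).conj_mem _ hjM y) (inv_mem hjM)
        have h4 : y * g ^ j * y⁻¹ * (g ^ j)⁻¹ ∈ pCore p G := by
          have hgy : ((g : G ⧸ pCore p G)) * y = y * g := by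
            rw [← QuotientGroup.mk_mul, ← QuotientGroup.mk_mul]
            have := (QuotientGroup.eq_one_iff _).2 (hg y)
            rw [commutatorElement_def, QuotientGroup.mk_mul, QuotientGroup.mk_inv,
              mul_inv_eq_one, QuotientGroup.mk_mul, QuotientGroup.mk_inv,
              mul_inv_eq_iff_eq_mul, ← QuotientGroup.mk_mul] at this
            exact this
          rw [← QuotientGroup.eq_one_iff]
          simp only [QuotientGroup.mk_mul, QuotientGroup.mk_inv, QuotientGroup.mk_pow]
          have hc : Commute (y : G ⧸ pCore p G) ((g : G ⧸ pCore p G) ^ j) :=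
            (show Commute (y : G ⧸ pCore p G) g from hgy.symm).pow_right j
          rw [hc.eq, mul_inv_cancel_right, mul_inv_cancel]
        exact commutatorElement_eq_one_iff_commute.1 (hdis _ h4 h3)
      rw [hij, h2, mul_one]
      exact h1
    · refine le_hypercenter hp hq hpq hG inferInstance (isPGroup_pCore p) fun n hn z hz => ?_
      exact (commute_of_mem_pCore hp hq hpq hn (hM z hz)).symm
  -- Stated for a variable `Z`, so that the equality can be substituted inside the quotient types.
  have key : ∀ (Z : Subgroup G) [Z.Normal], Z = pCore p G → IsPGroup p Z ∧
      ∃ (R : Sylow q (G ⧸ Z)) (A : Subgroup (G ⧸ Z)), IsFrobenius (R : Subgroup (G ⧸ Z)) A := by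
    rintro Z _ rfl
    refine ⟨isPGroup_pCore p, ?_⟩
    have hsurj := QuotientGroup.mk'_surjective (pCore p G)
    obtain ⟨P⟩ := Sylow.nonempty (p := p) (G := G)
    obtain ⟨Q⟩ := Sylow.nonempty (p := q) (G := G)
    have hQM : (Q : Subgroup G) = pCore q G :=
      le_antisymm (fun x hx => hM x (Q.isPGroup'.isPElt hx))
        ((isPGroup_pCore q).le_sylow_of_normal Q)
    let f := QuotientGroup.mk' (pCore p G)
    let R := Q.mapSurjective hsurj
    let A := P.mapSurjective hsurj
    have hR : (R : Subgroup (G ⧸ pCore p G)) = (pCore q G).map f := by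
      rw [← hQM]; exact Q.coe_mapSurjective hsurj
    have hA : (A : Subgroup (G ⧸ pCore p G)) = (P : Subgroup G).map f := P.coe_mapSurjective hsurj
    refine ⟨R, A, isFrobenius_of_disjoint ?_ ?_ ?_ ?_ ?_ ?_⟩
    · rw [hR]; exact (pCore_normal q G).map f hsurj
    · rw [hR, ne_eq, Subgroup.map_eq_bot_iff, QuotientGroup.ker_mk']
      exact fun h => hQ (eq_bot_iff.2 fun x hx => hdis x (h hx) hx)
    · rw [hA, ne_eq, Subgroup.map_eq_bot_iff, QuotientGroup.ker_mk']
      intro h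
      obtain ⟨T, hT⟩ := hy.isPGroup_zpowers.exists_le_sylow
      obtain ⟨g, hg⟩ := MulAction.exists_smul_eq G T P
      have hgP : g * y * g⁻¹ ∈ (P : Subgroup G) := by
        rw [← hg, Sylow.coe_subgroup_smul]
        exact smul_mem_pointwise_smul y (MulAut.conj g) (T : Subgroup G) (hT (mem_zpowers y))
      have := (pCore_normal p G).conj_mem _ (h hgP) g⁻¹
      exact hyO (by simpa [mul_assoc] using this)
    · exact disjoint_of_isPGroup hq hp hpq.symm R.isPGroup' A.isPGroup'
    · rw [sup_comm]
      exact sylow_sup_sylow hp hq (card_quotient_primes hG _) A R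
    · rw [hR, hA]
      rintro _ ⟨a, ha, rfl⟩ ha1 _ ⟨m, hm, rfl⟩ ham
      have h1 : a * m * a⁻¹ * m⁻¹ ∈ pCore p G := by
        rw [← QuotientGroup.eq_one_iff, QuotientGroup.mk_mul, QuotientGroup.mk_inv, mul_inv_eq_one]
        exact ham
      have h2 : a * m * a⁻¹ * m⁻¹ ∈ pCore q G :=
        mul_mem ((pCore_normal q G).conj_mem _ hm a) (inv_mem hm)
      rw [hfix a (P.isPGroup'.isPElt ha) (fun h => ha1 ((QuotientGroup.eq_one_iff a).2 h)) m hm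
        (commutatorElement_eq_one_iff_commute.1 (hdis _ h1 h2)), map_one]
  exact key _ hZ

/-- Each core is centralised by the elements of the other prime power order, so both cores are
hypercentral. -/
theorem isNilpotent_of_mem_pCore (hp : p.Prime) (hq : q.Prime) (hpq : p ≠ q)
    (hG : ∀ r : ℕ, r.Prime → r ∣ Nat.card G → r = p ∨ r = q)
    (h₁ : ∀ x : G, IsPElt p x → x ∈ pCore p G) (h₂ : ∀ x : G, IsPElt q x → x ∈ pCore q G) :
    Group.IsNilpotent G := by
  have hle : hypercenter G = ⊤ := by
    rw [eq_top_iff]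
    refine mem_of_parts hp hq hpq hG (fun x _ hx => ?_) fun x _ hx => ?_
    · exact le_hypercenter hp hq hpq hG inferInstance (isPGroup_pCore p) (fun n hn y hy =>
        (commute_of_mem_pCore hp hq hpq hn (h₂ y hy)).symm) (h₁ x hx)
    · exact le_hypercenter hq hp hpq.symm (fun t ht h => (hG t ht h).symm) inferInstance
        (isPGroup_pCore q) (fun n hn y hy => (commute_of_mem_pCore hp hq hpq (h₁ y hy) hn))
        (h₂ x hx)
  obtain ⟨n, hn⟩ := WellFoundedGT.monotone_chain_condition
    (⟨_, Subgroup.upperCentralSeries_mono G⟩ : ℕ →o Subgroup G)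
  refine ⟨n, ?_⟩
  rw [eq_top_iff, ← hle]
  refine iSup_le fun m => ?_
  rcases le_total n m with hm | hm
  · exact (hn m hm).ge
  · exact Subgroup.upperCentralSeries_mono G hm

end Frobenius

/-! ### A quaternion `2`-core and the action on its cyclic subgroups of order four -/

section QuaternionCore

variable {G : Type*} [Group G] {y a b : G}

/-- A tidy `{2, 3}`-group whose `2`-core is the quaternion group generated by `a` and `b`, on which
the `3`-element `y` acts nontrivially. -/
structure QuatCore (y a b : G) : Prop extends QuatTriple y a b where
  tidy : IsTidy G
  primes : ∀ r : ℕ, r.Prime → r ∣ Nat.card G → r = 2 ∨ r = 3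
  core : pCore 2 G = closure {a, b}
  isPElt : IsPElt 3 y

theorem QuatPair.inv_sq (h : QuatPair a b) : (a ^ 2)⁻¹ = a ^ 2 := inv_eq_of_mul_eq_one_left h.sq_sq

theorem QuatPair.sq_of_mem (h : QuatPair a b) {x : G} (hx : x ∈ closure ({a, b} : Set G)) :
    (x = 1 ∨ x = a ^ 2) ∨ x ^ 2 = a ^ 2 := by
  rcases h.mem_cases hx with h1 | ⟨j, rfl | rfl⟩
  · exact Or.inl h1
  · exact Or.inr (h.vec_sq j)
  · exact Or.inr (by rw [inv_pow, h.vec_sq, h.inv_sq])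

theorem QuatPair.eq_of_vec (h : QuatPair a b) {x : G} {i j : Fin 3}
    (hi : x = ![a, b, a * b] i ∨ x = (![a, b, a * b] i)⁻¹)
    (hj : x = ![a, b, a * b] j ∨ x = (![a, b, a * b] j)⁻¹) : i = j := by
  rcases hi with rfl | rfl
  · exact h.vec_eq hj
  · refine h.vec_eq ?_
    rcases hj with h2 | h2
    · exact Or.inr (inv_eq_iff_eq_inv.1 h2)
    · exact Or.inl (inv_injective h2)

/-- Conjugation by `g` fixes the square of the generators of a normal quaternion subgroup. -/
theorem QuatPair.sq_mem_center (h : QuatPair a b) (hn : (closure ({a, b} : Set G)).Normal) :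
    a ^ 2 ∈ center G := by
  rw [mem_center_iff]
  intro g
  have ha : a ∈ closure ({a, b} : Set G) := subset_closure (by simp)
  have h2 : (g * a * g⁻¹) ^ 2 = g * a ^ 2 * g⁻¹ := conj_pow
  rw [← mul_inv_eq_iff_eq_mul, ← h2]
  rcases h.sq_of_mem (hn.conj_mem a ha g) with (h1 | h1) | h1
  · exact absurd (by rw [← h2, h1, one_pow] : g * a ^ 2 * g⁻¹ = 1) (by
      rw [conj_eq_one_iff]; exact h.ne_one)
  · exact absurd (by rw [← h2, h1, pow_two, h.sq_sq] : g * a ^ 2 * g⁻¹ = 1) (by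
      rw [conj_eq_one_iff]; exact h.ne_one)
  · exact h1

namespace QuatCore

theorem normal (h : QuatCore y a b) : (closure ({a, b} : Set G)).Normal :=
  h.core ▸ pCore_normal 2 G

theorem sq_central (h : QuatCore y a b) (g : G) : Commute (a ^ 2) g :=
  (mem_center_iff.1 (h.toQuatPair.sq_mem_center h.normal) g).symm

theorem isPElt_of_mem (h : QuatCore y a b) {x : G} (hx : x ∈ closure ({a, b} : Set G)) :
    IsPElt 2 x := IsPElt.of_mem_pCore (h.core ▸ hx)

theorem commute_of_mem (h : QuatCore y a b) {l o : G} (hl : l ∈ closure ({a, b} : Set G))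
    (ho : o ∈ pCore 3 G) : Commute l o :=
  commute_of_mem_pCore Nat.prime_two Nat.prime_three (by norm_num) (h.core ▸ hl) ho

theorem eq_one_of_mem (h : QuatCore y a b) {x : G} (hx : x ∈ closure ({a, b} : Set G))
    (hx' : IsPElt 3 x) : x = 1 :=
  (h.isPElt_of_mem hx).eq_one_of_ne Nat.prime_two Nat.prime_three (by norm_num) hx'

/-- By tidiness the `2`-elements centralising `O_2` lie in `⟨a ^ 2⟩`, so `C(O_2)` is a `3`-group
modulo its central subgroup `C(O_2) ∩ O_2`. -/
theorem mem_pCore_three [Finite G] (h : QuatCore y a b) {x : G} (hx : IsPElt 3 x)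
    (ha : Commute x a) (hb : Commute x b) : x ∈ pCore 3 G := by
  have hmem : ∀ g : G, g ∈ centralizer (closure ({a, b} : Set G) : Set G) ↔
      Commute g a ∧ Commute g b := by
    intro g
    rw [centralizer_closure, mem_centralizer_iff]
    refine ⟨fun h => ⟨(h a (by simp)).symm, (h b (by simp)).symm⟩, fun h z hz => ?_⟩
    rcases hz with rfl | rfl
    exacts [h.1.eq.symm, h.2.eq.symm]
  have hn := h.normal
  refine mem_pCore_of_central Nat.prime_three (C := centralizer (closure ({a, b} : Set G) : Set G))
    (M := closure ({a, b} : Set G)) inferInstance hn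
    (fun c hc m _ hm => ((mem_centralizer_iff.1 hc) m hm).symm) (fun c hc => ?_)
    ((hmem x).2 ⟨ha, hb⟩) hx
  obtain ⟨i, j, hij, hi, k, hk⟩ :=
    exists_pow_mul_pow Nat.prime_two Nat.prime_three (by norm_num) h.primes c
  have hc' := (hmem c).1 hc
  have hci : c ^ i ∈ closure ({a, b} : Set G) := by
    rcases h.toQuatPair.eq_of_commute h.tidy hi (hc'.1.pow_left i) (hc'.2.pow_left i) with h1 | h1
    · rw [h1]; exact one_mem _
    · rw [h1]; exact pow_mem (subset_closure (by simp)) 2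
  refine ⟨k, ?_⟩
  rw [hij, ((Commute.refl c).pow_pow i j).mul_pow, hk, mul_one]
  exact pow_mem hci _

theorem cube_mem [Finite G] (h : QuatCore y a b) : y ^ 3 ∈ pCore 3 G :=
  h.mem_pCore_three (h.isPElt.pow 3) h.commute_cube_a h.commute_cube_b

/-- The action of `G` on the three cyclic subgroups of order four of its `2`-core. -/
noncomputable def perm (h : QuatCore y a b) : G →* Equiv.Perm (Fin 3) :=
  (h.toQuatPair.exists_perm h.normal).choose

theorem perm_spec (h : QuatCore y a b) (g : G) (i : Fin 3) :
    g * ![a, b, a * b] i * g⁻¹ = ![a, b, a * b] (h.perm g i) ∨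
      g * ![a, b, a * b] i * g⁻¹ = (![a, b, a * b] (h.perm g i))⁻¹ :=
  (h.toQuatPair.exists_perm h.normal).choose_spec g i

theorem perm_eq (h : QuatCore y a b) {g : G} {i j : Fin 3}
    (hg : g * ![a, b, a * b] i * g⁻¹ = ![a, b, a * b] j ∨
      g * ![a, b, a * b] i * g⁻¹ = (![a, b, a * b] j)⁻¹) : h.perm g i = j :=
  h.toQuatPair.eq_of_vec (h.perm_spec g i) hg

theorem perm_y (h : QuatCore y a b) : h.perm y ^ 3 = 1 ∧ h.perm y ≠ 1 := by
  have h0 : h.perm y 0 = 1 := h.perm_eq (Or.inl h.map_a)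
  have h1 : h.perm y 1 = 2 := h.perm_eq (Or.inl h.map_b)
  revert h0 h1
  generalize h.perm y = τ
  revert τ
  decide

theorem perm_vec (h : QuatCore y a b) (i : Fin 3) : h.perm (![a, b, a * b] i) i = i :=
  h.perm_eq (Or.inl (by rw [mul_inv_cancel_right]))

theorem perm_of_mem (h : QuatCore y a b) {l : G} (hl : l ∈ closure ({a, b} : Set G)) :
    h.perm l = 1 := by
  have h0 : h.perm a 0 = 0 := h.perm_vec 0
  have h1 : h.perm b 1 = 1 := h.perm_vec 1
  have h2 : (h.perm a * h.perm b) 2 = 2 := by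
    rw [← _root_.map_mul]; exact h.perm_vec 2
  have key : ∀ σ τ : Equiv.Perm (Fin 3), σ 0 = 0 ∧ τ 1 = 1 ∧ (σ * τ) 2 = 2 → σ = 1 ∧ τ = 1 := by
    decide
  obtain ⟨ha, hb⟩ := key _ _ ⟨h0, h1, h2⟩
  have hle : closure ({a, b} : Set G) ≤ h.perm.ker := by
    rw [closure_le]
    rintro x (rfl | rfl)
    exacts [ha, hb]
  exact hle hl

/-- Fixing the three cyclic subgroups means inducing an inner automorphism of `O_2`. After division
by a suitable `l` the element centralises `O_2`, and its two parts lie in `⟨a ^ 2⟩` and `O_3`. Thus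
the kernel of the action is `O_2 O_3`. -/
theorem exists_of_perm_eq_one [Finite G] (h : QuatCore y a b) {g : G} (hg : h.perm g = 1) :
    ∃ l ∈ closure ({a, b} : Set G), ∃ o ∈ pCore 3 G, g = l * o := by
  have ha := h.perm_spec g 0
  have hb := h.perm_spec g 1
  rw [hg] at ha hb
  obtain ⟨l, hl, hla, hlb⟩ := h.toQuatPair.exists_mul_commute ha hb
  obtain ⟨i, j, hij, hi, hj⟩ :=
    exists_pow_mul_pow Nat.prime_two Nat.prime_three (by norm_num) h.primes (l⁻¹ * g)
  have hci : (l⁻¹ * g) ^ i ∈ closure ({a, b} : Set G) := by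
    rcases h.toQuatPair.eq_of_commute h.tidy hi (hla.pow_left i) (hlb.pow_left i) with h1 | h1
    · rw [h1]; exact one_mem _
    · rw [h1]; exact pow_mem (subset_closure (by simp)) 2
  refine ⟨_, mul_mem hl hci, _, h.mem_pCore_three hj (hla.pow_left j) (hlb.pow_left j), ?_⟩
  rw [mul_assoc, ← hij, mul_inv_cancel_left]

theorem mem_of_perm_eq_one [Finite G] (h : QuatCore y a b) {g : G} (hg : h.perm g = 1)
    (hg2 : IsPElt 2 g) : g ∈ closure ({a, b} : Set G) := by
  obtain ⟨l, hl, o, ho, rfl⟩ := h.exists_of_perm_eq_one hg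
  have hlo := h.commute_of_mem hl ho
  have h1 : IsPElt 2 (l⁻¹ * (l * o)) :=
    (h.isPElt_of_mem hl).inv.mul_of_commute hg2
      (((Commute.refl l).mul_right hlo).inv_left)
  rw [inv_mul_cancel_left] at h1
  rw [h1.eq_one_of_ne Nat.prime_two Nat.prime_three (by norm_num) (IsPElt.of_mem_pCore ho), mul_one]
  exact hl

theorem mem_cyc_of_sq_eq {x v : G} (h : x ^ 2 = v) : x ∈ cyc G v :=
  mem_cyc_of_mem_zpowers (z := x) (by rw [← h]; exact pow_mem (mem_zpowers x) 2) (mem_zpowers x)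

/-- `a ^ 2` is the only involution. -/
theorem eq_of_sq_eq_one [Finite G] (h : QuatCore y a b) {t : G} (ht : t ^ 2 = 1) :
    t = 1 ∨ t = a ^ 2 := by
  by_cases hf : h.perm t = 1
  · have := h.mem_of_perm_eq_one hf ⟨1, by rw [pow_one, ht]⟩
    rcases h.toQuatPair.sq_of_mem this with h1 | h1
    · exact h1
    · exact absurd (h1.symm.trans ht) h.ne_one
  exfalso
  -- Let the involution `t` move `⟨c⟩`. Then `(t c) ^ 2 = (t c t⁻¹) c` has square `a ^ 2`, so `t c`
  -- and `c`, and with them `t`, lie in `Cyc(a ^ 2)`. This puts `t` in the central subgroup `⟨a ^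
  -- 2⟩`, which moves nothing.
  obtain ⟨i, hi⟩ : ∃ i, h.perm t i ≠ i := by
    by_contra! hc
    exact hf (Equiv.ext hc)
  set u := ![a, b, a * b] with hu
  set c := u i with hc
  set w := t * c * t⁻¹ with hw
  have htt : t⁻¹ = t := by rw [inv_eq_iff_mul_eq_one, ← pow_two, ht]
  have hcL : c ∈ closure ({a, b} : Set G) := QuatPair.vec_mem i
  have hwL : w ∈ closure ({a, b} : Set G) := h.normal.conj_mem _ hcL t
  have hnc : ¬ Commute w c := by
    intro hwc
    have h1 : Commute (u (h.perm t i)) (u i) := by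
      rcases h.perm_spec t i with h2 | h2
      · rw [← hu] at h2; rw [← h2]; exact hwc
      · rw [← hu] at h2; rw [← inv_inv (u (h.perm t i)), ← h2]; exact hwc.inv_left
    exact hi (h.toQuatPair.vec_commute_iff.1 h1)
  have hsq : (w * c) ^ 2 = a ^ 2 := by
    rcases h.toQuatPair.sq_of_mem (mul_mem hwL hcL) with (h1 | h1) | h1
    · exact absurd (by rw [eq_inv_of_mul_eq_one_left h1]; exact (Commute.refl c).inv_left) hnc
    · refine absurd ?_ hnc
      rw [eq_mul_inv_of_mul_eq h1]
      exact (h.sq_central c).mul_left (Commute.refl c).inv_left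
    · exact h1
  have h4 : ((t * c) ^ 2) ^ 2 = a ^ 2 := by
    rw [← hsq]
    congr 1
    rw [pow_two, hw, htt]
    simp only [mul_assoc]
  have h5 : t * c ∈ cyc G (a ^ 2) := mem_cyc_of_mem_zpowers (z := t * c)
    (by rw [← h4]; exact pow_mem (pow_mem (mem_zpowers _) 2) 2) (mem_zpowers _)
  have h6 : c ∈ cyc G (a ^ 2) := mem_cyc_of_sq_eq (h.toQuatPair.vec_sq i)
  have h7 := h.tidy.mul_mem h5 (inv_mem_cyc h6)
  rw [mul_inv_cancel_right] at h7
  have h8 : t ∈ zpowers (a ^ 2) := mem_zpowers_of_mem_cyc Nat.prime_two h.orderOf_sq ht h7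
  obtain ⟨n, hn⟩ := h8
  have h9 : Commute t c := by
    dsimp only at hn
    rw [← hn]; exact (h.sq_central c).zpow_left n
  refine hnc ?_
  rw [hw, h9.eq, mul_inv_cancel_right]

/-- `y` fixes none of the three cyclic subgroups of order four, whereas an element of order four
commuting with `y` modulo `⟨a ^ 2⟩` would generate a fixed one. -/
theorem eq_of_commute_mod (h : QuatCore y a b) {l : G} (hl : l ∈ closure ({a, b} : Set G))
    (hly : l⁻¹ * (y * l * y⁻¹) = 1 ∨ l⁻¹ * (y * l * y⁻¹) = a ^ 2) : l = 1 ∨ l = a ^ 2 := by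
  rcases h.toQuatPair.mem_cases hl with h1 | ⟨j, hj⟩
  · exact h1
  exfalso
  have h1 : y * ![a, b, a * b] j * y⁻¹ = ![a, b, a * b] j ∨
      y * ![a, b, a * b] j * y⁻¹ = (![a, b, a * b] j)⁻¹ := by
    have key : ∀ u : G, u ^ 2 = a ^ 2 → (u⁻¹ * (y * u * y⁻¹) = 1 ∨ u⁻¹ * (y * u * y⁻¹) = a ^ 2) →
        y * u * y⁻¹ = u ∨ y * u * y⁻¹ = u⁻¹ := by
      rintro u hu (h2 | h2)
      · exact Or.inl (inv_mul_eq_one.1 h2).symm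
      · right
        rw [inv_mul_eq_iff_eq_mul] at h2
        rw [h2, ← hu, eq_inv_iff_mul_eq_one]
        calc u * u ^ 2 * u = u ^ 2 * u ^ 2 := by group
          _ = 1 := by rw [hu, h.sq_sq]
    rcases hj with rfl | rfl
    · exact key _ (h.toQuatPair.vec_sq j) hly
    · have := key _ (by rw [inv_pow, h.toQuatPair.vec_sq, h.toQuatPair.inv_sq]) hly
      rw [← conj_inv, inv_inj, inv_inj] at this
      exact this
  have h2 := h.perm_eq h1
  have h0 : h.perm y 0 = 1 := h.perm_eq (Or.inl h.map_a)
  have h1 : h.perm y 1 = 2 := h.perm_eq (Or.inl h.map_b)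
  have hfix : ∀ (τ : Equiv.Perm (Fin 3)) (j : Fin 3), τ 0 = 1 ∧ τ 1 = 2 ∧ τ j = j → False := by
    decide
  exact hfix _ j ⟨h0, h1, h2⟩

end QuatCore

end QuaternionCore

/-! ### Frobenius groups with complement of order two -/

section FrobeniusTwo

variable {G : Type*} [Group G]

/-- A criterion for the quotient by a normal `2`-subgroup to be a Frobenius group with kernel the
Sylow `3`-subgroup and complement of order two. -/
theorem exists_isFrobenius_card_two [Finite G] {N S : Subgroup G} [N.Normal] (hN : IsPGroup 2 N)
    (hS : IsPGroup 3 S) (hS₁ : S ≠ ⊥) {t : G} (htS : t ∈ normalizer (S : Set G)) (ht : t ^ 2 ∈ N)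
    (htN : t ∉ N) (hfix : ∀ x ∈ S, Commute t x → x = 1) (hsup : N ⊔ S ⊔ zpowers t = ⊤) :
    ∃ (R : Sylow 3 (G ⧸ N)) (A : Subgroup (G ⧸ N)), IsFrobenius (R : Subgroup (G ⧸ N)) A ∧
      Nat.card A = 2 := by
  have hf3 : Fact (Nat.Prime 3) := ⟨Nat.prime_three⟩
  have hdis : ∀ x ∈ S, x ∈ N → x = 1 := fun x h1 h2 =>
    eq_one_of_mem_of_mem Nat.prime_three Nat.prime_two (by norm_num) hS hN h1 h2
  let f := QuotientGroup.mk' N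
  have hsurj : Function.Surjective f := QuotientGroup.mk'_surjective N
  have hft : (f t) ^ 2 = 1 := by rw [← map_pow]; exact (QuotientGroup.eq_one_iff _).2 ht
  have hft1 : f t ≠ 1 := fun h => htN ((QuotientGroup.eq_one_iff _).1 h)
  have hord : orderOf (f t) = 2 := orderOf_eq_prime hft hft1
  have hcardA : Nat.card (zpowers (f t)) = 2 := by rw [Nat.card_zpowers, hord]
  have hAel : ∀ x ∈ zpowers (f t), x = 1 ∨ x = f t := by
    rintro _ ⟨n, rfl⟩
    have h2 : f t ^ (2 : ℤ) = 1 := by rw [zpow_ofNat]; exact hft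
    rcases Int.even_or_odd' n with ⟨k, rfl | rfl⟩
    · left; dsimp only; rw [zpow_mul, h2, one_zpow]
    · right; dsimp only; rw [zpow_add, zpow_mul, h2, one_zpow, one_mul, zpow_one]
  have htop : S.map f ⊔ zpowers (f t) = ⊤ := by
    have h1 := congrArg (Subgroup.map f) hsup
    rw [Subgroup.map_sup, Subgroup.map_sup, (Subgroup.map_eq_bot_iff N).2 (by
      rw [QuotientGroup.ker_mk']), bot_sup_eq, MonoidHom.map_zpowers,
      Subgroup.map_top_of_surjective f hsurj] at h1
    exact h1
  have hnorm : (S.map f).Normal := by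
    rw [← normalizer_eq_top_iff, eq_top_iff, ← htop, sup_le_iff]
    refine ⟨le_normalizer, ?_⟩
    rw [zpowers_le]
    refine mem_normalizer_of_conj_mem ?_
    rintro _ ⟨x, hx, rfl⟩
    rw [← map_inv, ← map_mul, ← map_mul]
    exact mem_map_of_mem f ((mem_normalizer_iff.1 htS x).1 hx)
  have hA2 : IsPGroup 2 (zpowers (f t)) := IsPGroup.of_card (n := 1) (by rw [hcardA, pow_one])
  have hfrob : IsFrobenius (S.map f) (zpowers (f t)) := by
    refine isFrobenius_of_disjoint hnorm ?_ ?_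
      (disjoint_of_isPGroup Nat.prime_three Nat.prime_two (by norm_num) (hS.map f) hA2) htop ?_
    · rw [ne_eq, Subgroup.map_eq_bot_iff, QuotientGroup.ker_mk']
      exact fun h => hS₁ (eq_bot_iff.2 fun x hx => hdis x hx (h hx))
    · rw [ne_eq, zpowers_eq_bot]; exact hft1
    · rintro x hx hx1 _ ⟨s, hs, rfl⟩ hxs
      rcases hAel x hx with rfl | rfl
      · exact absurd rfl hx1
      · have h1 : t * s * t⁻¹ * s⁻¹ ∈ N := by
          rw [← QuotientGroup.eq_one_iff, QuotientGroup.mk_mul, QuotientGroup.mk_inv,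
            mul_inv_eq_one]
          exact hxs
        have h2 : t * s * t⁻¹ * s⁻¹ ∈ S :=
          mul_mem ((mem_normalizer_iff.1 htS s).1 hs) (inv_mem hs)
        rw [hfix s hs (commutatorElement_eq_one_iff_commute.1 (hdis _ h2 h1)), map_one]
  have hindex : ¬ 3 ∣ (S.map f).index := by
    rw [hfrob.isComplement.symm.index_eq_card, hcardA]; norm_num
  exact ⟨(hS.map f).toSylow hindex, zpowers (f t), hfrob, hcardA⟩

end FrobeniusTwo

/-! ### Quaternion core, image `A₃`: the group `SL₂(3)` -/

section QuaternionCore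

open scoped commutatorElement

variable {G : Type*} [Group G] {y a b : G}

theorem commutator_mem_iff {Z : Subgroup G} [Z.Normal] {g x : G} :
    ⁅g, x⁆ ∈ Z ↔ Commute (g : G ⧸ Z) (x : G ⧸ Z) := by
  rw [← QuotientGroup.eq_one_iff, ← commutatorElement_eq_one_iff_commute]
  rfl

namespace QuatCore

theorem mem_a : a ∈ closure ({a, b} : Set G) := subset_closure (by simp)

theorem mem_b : b ∈ closure ({a, b} : Set G) := subset_closure (by simp)

theorem nonempty_mulEquiv_core (h : QuatCore y a b) : Nonempty (pCore 2 G ≃* QuaternionGroup 2) :=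
  ⟨(MulEquiv.subgroupCongr h.core).trans h.toQuatPair.nonempty_mulEquiv.some⟩

theorem mem_zpowers_sq (h : QuatCore y a b) {x : G} : x ∈ zpowers (a ^ 2) ↔ x = 1 ∨ x = a ^ 2 := by
  constructor
  · rintro ⟨n, rfl⟩
    have h2 : (a ^ 2) ^ (2 : ℤ) = 1 := by rw [zpow_ofNat, pow_two]; exact h.sq_sq
    rcases Int.even_or_odd' n with ⟨k, rfl | rfl⟩
    · left; dsimp only; rw [zpow_mul, h2, one_zpow]
    · right; dsimp only; rw [zpow_add, zpow_mul, h2, one_zpow, one_mul, zpow_one]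
  · rintro (rfl | rfl)
    · exact one_mem _
    · exact mem_zpowers _

theorem centerOf_core [Finite G] (h : QuatCore y a b) : centerOf (pCore 2 G) = zpowers (a ^ 2) := by
  rw [h.core]
  ext x
  rw [h.mem_zpowers_sq, centerOf, mem_map]
  constructor
  · rintro ⟨z, hz, rfl⟩
    have hc := mem_center_iff.1 hz
    exact h.toQuatPair.eq_of_commute h.tidy (h.isPElt_of_mem z.2)
      (congrArg Subtype.val (hc ⟨a, mem_a⟩)).symm (congrArg Subtype.val (hc ⟨b, mem_b⟩)).symm
  · rintro (rfl | rfl)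
    · exact ⟨1, one_mem _, rfl⟩
    · exact ⟨⟨a ^ 2, pow_mem mem_a 2⟩, mem_center_iff.2 fun g =>
        Subtype.ext (h.sq_central g).eq.symm, rfl⟩

theorem zpowers_sq_le_center (h : QuatCore y a b) : zpowers (a ^ 2) ≤ center G := by
  rw [zpowers_le, mem_center_iff]
  exact fun g => (h.sq_central g).eq.symm

theorem normal_zpowers_sq (h : QuatCore y a b) : (zpowers (a ^ 2)).Normal :=
  ⟨fun n hn g => by
    rwa [(mem_center_iff.1 (h.zpowers_sq_le_center hn) g), mul_inv_cancel_right]⟩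

/-- Conjugation by `g` is trivial modulo `Z`, and `Z` meets `O_2` at most in `⟨a ^ 2⟩`; so `g` sends
each of `a`, `b`, `a * b` to itself or its inverse. -/
theorem perm_eq_one_of_central_mod (h : QuatCore y a b) {Z : Subgroup G} [Z.Normal]
    (hZ : ∀ x ∈ Z, x ∈ closure ({a, b} : Set G) → x = 1 ∨ x = a ^ 2) {g : G}
    (hg : ∀ x : G, ⁅g, x⁆ ∈ Z) : h.perm g = 1 := by
  ext i
  rw [h.perm_eq (j := i) ?_]
  · rfl
  · set u := ![a, b, a * b] i with hu
    have hmem : u ∈ closure ({a, b} : Set G) := QuatPair.vec_mem i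
    have husq : u ^ 2 = a ^ 2 := h.toQuatPair.vec_sq i
    rcases hZ _ (hg u) (mul_mem (h.normal.conj_mem _ hmem g) (inv_mem hmem)) with h1 | h1
    · exact Or.inl (mul_inv_eq_one.1 h1)
    · right
      rw [commutatorElement_def, mul_inv_eq_iff_eq_mul] at h1
      rw [h1, ← husq, eq_inv_iff_mul_eq_one]
      calc u ^ 2 * u * u = u ^ 2 * u ^ 2 := by group
        _ = 1 := by rw [husq, h.sq_sq]

theorem eq_of_central_mod (h : QuatCore y a b) {Z : Subgroup G} [Z.Normal]
    (hZ : ∀ x ∈ Z, x ∈ closure ({a, b} : Set G) → x = 1 ∨ x = a ^ 2) {l : G}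
    (hl : l ∈ closure ({a, b} : Set G)) (hly : Commute (l : G ⧸ Z) (y : G ⧸ Z)) :
    l = 1 ∨ l = a ^ 2 := by
  refine h.eq_of_commute_mod hl (hZ _ ?_ (mul_mem (inv_mem hl)
    ((mem_normalizer_iff.1 h.mem_normalizer l).1 hl)))
  rw [← QuotientGroup.eq_one_iff]
  simp only [QuotientGroup.mk_mul, QuotientGroup.mk_inv]
  rw [← hly.eq, mul_inv_cancel_right, inv_mul_cancel]

theorem quotient [Finite G] (h : QuatCore y a b) :
    QuatTriple (QuotientGroup.mk' (pCore 3 G) y) (QuotientGroup.mk' (pCore 3 G) a)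
      (QuotientGroup.mk' (pCore 3 G) b) := by
  refine h.toQuatTriple.map _ fun h1 => h.ne_one ?_
  rw [← map_pow] at h1
  exact h.eq_one_of_mem (pow_mem mem_a 2) (IsPElt.of_mem_pCore ((QuotientGroup.eq_one_iff _).1 h1))

theorem quotient_cube [Finite G] (h : QuatCore y a b) :
    (QuotientGroup.mk' (pCore 3 G) y) ^ 3 = 1 := by
  rw [← map_pow]
  exact (QuotientGroup.eq_one_iff _).2 h.cube_mem

/-- The even permutations are the powers of the `3`-cycle induced by `y`, so a power of `y` carries
`g` into the kernel `O_2 O_3` of the action. -/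
theorem mk_mem_closure [Finite G] (h : QuatCore y a b) {g : G} (hg : h.perm g ^ 3 = 1) :
    QuotientGroup.mk' (pCore 3 G) g ∈ closure ({QuotientGroup.mk' (pCore 3 G) y,
      QuotientGroup.mk' (pCore 3 G) a, QuotientGroup.mk' (pCore 3 G) b} : Set (G ⧸ pCore 3 G)) := by
  set f := QuotientGroup.mk' (pCore 3 G)
  have key : ∀ σ τ : Equiv.Perm (Fin 3), σ ^ 3 = 1 ∧ τ ^ 3 = 1 ∧ τ ≠ 1 →
      σ = τ ^ 0 ∨ σ = τ ^ 1 ∨ σ = τ ^ 2 := by decide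
  obtain ⟨n, hn⟩ : ∃ n : ℕ, h.perm g = h.perm y ^ n := by
    rcases key _ _ ⟨hg, h.perm_y⟩ with h1 | h1 | h1
    exacts [⟨0, h1⟩, ⟨1, h1⟩, ⟨2, h1⟩]
  have h1 : h.perm (g * (y ^ n)⁻¹) = 1 := by rw [_root_.map_mul, map_inv, map_pow, hn, mul_inv_cancel]
  obtain ⟨l, hl, o, ho, hlo⟩ := h.exists_of_perm_eq_one h1
  rw [mul_inv_eq_iff_eq_mul] at hlo
  rw [hlo, _root_.map_mul, _root_.map_mul, map_pow, show f o = 1 from (QuotientGroup.eq_one_iff _).2 ho, mul_one]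
  refine mul_mem ?_ (pow_mem (subset_closure (by simp)) n)
  have h2 := mem_map_of_mem f hl
  rw [MonoidHom.map_closure, Set.image_pair] at h2
  exact closure_mono (by simp) h2

theorem perm_cube_of_isPElt (h : QuatCore y a b) {g : G} (hg : IsPElt 3 g) : h.perm g ^ 3 = 1 := by
  have h6 : h.perm g ^ 6 = 1 := by
    have := pow_card_eq_one (x := h.perm g)
    rwa [Fintype.card_perm] at this
  refine ((hg.map h.perm).pow 3).eq_one_of_pow (n := 2) (by norm_num) ?_
  rw [← pow_mul]; exact h6

theorem perm_sq_of_isPElt (h : QuatCore y a b) {g : G} (hg : IsPElt 2 g) : h.perm g ^ 2 = 1 := by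
  have h6 : h.perm g ^ 6 = 1 := by
    have := pow_card_eq_one (x := h.perm g)
    rwa [Fintype.card_perm] at this
  refine ((hg.map h.perm).pow 2).eq_one_of_pow (n := 3) (by norm_num) ?_
  rw [← pow_mul]; exact h6

/-- Here the action has image `A₃`. All `2`-elements lie in `O_2`, and `G / O_3` is generated by the
images of `y`, `a`, `b`, where the cube of `y` becomes trivial. -/
theorem of_even [Finite G] (h : QuatCore y a b) (h2 : ∀ t, IsPElt 2 t → h.perm t = 1) :
    (∃ T : Sylow 2 G, (T : Subgroup G) = pCore 2 G) ∧
      Nonempty (pCore 2 G ≃* QuaternionGroup 2) ∧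
      Nonempty ((G ⧸ pCore 3 G) ≃* Matrix.SpecialLinearGroup (Fin 2) (ZMod 3)) ∧
      IsInternalProd (hypercenter G) (centerOf (pCore 2 G)) (pCore 3 G) := by
  have hf2 : Fact (Nat.Prime 2) := ⟨Nat.prime_two⟩
  have hL : ∀ t, IsPElt 2 t → t ∈ closure ({a, b} : Set G) := fun t ht =>
    h.mem_of_perm_eq_one (h2 t ht) ht
  refine ⟨?_, h.nonempty_mulEquiv_core, ?_, ?_⟩
  · obtain ⟨T⟩ := Sylow.nonempty (p := 2) (G := G)
    refine ⟨T, le_antisymm (fun x hx => ?_) ((isPGroup_pCore 2).le_sylow_of_normal T)⟩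
    rw [h.core]
    exact hL x (T.isPGroup'.isPElt hx)
  · obtain ⟨e⟩ := h.quotient.nonempty_mulEquiv_specialLinearGroup h.quotient_cube
    have htop : closure ({QuotientGroup.mk' (pCore 3 G) y, QuotientGroup.mk' (pCore 3 G) a,
        QuotientGroup.mk' (pCore 3 G) b} : Set (G ⧸ pCore 3 G)) = ⊤ := by
      rw [eq_top_iff]
      intro x _
      obtain ⟨g, rfl⟩ := QuotientGroup.mk'_surjective (pCore 3 G) x
      refine h.mk_mem_closure ?_
      obtain ⟨i, j, hij, hi, hj⟩ :=
        exists_pow_mul_pow Nat.prime_two Nat.prime_three (by norm_num) h.primes g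
      rw [hij, _root_.map_mul, h2 _ hi, one_mul]
      exact h.perm_cube_of_isPElt hj
    exact ⟨(Subgroup.topEquiv.symm.trans (MulEquiv.subgroupCongr htop.symm)).trans e⟩
  · rw [h.centerOf_core]
    have hvn : (zpowers (a ^ 2)).Normal := h.normal_zpowers_sq
    have hZ : ∀ x ∈ zpowers (a ^ 2) ⊔ pCore 3 G, x ∈ closure ({a, b} : Set G) →
        x = 1 ∨ x = a ^ 2 := by
      intro x hx hxL
      obtain ⟨v, hv, o, ho, rfl⟩ := mem_sup_of_normal_right.1 hx
      have hvL : v ∈ closure ({a, b} : Set G) := zpowers_le.2 (pow_mem mem_a 2) hv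
      have ho1 : o ∈ closure ({a, b} : Set G) := by
        simpa using mul_mem (inv_mem hvL) hxL
      rw [h.eq_one_of_mem ho1 (IsPElt.of_mem_pCore ho), mul_one]
      exact h.mem_zpowers_sq.1 hv
    refine ⟨le_antisymm (sup_le ?_ ?_) ?_, ?_, ?_⟩
    · exact h.zpowers_sq_le_center.trans center_le_hypercenter
    · exact le_hypercenter Nat.prime_three Nat.prime_two (by norm_num)
        (fun t ht htd => (h.primes t ht htd).symm) inferInstance (isPGroup_pCore 3)
        fun n hn z hz => h.commute_of_mem (hL z hz) hn
    -- An element central modulo `⟨a ^ 2⟩ O_3` acts trivially, so it is `l * o` with `l ∈ O_2` and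
    -- `o ∈ O_3`; commuting with `y` then forces `l ∈ ⟨a ^ 2⟩`.
    · refine hypercenter_le fun g hg => ?_
      obtain ⟨l, hl, o, ho, rfl⟩ :=
        h.exists_of_perm_eq_one (h.perm_eq_one_of_central_mod hZ hg)
      have hlo : ((l * o : G) : G ⧸ (zpowers (a ^ 2) ⊔ pCore 3 G)) = l := by
        rw [QuotientGroup.mk_mul, (QuotientGroup.eq_one_iff o).2 (mem_sup_right ho), mul_one]
      have h3 := commutator_mem_iff.1 (hg y)
      rw [hlo] at h3
      exact mul_mem (mem_sup_left (h.mem_zpowers_sq.2 (h.eq_of_central_mod hZ hl h3)))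
        (mem_sup_right ho)
    · refine disjoint_def.2 fun {x} hx ho => ?_
      exact h.eq_one_of_mem (zpowers_le.2 (pow_mem mem_a 2) hx) (IsPElt.of_mem_pCore ho)
    · intro x hx o _
      exact (mem_center_iff.1 (h.zpowers_sq_le_center hx) o).symm

end QuatCore

end QuaternionCore

/-! ### Quaternion core, image `S₃`: the nonsplit extension of `SL₂(3)` -/

section QuaternionCore

variable {G : Type*} [Group G] {y a b : G}

namespace QuatCore

theorem sign_eq_one_iff (σ : Equiv.Perm (Fin 3)) : Equiv.Perm.sign σ = 1 ↔ σ ^ 3 = 1 := by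
  revert σ; decide

/-- The elements acting on the `2`-core as even permutations. -/
noncomputable def signHom (h : QuatCore y a b) : G →* ℤˣ := Equiv.Perm.sign.comp h.perm

theorem signHom_eq_one_iff (h : QuatCore y a b) {g : G} : h.signHom g = 1 ↔ h.perm g ^ 3 = 1 :=
  sign_eq_one_iff _

theorem signHom_of_isPElt (h : QuatCore y a b) {g : G} (hg : IsPElt 3 g) : h.signHom g = 1 :=
  h.signHom_eq_one_iff.2 (h.perm_cube_of_isPElt hg)

/-- Frattini argument in the kernel of the sign, which contains `S`: the normaliser of `S` contains
elements of sign `-1`, and passing to the `2`-part preserves the sign. -/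
theorem exists_normalizing [Finite G] (h : QuatCore y a b) (S : Sylow 3 G) {t₀ : G}
    (ht₀ : IsPElt 2 t₀) (hpt₀ : h.perm t₀ ≠ 1) :
    ∃ t, IsPElt 2 t ∧ h.perm t ≠ 1 ∧ t ∈ normalizer ((S : Subgroup G) : Set G) := by
  have hf3 : Fact (Nat.Prime 3) := ⟨Nat.prime_three⟩
  have hs0 : h.signHom t₀ ≠ 1 := by
    rw [ne_eq, h.signHom_eq_one_iff]
    intro h3
    refine hpt₀ ?_
    have h2 := h.perm_sq_of_isPElt ht₀
    rwa [pow_succ, h2, one_mul] at h3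
  have hSK : (S : Subgroup G) ≤ h.signHom.ker := fun x hx =>
    h.signHom_of_isPElt (S.isPGroup'.isPElt hx)
  have htop := S.normalizer_sup_eq_top' hSK
  obtain ⟨n, hn, k, hk, hnk⟩ := mem_sup_of_normal_right.1 (htop ▸ mem_top t₀ : t₀ ∈ _ ⊔ _)
  have hsn : h.signHom n ≠ 1 := by
    intro h1
    rw [← hnk, _root_.map_mul, h1, one_mul] at hs0
    exact hs0 hk
  obtain ⟨i, j, hij, hi, hj⟩ :=
    exists_pow_mul_pow Nat.prime_two Nat.prime_three (by norm_num) h.primes n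
  refine ⟨n ^ i, hi, fun h1 => hsn ?_, pow_mem hn i⟩
  rw [hij, _root_.map_mul, h.signHom_of_isPElt hj, mul_one, h.signHom_eq_one_iff, h1, one_pow]

/-- The images of `z` and `t` generate `S₃`, and `U` contains the kernel of the action. -/
theorem mem_of_perm_mem [Finite G] (h : QuatCore y a b) {U : Subgroup G}
    (hL : closure ({a, b} : Set G) ≤ U) (hO : pCore 3 G ≤ U) {z t : G} (hz : z ∈ U) (ht : t ∈ U)
    (hz3 : h.perm z ^ 3 = 1) (hz1 : h.perm z ≠ 1) (ht2 : h.perm t ^ 2 = 1) (ht1 : h.perm t ≠ 1) :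
    U = ⊤ := by
  rw [eq_top_iff]
  intro g _
  have key : ∀ σ τ ρ : Equiv.Perm (Fin 3), τ ^ 3 = 1 ∧ τ ≠ 1 ∧ σ ^ 2 = 1 ∧ σ ≠ 1 →
      ∃ i : Fin 3, ∃ j : Fin 2, ρ = τ ^ (i : ℕ) * σ ^ (j : ℕ) := by decide +kernel
  obtain ⟨i, j, hij⟩ := key _ _ (h.perm g) ⟨hz3, hz1, ht2, ht1⟩
  set u := z ^ (i : ℕ) * t ^ (j : ℕ)
  have hu : u ∈ U := mul_mem (pow_mem hz _) (pow_mem ht _)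
  have h1 : h.perm (g * u⁻¹) = 1 := by
    rw [_root_.map_mul, map_inv, mul_inv_eq_one, hij, _root_.map_mul, map_pow, map_pow]
  obtain ⟨l, hl, o, ho, hlo⟩ := h.exists_of_perm_eq_one h1
  rw [mul_inv_eq_iff_eq_mul] at hlo
  rw [hlo]
  exact mul_mem (mul_mem (hL hl) (hO ho)) hu

theorem isTildeGL23_quotient [Finite G] (h : QuatCore y a b) {t : G} (ht : IsPElt 2 t)
    (hpt : h.perm t ≠ 1) : IsTildeGL23 (G ⧸ pCore 3 G) := by
  let π := QuotientGroup.mk' (pCore 3 G)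
  have hst : h.signHom t ≠ 1 := by
    rw [ne_eq, h.signHom_eq_one_iff]
    intro h3
    refine hpt ?_
    have h2 := h.perm_sq_of_isPElt ht
    rwa [pow_succ, h2, one_mul] at h3
  let s : G ⧸ pCore 3 G →* ℤˣ := QuotientGroup.lift (pCore 3 G) h.signHom fun o ho =>
    h.signHom_of_isPElt (IsPElt.of_mem_pCore ho)
  have hs : ∀ g, s (π g) = h.signHom g := fun g => rfl
  have hker : s.ker = closure {π y, π a, π b} := by
    apply le_antisymm
    · intro x hx
      obtain ⟨g, rfl⟩ := QuotientGroup.mk'_surjective (pCore 3 G) x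
      exact h.mk_mem_closure (h.signHom_eq_one_iff.1 hx)
    · rw [closure_le]
      rintro x (rfl | rfl | rfl)
      · exact h.signHom_of_isPElt h.isPElt
      · refine h.signHom_eq_one_iff.2 ?_
        rw [h.perm_of_mem mem_a, one_pow]
      · refine h.signHom_eq_one_iff.2 ?_
        rw [h.perm_of_mem mem_b, one_pow]
  have hsurj : Function.Surjective s := by
    intro u
    rcases Int.units_eq_one_or u with rfl | rfl
    · exact ⟨1, map_one s⟩
    · exact ⟨π t, (Int.units_eq_one_or _).resolve_left hst⟩
  refine ⟨s.ker, inferInstance, ?_, ?_, ?_⟩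
  · rw [index_ker, MonoidHom.range_eq_top.2 hsurj]
    simp
  · obtain ⟨e⟩ := h.quotient.nonempty_mulEquiv_specialLinearGroup h.quotient_cube
    exact ⟨(MulEquiv.subgroupCongr hker).trans e⟩
  -- A complement would have order two. Its involution lifts to a `2`-element of `G` whose square
  -- lies in `O_3` and so is trivial; that lift can only be `a ^ 2`, which has sign `1`.
  · rintro ⟨K, hK⟩
    have hcard : Nat.card K = 2 := by
      rw [← hK.symm.index_eq_card, index_ker, MonoidHom.range_eq_top.2 hsurj]
      simp
    have hnt : Nontrivial K := Finite.one_lt_card_iff_nontrivial.1 (by rw [hcard]; norm_num)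
    obtain ⟨⟨k, hkK⟩, hk1⟩ := exists_ne (1 : K)
    have hk2 : k ^ 2 = 1 := by
      have := pow_card_eq_one' (x := (⟨k, hkK⟩ : K))
      rw [hcard] at this
      exact congrArg Subtype.val this
    obtain ⟨g, rfl⟩ := QuotientGroup.mk'_surjective (pCore 3 G) k
    obtain ⟨i, j, hij, hi, hj⟩ :=
      exists_pow_mul_pow Nat.prime_two Nat.prime_three (by norm_num) h.primes g
    have h1 : π (g ^ j) = 1 := by
      refine (hj.map π).eq_one_of_ne Nat.prime_three Nat.prime_two (by norm_num) ?_
      rw [map_pow]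
      exact (show IsPElt 2 (π g) from ⟨1, by rw [pow_one]; exact hk2⟩).pow j
    have h2 : π (g ^ i) = π g := by
      conv_rhs => rw [hij, _root_.map_mul, h1, mul_one]
    have h3 : (g ^ i) ^ 2 = 1 := by
      refine (hi.pow 2).eq_one_of_ne Nat.prime_two Nat.prime_three (by norm_num)
        (IsPElt.of_mem_pCore ((QuotientGroup.eq_one_iff _).1 ?_))
      change π ((g ^ i) ^ 2) = 1
      rw [map_pow, h2]; exact hk2
    have h4 : π g ∈ s.ker := by
      rw [← h2]
      have h5 : g ^ i ∈ closure ({a, b} : Set G) := by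
        rcases h.eq_of_sq_eq_one h3 with h4 | h4 <;> rw [h4]
        · exact one_mem _
        · exact pow_mem mem_a 2
      refine h.signHom_eq_one_iff.2 ?_
      rw [h.perm_of_mem h5, one_pow]
    exact hk1 (Subtype.ext (disjoint_def.1 hK.disjoint h4 hkK))

theorem of_odd [Finite G] (h : QuatCore y a b) {t₀ : G} (ht₀ : IsPElt 2 t₀)
    (hpt₀ : h.perm t₀ ≠ 1) :
    Nonempty (pCore 2 G ≃* QuaternionGroup 2) ∧ IsTildeGL23 (G ⧸ pCore 3 G) ∧
      (∃ (R : Sylow 3 (G ⧸ pCore 2 G)) (A : Subgroup (G ⧸ pCore 2 G)),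
        IsFrobenius (R : Subgroup (G ⧸ pCore 2 G)) A ∧ Nat.card A = 2) ∧
      hypercenter G = center G ∧ center G = centerOf (pCore 2 G) := by
  have hf3 : Fact (Nat.Prime 3) := ⟨Nat.prime_three⟩
  obtain ⟨S, hyS⟩ := h.isPElt.isPGroup_zpowers.exists_le_sylow
  have hyS : y ∈ (S : Subgroup G) := hyS (mem_zpowers y)
  obtain ⟨t, ht, hpt, htS⟩ := h.exists_normalizing S ht₀ hpt₀
  have ht2 := h.perm_sq_of_isPElt ht
  have hOS : pCore 3 G ≤ S := (isPGroup_pCore 3).le_sylow_of_normal S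
  -- `t` cannot act trivially on `S`, since a transposition and a `3`-cycle do not commute, and the
  -- quaternion exception concerns only `2`-groups.
  have hfix : ∀ x ∈ (S : Subgroup G), Commute t x → x = 1 := by
    rcases h.tidy.action_cases Nat.prime_three Nat.prime_two (by norm_num) S.isPGroup' ht
      (fun x hx => (mem_normalizer_iff.1 htS x).1 hx) with h1 | h1 | ⟨h1, -⟩
    · exact h1
    · exfalso
      have h2 := (h1 y hyS).map h.perm
      have key : ∀ σ τ : Equiv.Perm (Fin 3), τ ^ 3 = 1 ∧ τ ≠ 1 ∧ σ ^ 2 = 1 ∧ σ ≠ 1 ∧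
        σ * τ = τ * σ → False := by decide
      exact key _ _ ⟨h.perm_y.1, h.perm_y.2, ht2, hpt, h2⟩
    · norm_num at h1
  refine ⟨h.nonempty_mulEquiv_core, h.isTildeGL23_quotient ht hpt, ?_, ?_⟩
  · refine exists_isFrobenius_card_two (isPGroup_pCore 2) S.isPGroup' ?_ htS ?_ ?_ hfix ?_
    · intro hb
      rw [hb, mem_bot] at hyS
      exact h.perm_y.2 ((congrArg h.perm hyS).trans (map_one _))
    · rw [h.core]
      exact h.mem_of_perm_eq_one (by rw [map_pow, ht2]) (ht.pow 2)
    · rw [h.core]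
      exact fun h1 => hpt (h.perm_of_mem h1)
    · have hSU : (S : Subgroup G) ≤ pCore 2 G ⊔ S ⊔ zpowers t := le_sup_right.trans le_sup_left
      refine h.mem_of_perm_mem ?_ (hOS.trans hSU) (hSU hyS) (mem_sup_right (mem_zpowers t))
        h.perm_y.1 h.perm_y.2 ht2 hpt
      rw [← h.core]
      exact le_sup_left.trans le_sup_left
  · have hvn := h.normal_zpowers_sq
    have hZ : ∀ x ∈ zpowers (a ^ 2), x ∈ closure ({a, b} : Set G) → x = 1 ∨ x = a ^ 2 :=
      fun x hx _ => h.mem_zpowers_sq.1 hx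
    have hle : hypercenter G ≤ zpowers (a ^ 2) := by
      refine hypercenter_le fun g hg => ?_
      have hcm : ∀ (n : ℕ) (x : G), Commute ((g ^ n : G) : G ⧸ zpowers (a ^ 2)) x := fun n x => by
        rw [QuotientGroup.mk_pow]
        exact (commutator_mem_iff.1 (hg x)).pow_left n
      obtain ⟨i, j, hij, hi, hj⟩ :=
        exists_pow_mul_pow Nat.prime_two Nat.prime_three (by norm_num) h.primes g
      have hperm := h.perm_eq_one_of_central_mod hZ hg
      have h1 : g ^ i ∈ zpowers (a ^ 2) := by
        have h2 := h.mem_of_perm_eq_one (g := g ^ i) (by rw [map_pow, hperm, one_pow]) hi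
        exact h.mem_zpowers_sq.2 (h.eq_of_central_mod hZ h2 (hcm i y))
      -- The commutator of `g ^ j` with `x` is `1` or `a ^ 2`; in the second case a `3`-element
      -- would be conjugate to its product with a central involution.
      have hcen : ∀ x, Commute (g ^ j) x := by
        intro x
        rw [← commutatorElement_eq_one_iff_commute]
        rcases h.mem_zpowers_sq.1 (commutator_mem_iff.2 (hcm j x)) with h2 | h2
        · exact h2
        exfalso
        rw [commutatorElement_def, mul_assoc, mul_assoc, ← mul_assoc x] at h2
        have h3 : x * (g ^ j)⁻¹ * x⁻¹ = (g ^ j)⁻¹ * a ^ 2 := by rw [← h2]; group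
        obtain ⟨k, hk⟩ := hj.inv
        have h4 : (x * (g ^ j)⁻¹ * x⁻¹) ^ 3 ^ k = ((g ^ j)⁻¹ * a ^ 2) ^ 3 ^ k := by rw [h3]
        rw [conj_pow, hk, ((h.sq_central _).symm).mul_pow, hk, one_mul, mul_one, mul_inv_cancel]
          at h4
        refine h.ne_one ?_
        refine (show IsPElt 2 (a ^ 2) from ⟨1, by rw [pow_one, pow_two]; exact h.sq_sq⟩).eq_one_of_pow
          ((by norm_num : Nat.Coprime 2 3).pow_right k) h4.symm
      have h5 : g ^ j = 1 := by
        refine hfix _ (hOS (h.mem_pCore_three hj (hcen a) (hcen b))) (hcen t).symm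
      rw [hij, h5, mul_one]
      exact h1
    have h1 : hypercenter G = center G :=
      le_antisymm (hle.trans h.zpowers_sq_le_center) center_le_hypercenter
    refine ⟨h1, ?_⟩
    rw [h.centerOf_core]
    exact le_antisymm (center_le_hypercenter.trans hle) h.zpowers_sq_le_center

end QuatCore

end QuaternionCore

/-! ### The Frattini situation -/

section Frattini

variable {G : Type*} [Group G]

/-- The situation in which a `p`-subgroup `R`, covering the `p`-core modulo the `q`-core and larger
than the `p`-core, acts without fixed points on the `q`-core, while the `q`-core is not a Sylow
subgroup. -/
structure FrattiniPair (p q : ℕ) (R : Subgroup G) : Prop where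
  tidy : IsTidy G
  hp : p.Prime
  hq : q.Prime
  hpq : p ≠ q
  primes : ∀ r : ℕ, r.Prime → r ∣ Nat.card G → r = p ∨ r = q
  isPGroup : IsPGroup p R
  core_le : pCore p G ≤ R
  sup_eq : normalizer (R : Set G) ⊔ pCore q G = ⊤
  mem_of_commute : ∀ g, IsPElt q g → (∀ r ∈ R, Commute g r) → g ∈ pCore q G
  fix : ∀ x ∈ R, x ∉ pCore p G → ∀ m ∈ pCore q G, Commute x m → m = 1
  not_le : ∃ x ∈ R, x ∉ pCore p G
  core_ne_bot : pCore q G ≠ ⊥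
  exists_not_mem : ∃ z, IsPElt q z ∧ z ∉ pCore q G

/-- `R` is a Sylow `p`-subgroup of the preimage `K` of `O_p(G / O_q)`, so `K = R O_q` and the
Frattini argument gives the covering by `N(R)`. The centraliser conditions hold because `O_p(G /
O_q)` contains its centraliser and because `K ∩ C(O_q)` is a `p`-group modulo a central subgroup. -/
theorem exists_frattini_subgroup [Finite G] {p q : ℕ} (hp : p.Prime) (hq : q.Prime) (hpq : p ≠ q)
    (hG : ∀ r : ℕ, r.Prime → r ∣ Nat.card G → r = p ∨ r = q) {x : G} (hx : IsPElt p x)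
    (hxK : (x : G ⧸ pCore q G) ∈ pCore p (G ⧸ pCore q G)) :
    ∃ R : Subgroup G, IsPGroup p R ∧ x ∈ R ∧ pCore p G ≤ R ∧
      normalizer (R : Set G) ⊔ pCore q G = ⊤ ∧
      (∀ g, IsPElt q g → (∀ r ∈ R, Commute g r) → g ∈ pCore q G) ∧
      (∀ z ∈ R, (∀ m ∈ pCore q G, Commute z m) → z ∈ pCore p G) := by
  have hfp : Fact p.Prime := ⟨hp⟩
  set M := pCore q G with hM
  set K := (pCore p (G ⧸ M)).comap (QuotientGroup.mk' M) with hK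
  have hKn : K.Normal := inferInstance
  have hKpow : ∀ k ∈ K, ∃ n, k ^ p ^ n ∈ M := by
    intro k hk
    obtain ⟨n, hn⟩ := IsPElt.of_mem_pCore (mem_comap.1 hk)
    refine ⟨n, (QuotientGroup.eq_one_iff _).1 ?_⟩
    rw [← hn]; rfl
  let x' : K := ⟨x, hxK⟩
  obtain ⟨S, hS⟩ := ((isPElt_coe (x := x')).1 hx).isPGroup_zpowers.exists_le_sylow
  set R := (S : Subgroup K).map K.subtype with hR
  have hRK : R ≤ K := map_subtype_le _
  have hMK : M ≤ K := fun m hm => by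
    change (m : G ⧸ M) ∈ pCore p (G ⧸ M)
    rw [(QuotientGroup.eq_one_iff m).2 hm]
    exact one_mem _
  have hsup : (S : Subgroup K) ⊔ M.subgroupOf K = ⊤ := by
    refine sup_eq_top_of_index fun t ht h1 h2 => ?_
    have hP : IsPGroup p (K ⧸ M.subgroupOf K) := by
      rw [isPGroup_iff_pow_pow_eq_one]
      intro c
      induction c using QuotientGroup.induction_on with
      | H c =>
        obtain ⟨n, hn⟩ := hKpow c c.2
        exact ⟨n, (QuotientGroup.eq_one_iff _).2 (mem_subgroupOf.2 hn)⟩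
    obtain ⟨n, hn⟩ := IsPGroup.iff_card.1 hP
    rw [index_eq_card, hn] at h2
    rw [(Nat.prime_dvd_prime_iff_eq ht hp).1 (ht.dvd_of_dvd_pow h2)] at h1
    exact S.not_dvd_index h1
  have hKeq : ∀ k ∈ K, ∃ r ∈ R, ∃ m ∈ M, k = r * m := by
    intro k hk
    obtain ⟨s, hs, m, hm, hsm⟩ :=
      mem_sup_of_normal_right.1 (hsup ▸ mem_top (⟨k, hk⟩ : K) : _ ∈ _ ⊔ _)
    exact ⟨s, mem_map_of_mem _ hs, m, hm, (congrArg Subtype.val hsm).symm⟩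
  refine ⟨R, S.isPGroup'.map _, mem_map_of_mem K.subtype (hS (mem_zpowers x')), ?_, ?_, ?_, ?_⟩
  · have h1 : pCore p G ≤ K := by
      rw [hK, ← map_le_iff_le_comap]
      exact le_pCore ((pCore_normal p G).map _ (QuotientGroup.mk'_surjective M))
        ((isPGroup_pCore p).map _)
    have h2 : IsPGroup p ((pCore p G).subgroupOf K) := (isPGroup_pCore p).comap_subtype
    have h3 := map_mono (f := K.subtype) (h2.le_sylow_of_normal S)
    rwa [subgroupOf_map_subtype, inf_eq_left.2 h1] at h3
  · have h1 := S.normalizer_sup_eq_top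
    rw [eq_top_iff, ← h1, sup_le_iff]
    refine ⟨le_sup_left, fun k hk => ?_⟩
    obtain ⟨r, hr, m, hm, rfl⟩ := hKeq k hk
    exact mul_mem (mem_sup_left (le_normalizer hr)) (mem_sup_right hm)
  · intro g hg hgR
    have h1 : (g : G ⧸ M) ∈ pCore p (G ⧸ M) := by
      refine mem_pCore_of_commute hp hq hpq (card_quotient_primes hG M) (pCore_quotient_pCore q) ?_
      intro k hk
      induction k using QuotientGroup.induction_on with
      | H k =>
        obtain ⟨r, hr, m, hm, rfl⟩ := hKeq k hk
        rw [QuotientGroup.mk_mul, (QuotientGroup.eq_one_iff m).2 hm, mul_one]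
        exact (hgR r hr).map (QuotientGroup.mk' M)
    exact (QuotientGroup.eq_one_iff g).1
      ((IsPElt.of_mem_pCore h1).eq_one_of_ne hp hq hpq (hg.mk M))
  · intro z hz hzM
    refine mem_pCore_of_central hp (C := K ⊓ centralizer (M : Set G)) (M := M) inferInstance
      inferInstance (fun c hc m _ hm => (mem_centralizer_iff.1 hc.2 m hm).symm)
      (fun c hc => hKpow c hc.1) ⟨hRK hz, mem_centralizer_iff.2 fun m hm => (hzM m hm).eq.symm⟩
      ((S.isPGroup'.map _).isPElt hz)

namespace FrattiniPair

variable {p q : ℕ} {R : Subgroup G}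

theorem eq_one_of_mem (h : FrattiniPair p q R) {x : G} (hx : x ∈ R) (hxM : x ∈ pCore q G) : x = 1 :=
  eq_one_of_mem_of_mem h.hp h.hq h.hpq h.isPGroup (isPGroup_pCore q) hx hxM

/-- For `x ∈ R` outside `O_p`, `[x, m]` lies in `R ∩ O_q = 1`, so `m` is a fixed point of `x`. Thus
`N(R)` is a complement to `O_q`. -/
theorem eq_one_of_mem_normalizer (h : FrattiniPair p q R) {m : G} (hm : m ∈ pCore q G)
    (hmR : m ∈ normalizer (R : Set G)) : m = 1 := by
  obtain ⟨x, hx, hxO⟩ := h.not_le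
  refine h.fix x hx hxO m hm ?_
  rw [← commutatorElement_eq_one_iff_commute]
  refine h.eq_one_of_mem (x := x * m * x⁻¹ * m⁻¹) ?_ ?_
  · have := mul_mem hx ((mem_normalizer_iff.1 hmR _).1 (inv_mem hx))
    simpa [mul_assoc] using this
  · exact mul_mem ((pCore_normal q G).conj_mem m hm x) (inv_mem hm)

variable [Finite G]

/-- `N(R)` covers `G / O_q`, which is not a `p`-group. -/
theorem exists_orderOf_eq (h : FrattiniPair p q R) :
    ∃ y ∈ normalizer (R : Set G), orderOf y = q := by
  obtain ⟨z, hz, hzM⟩ := h.exists_not_mem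
  obtain ⟨n, hn, m, hm, rfl⟩ := mem_sup_of_normal_right.1 (h.sup_eq ▸ mem_top z : z ∈ _ ⊔ _)
  obtain ⟨i, j, hij, hi, hj⟩ := exists_pow_mul_pow h.hp h.hq h.hpq h.primes n
  by_cases hj1 : n ^ j = 1
  · exfalso
    rw [hj1, mul_one] at hij
    refine hzM (mul_mem ((QuotientGroup.eq_one_iff n).1 ?_) hm)
    have h1 : IsPElt p (n : G ⧸ pCore q G) := by rw [hij]; exact hi.mk _
    refine h1.eq_one_of_ne h.hp h.hq h.hpq ?_
    have h2 := hz.mk (pCore q G)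
    rwa [QuotientGroup.mk_mul, (QuotientGroup.eq_one_iff m).2 hm, mul_one] at h2
  · obtain ⟨k, hk⟩ := hj.exists_orderOf_eq h.hq hj1
    exact ⟨_, pow_mem (pow_mem hn j) k, hk⟩

/-- The `q`-core contains a nontrivial central element of order `q`. -/
theorem exists_central (h : FrattiniPair p q R) :
    ∃ w ∈ pCore q G, orderOf w = q ∧ ∀ m ∈ pCore q G, Commute w m := by
  have hfq : Fact q.Prime := ⟨h.hq⟩
  have : Nontrivial (pCore q G) := (nontrivial_iff_ne_bot _).2 h.core_ne_bot
  obtain ⟨z, hz⟩ :=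
    (nontrivial_iff_exists_ne_one _).1 (isPGroup_pCore (G := G) q).center_nontrivial
  obtain ⟨k, hk⟩ := (IsPElt.of_mem_pCore z.2).exists_orderOf_eq h.hq
    (fun h1 => hz.2 (Subtype.ext h1) : (z : G) ≠ 1)
  exact ⟨_, pow_mem z.2 k, hk, fun m hm => Commute.pow_left
    (congrArg Subtype.val (mem_center_iff.1 hz.1 ⟨m, hm⟩)).symm k⟩

/-- Rules out the exceptional action on `R`. If `a ^ 2 ∈ O_2`, it centralises `O_3`, so `a` and `b`,
acting freely, both invert `w`, and `a * b` fixes it. Otherwise the involution `a ^ 2` acts on the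
`3`-group `O_3 ⟨y⟩` with the fixed point `y` but none in `O_3` except `1`, against the trichotomy.
-/
theorem not_quatTriple (h : FrattiniPair p q R) {y a b : G} (hp2 : p = 2) (hq3 : q = 3)
    (hy : IsPElt q y) (hR : R = closure {a, b}) (hq : QuatTriple y a b) : False := by
  subst hp2 hq3
  have hOn := pCore_normal 2 G
  have hMn := pCore_normal 3 G
  have ha : a ∈ R := hR ▸ subset_closure (by simp)
  have hb : b ∈ R := hR ▸ subset_closure (by simp)
  have haO : a ∉ pCore 2 G := by
    intro haO
    have hbO : b ∈ pCore 2 G := by rw [← hq.map_a]; exact hOn.conj_mem a haO y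
    obtain ⟨x, hx, hxO⟩ := h.not_le
    refine hxO ((closure_le _).2 ?_ (hR ▸ hx))
    rintro z (rfl | rfl)
    exacts [haO, hbO]
  have habO : a * b ∉ pCore 2 G := fun h1 => haO (by
    rw [← hq.map_mul]; exact hOn.conj_mem _ h1 y)
  have hbO : b ∉ pCore 2 G := fun h1 => habO (by
    rw [← hq.map_b]; exact hOn.conj_mem _ h1 y)
  obtain ⟨w, hw, hwo, hwc⟩ := h.exists_central
  have hw1 : w ≠ 1 := by
    rintro rfl
    rw [orderOf_one] at hwo
    norm_num at hwo
  by_cases hv : a ^ 2 ∈ pCore 2 G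
  · have hvw : Commute (a ^ 2) w := commute_of_mem_pCore h.hp h.hq h.hpq hv hw
    have key : ∀ c ∈ R, c ∉ pCore 2 G → c ^ 2 = a ^ 2 → c * w * c⁻¹ = w⁻¹ := by
      intro c hc hcO hc2
      have hm := hMn.conj_mem w hw c
      -- Since `c ^ 2` fixes `w`, the product of `w` with its conjugate is fixed by `c`.
      have h1 : c * w * c⁻¹ * w = 1 := by
        refine h.fix c hc hcO _ (mul_mem hm hw) ?_
        rw [Commute, SemiconjBy, ← mul_inv_eq_iff_eq_mul]
        calc c * (c * w * c⁻¹ * w) * c⁻¹ = (c ^ 2 * w * (c ^ 2)⁻¹) * (c * w * c⁻¹) := by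
              rw [pow_two]; group
          _ = c * w * c⁻¹ * w := by
              rw [hc2, hvw.eq, mul_inv_cancel_right, (hwc _ hm).eq]
      exact eq_inv_of_mul_eq_one_left h1
    refine hw1 (h.fix (a * b) (mul_mem ha hb) habO w hw ?_)
    rw [Commute, SemiconjBy, ← mul_inv_eq_iff_eq_mul]
    calc a * b * w * (a * b)⁻¹ = a * (b * w * b⁻¹) * a⁻¹ := by group
      _ = (a * w * a⁻¹)⁻¹ := by rw [key b hb hbO hq.sq_eq]; group
      _ = w := by rw [key a ha haO rfl, inv_inv]
  · have hvR : a ^ 2 ∈ R := pow_mem ha 2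
    have hP : IsPGroup 3 (pCore 3 G ⊔ zpowers y : Subgroup G) :=
      (isPGroup_pCore 3).to_sup_of_normal_left hy.isPGroup_zpowers
    have hnorm : ∀ n ∈ pCore 3 G ⊔ zpowers y, a ^ 2 * n * (a ^ 2)⁻¹ ∈ pCore 3 G ⊔ zpowers y := by
      intro n hn
      obtain ⟨m, hm, z, hz, rfl⟩ := mem_sup_of_normal_left.1 hn
      have hz' := hz
      obtain ⟨k, rfl⟩ := hz
      have h2 : a ^ 2 * (m * y ^ k) * (a ^ 2)⁻¹ = (a ^ 2 * m * (a ^ 2)⁻¹) * y ^ k := by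
        have h3 : Commute (a ^ 2)⁻¹ (y ^ k) := (hq.commute_sq.symm.zpow_right k).inv_left
        calc a ^ 2 * (m * y ^ k) * (a ^ 2)⁻¹ = a ^ 2 * m * (y ^ k * (a ^ 2)⁻¹) := by group
          _ = _ := by rw [← h3.eq]; group
      dsimp only
      rw [h2]
      exact mul_mem (mem_sup_left (hMn.conj_mem m hm _)) (mem_sup_right hz')
    rcases h.tidy.action_cases Nat.prime_three Nat.prime_two (by norm_num) hP (y := a ^ 2)
      (h.isPGroup.isPElt hvR) hnorm with h1 | h1 | ⟨h1, -⟩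
    · have := h1 y (mem_sup_right (mem_zpowers y)) hq.commute_sq.symm
      exact hq.not_commute_y (this ▸ Commute.one_left a)
    · exact hw1 (h.fix _ hvR hv w hw (h1 w (mem_sup_left hw)))
    · norm_num at h1

/-- Nontrivial `q`-elements of the normaliser of `R` act on `R` without fixed points. -/
theorem eq_one_of_commute (h : FrattiniPair p q R) {y : G} (hy : IsPElt q y) (hy1 : y ≠ 1)
    (hyR : y ∈ normalizer (R : Set G)) {r : G} (hr : r ∈ R) (hyr : Commute y r) : r = 1 := by
  rcases h.tidy.action_cases h.hp h.hq h.hpq h.isPGroup hy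
    (fun x hx => (mem_normalizer_iff.1 hyR x).1 hx) with h1 | h1 | ⟨h1, h2, a, b, h3, h4⟩
  · exact h1 r hr hyr
  · exact absurd (h.eq_one_of_mem_normalizer (h.mem_of_commute y hy h1) hyR) hy1
  · exact (h.not_quatTriple h1 h2 hy h3 h4).elim

/-- `r ↦ [r, y]` is injective as `y` centralises only `1` in `R`; by finiteness every element of `R`
is a commutator with `y`. -/
theorem exists_commutator_eq (h : FrattiniPair p q R) {y : G} (hy : IsPElt q y) (hy1 : y ≠ 1)
    (hyR : y ∈ normalizer (R : Set G)) :
    ∃ F : R ≃ R, ∀ r : R, (F r : G) = r * y * (r : G)⁻¹ * y⁻¹ := by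
  let f : R → R := fun r => ⟨r * y * (r : G)⁻¹ * y⁻¹, by
    have := mul_mem r.2 ((mem_normalizer_iff.1 hyR _).1 (inv_mem r.2))
    simpa [mul_assoc] using this⟩
  have hinj : Function.Injective f := by
    intro r s hrs
    have h1 : (r : G) * y * (r : G)⁻¹ * y⁻¹ = s * y * (s : G)⁻¹ * y⁻¹ := congrArg Subtype.val hrs
    rw [mul_left_inj] at h1
    have h2 : (s : G)⁻¹ * r = 1 := by
      refine h.eq_one_of_commute hy hy1 hyR (mul_mem (inv_mem s.2) r.2) ?_
      rw [Commute, SemiconjBy]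
      calc y * ((s : G)⁻¹ * r) = (s : G)⁻¹ * (s * y * (s : G)⁻¹) * r := by group
        _ = (s : G)⁻¹ * r * y := by rw [← h1]; group
    exact Subtype.ext (inv_mul_eq_one.1 h2).symm
  exact ⟨Equiv.ofBijective f (Finite.injective_iff_bijective.1 hinj), fun r => rfl⟩

/-- A norm argument: some conjugate of `y` has a product of order larger than `q` with `a`. -/
theorem exists_conj_mul_pow_ne_one (h : FrattiniPair p q R) {y a : G} (hy : orderOf y = q)
    (hyR : y ∈ normalizer (R : Set G)) (ha : a ∈ pCore q G) (hac : ∀ m ∈ pCore q G, Commute a m)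
    (ha1 : a ≠ 1) : ∃ g ∈ R, (a * (g * y * g⁻¹)) ^ q ≠ 1 := by
  classical
  have hfp : Fact p.Prime := ⟨h.hp⟩
  by_contra! hcon
  -- `W` is the centre of `O_q`. If every `(a (g y g⁻¹)) ^ q` is trivial, so is the norm of `a`
  -- along each conjugate of `y`. Multiply these norms over `g ∈ R` and exchange the products: the
  -- factor `i = 0` is `a ^ |R|`.
  let W : Subgroup G := pCore q G ⊓ centralizer (pCore q G : Set G)
  have hWn : W.Normal := inferInstance
  let _ : CommGroup W := { (inferInstance : Group W) with
    mul_comm := fun u v => Subtype.ext (mem_centralizer_iff.1 v.2.2 u u.2.1) }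
  have := Fintype.ofFinite R
  let c : G →* MulAut W := MulAut.conjNormal
  let a' : W := ⟨a, ha, mem_centralizer_iff.2 fun m hm => (hac m hm).eq.symm⟩
  have hyq : y ^ q = 1 := by rw [← hy]; exact pow_orderOf_eq_one y
  have hpow : ∀ (z : G) (n : ℕ),
      ((∏ i ∈ Finset.range n, c (z ^ i) a' : W) : G) * z ^ n = (a * z) ^ n := by
    intro z n
    induction n with
    | zero => simp
    | succ n ih =>
      rw [Finset.prod_range_succ, pow_succ (a * z), ← ih]
      change _ * (z ^ n * a * (z ^ n)⁻¹) * _ = _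
      rw [pow_succ]; group
  have hN : ∀ g : R, ∏ i ∈ Finset.range q, c ((g * y * (g : G)⁻¹) ^ i) a' = 1 := by
    intro g
    have h1 := hpow (g * y * (g : G)⁻¹) q
    rw [hcon g g.2, conj_pow, hyq, mul_one, mul_inv_cancel, mul_one] at h1
    exact Subtype.ext h1
  have hsum : ∏ i ∈ Finset.range q, ∏ g : R, c ((g * y * (g : G)⁻¹) ^ i) a' = 1 := by
    rw [Finset.prod_comm]
    exact Finset.prod_eq_one fun g _ => hN g
  obtain ⟨x, hx, hxO⟩ := h.not_le
  rw [Finset.prod_eq_single 0] at hsum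
  · have h1 : a' ^ Fintype.card R = 1 := by
      rw [← hsum]; simp
    have h2 : a ^ Nat.card R = 1 := by
      rw [Nat.card_eq_fintype_card]; exact congrArg Subtype.val h1
    obtain ⟨n, hn⟩ := IsPGroup.iff_card.1 h.isPGroup
    rw [hn] at h2
    exact ha1 ((IsPElt.of_mem_pCore ha).eq_one_of_pow
      (((Nat.coprime_primes h.hq h.hp).2 h.hpq.symm).pow_right n) h2)
  -- Here `(g y g⁻¹) ^ i = [g, y ^ i] y ^ i`, and `[g, y ^ i]` runs over `R`. The factor is thus a
  -- product over all of `R`, fixed by `x`, and hence trivial.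
  · intro i hi hi0
    have hyi1 : y ^ i ≠ 1 := by
      intro h1
      have h2 := Nat.le_of_dvd (Nat.pos_of_ne_zero hi0) (orderOf_dvd_of_pow_eq_one h1)
      rw [hy] at h2
      exact absurd (Finset.mem_range.1 hi) (by omega)
    obtain ⟨F, hF⟩ := h.exists_commutator_eq ((IsPElt.of_orderOf_eq hy).pow i) hyi1 (pow_mem hyR i)
    have h1 : ∀ g : R, c ((g * y * (g : G)⁻¹) ^ i) a' = c (F g) (c (y ^ i) a') := by
      intro g
      rw [hF, ← MulAut.mul_apply, ← map_mul, inv_mul_cancel_right, conj_pow]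
    rw [Finset.prod_congr rfl fun g _ => h1 g, F.prod_comp (fun r : R => c r (c (y ^ i) a'))]
    set P : W := ∏ r : R, c r (c (y ^ i) a') with hP
    have h2 : c x P = P := by
      rw [hP, map_prod]
      refine Fintype.prod_equiv (Equiv.mulLeft (⟨x, hx⟩ : R)) _ _ fun r => ?_
      rw [← MulAut.mul_apply, ← map_mul]; rfl
    refine Subtype.ext (h.fix x hx hxO P P.2.1 ?_)
    have h3 : x * (P : G) * x⁻¹ = P := congrArg Subtype.val h2
    exact mul_inv_eq_iff_eq_mul.1 h3
  · intro h0
    exact absurd (Finset.mem_range.2 h.hq.pos) h0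

end FrattiniPair

end Frattini

/-! ### Commutators with an element of order `q` -/

section Frattini

variable {G : Type*} [Group G]

theorem zpowers_eq_of_orderOf_eq [Finite G] {x y : G} (h : orderOf x = orderOf y)
    (hx : x ∈ zpowers y) : zpowers x = zpowers y :=
  eq_of_le_of_card_ge (zpowers_le.2 hx) (by rw [Nat.card_zpowers, Nat.card_zpowers, h])

theorem orderOf_conj (g x : G) : orderOf (g * x * g⁻¹) = orderOf x :=
  orderOf_injective (MulAut.conj g).toMonoidHom (MulAut.conj g).injective x

namespace FrattiniPair

variable [Finite G] {p q : ℕ} {R : Subgroup G}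

/-- If `r` normalised `⟨w⟩`, both `y` and `r y r⁻¹` would centralise `w`, and so would `[r, y]`,
which acts freely on `O_q`. -/
theorem conj_notMem_zpowers (h : FrattiniPair p q R) {y r w : G}
    (hyR : y ∈ normalizer (R : Set G)) (hr : r ∈ R) (hry : r * y * r⁻¹ * y⁻¹ ∉ pCore p G)
    (hw : w ∈ pCore q G) (hwq : orderOf w = q) (hyw : Commute y w) :
    r * w * r⁻¹ ∉ zpowers w := by
  intro hmem
  have h1 : w ∈ zpowers (r * w * r⁻¹) := by
    rw [zpowers_eq_of_orderOf_eq (orderOf_conj r w) hmem]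
    exact mem_zpowers w
  have h2 : Commute (r * y * r⁻¹) (r * w * r⁻¹) := hyw.map (MulAut.conj r).toMonoidHom
  have h3 : Commute (r * y * r⁻¹) w := by
    obtain ⟨n, hn⟩ := h1
    have := h2.zpow_right n
    dsimp only at hn
    rwa [hn] at this
  have h4 : w = 1 := by
    refine h.fix (r * y * r⁻¹ * y⁻¹) ?_ hry w hw (h3.mul_left hyw.inv_left)
    have := mul_mem hr ((mem_normalizer_iff.1 hyR _).1 (inv_mem hr))
    simpa [mul_assoc] using this
  rw [h4, orderOf_one] at hwq
  exact h.hq.ne_one hwq.symm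

/-- A larger `O_q ∩ Cyc(w)` would contain a `q`-th root `n₁` of a generator `w₁` of `⟨w⟩`. Comparing
it with its conjugate `n₂` by `r` forces the conjugate `w₂` of `w₁` into `⟨w₁⟩`, against
`conj_notMem_zpowers`. -/
theorem mem_zpowers_of_mem_cyc (h : FrattiniPair p q R) {y r w n : G}
    (hyR : y ∈ normalizer (R : Set G)) (hr : r ∈ R) (hry : r * y * r⁻¹ * y⁻¹ ∉ pCore p G)
    (hwq : orderOf w = q) (hwc : ∀ m ∈ pCore q G, Commute w m)
    (hyw : Commute y w) (hn : n ∈ pCore q G) (hnw : n ∈ cyc G w) : n ∈ zpowers w := by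
  have hfq : Fact q.Prime := ⟨h.hq⟩
  have hMn := pCore_normal q G
  by_contra hnn
  have hex : ∃ k, n ^ q ^ k ∈ zpowers w := by
    obtain ⟨k, hk⟩ := IsPElt.of_mem_pCore hn
    exact ⟨k, hk ▸ one_mem _⟩
  obtain ⟨n₁, hn₁n, hn₁, hn₁q⟩ : ∃ n₁ ∈ zpowers n, n₁ ∉ zpowers w ∧ n₁ ^ q ∈ zpowers w := by
    classical
    have h1 := Nat.find_spec hex
    have h0 : Nat.find hex ≠ 0 := fun h0 => hnn (by simpa [h0] using h1)
    obtain ⟨m, hm⟩ := Nat.exists_eq_succ_of_ne_zero h0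
    refine ⟨n ^ q ^ m, pow_mem (mem_zpowers n) _, Nat.find_min hex (by omega), ?_⟩
    rw [← pow_mul, ← pow_succ]
    rwa [hm] at h1
  have hn₁M : n₁ ∈ pCore q G := zpowers_le.2 hn hn₁n
  have hn₁w : n₁ ∈ cyc G w := mem_cyc_of_mem_zpowers_right hnw hn₁n
  have hwpow : ∀ x ∈ zpowers w, x ^ q = 1 := by
    rintro _ ⟨k, rfl⟩
    rw [← zpow_natCast, ← zpow_mul, mul_comm, zpow_mul, zpow_natCast, ← hwq, pow_orderOf_eq_one,
      one_zpow]
  set w₁ := n₁ ^ q with hw₁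
  have hw₁1 : w₁ ≠ 1 := fun h1 => hn₁ (_root_.mem_zpowers_of_mem_cyc h.hq hwq h1 hn₁w)
  have hw₁q : orderOf w₁ = q := orderOf_eq_prime (hwpow _ hn₁q) hw₁1
  have hw₁M : w₁ ∈ pCore q G := pow_mem hn₁M q
  have hw₁c : ∀ m ∈ pCore q G, Commute w₁ m := by
    intro m hm
    obtain ⟨k, hk⟩ := hn₁q
    dsimp only at hk
    rw [← hk]; exact (hwc m hm).zpow_left k
  have hyw₁ : Commute y w₁ := by
    obtain ⟨k, hk⟩ := hn₁q
    dsimp only at hk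
    rw [← hk]; exact hyw.zpow_right k
  have hnot := h.conj_notMem_zpowers hyR hr hry hw₁M hw₁q hyw₁
  set w₂ := r * w₁ * r⁻¹ with hw₂
  set n₂ := r * n₁ * r⁻¹ with hn₂
  have hn₂q : n₂ ^ q = w₂ := by rw [hn₂, conj_pow]
  have hw₂q : orderOf w₂ = q := (orderOf_conj r w₁).trans hw₁q
  have hn₂M : n₂ ∈ pCore q G := hMn.conj_mem _ hn₁M r
  have hw₂M : w₂ ∈ pCore q G := hMn.conj_mem _ hw₁M r
  have hw₂c : ∀ m ∈ pCore q G, Commute w₂ m := by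
    intro m hm
    have h1 := (hw₁c _ (hMn.conj_mem m hm r⁻¹)).map (MulAut.conj r).toMonoidHom
    have h2 : (MulAut.conj r).toMonoidHom (r⁻¹ * m * r⁻¹⁻¹) = m := by
      change r * (r⁻¹ * m * r⁻¹⁻¹) * r⁻¹ = m
      group
    rw [h2] at h1
    exact h1
  have hc₁ : n₁ ∈ cyc G w₁ := mem_cyc_of_mem_zpowers (z := n₁) (pow_mem (mem_zpowers n₁) q)
    (mem_zpowers n₁)
  have hc₂ : n₂ ∈ cyc G w₂ := mem_cyc_of_mem_zpowers (z := n₂)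
    (by rw [← hn₂q]; exact pow_mem (mem_zpowers n₂) q) (mem_zpowers n₂)
  -- A nontrivial `[n₁, n₂]` would lie in `Cyc(w₁)` and in `Cyc(w₂)`, and a power of it of order `q`
  -- would generate both `⟨w₁⟩` and `⟨w₂⟩`.
  have hcomm : Commute n₁ n₂ := by
    rw [← commutatorElement_eq_one_iff_commute]
    by_contra hc
    have hcM : n₁ * n₂ * n₁⁻¹ * n₂⁻¹ ∈ pCore q G :=
      mul_mem (mul_mem (mul_mem hn₁M hn₂M) (inv_mem hn₁M)) (inv_mem hn₂M)
    have e₁ : n₁ * n₂ * n₁⁻¹ * n₂⁻¹ ∈ cyc G w₁ := by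
      have := h.tidy.mul_mem hc₁ (conj_mem_cyc (inv_mem_cyc hc₁) (hw₁c n₂ hn₂M).symm)
      simpa [mul_assoc] using this
    have e₂ : n₁ * n₂ * n₁⁻¹ * n₂⁻¹ ∈ cyc G w₂ :=
      h.tidy.mul_mem (conj_mem_cyc hc₂ (hw₂c n₁ hn₁M).symm) (inv_mem_cyc hc₂)
    obtain ⟨k, hk⟩ := (IsPElt.of_mem_pCore hcM).exists_orderOf_eq h.hq hc
    set c := (n₁ * n₂ * n₁⁻¹ * n₂⁻¹) ^ k
    have hcq : c ^ q = 1 := by rw [← hk]; exact pow_orderOf_eq_one c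
    have m₁ := _root_.mem_zpowers_of_mem_cyc h.hq hw₁q hcq
      (mem_cyc_of_mem_zpowers_right e₁ (pow_mem (mem_zpowers _) k))
    have m₂ := _root_.mem_zpowers_of_mem_cyc h.hq hw₂q hcq
      (mem_cyc_of_mem_zpowers_right e₂ (pow_mem (mem_zpowers _) k))
    refine hnot ?_
    rw [← zpowers_eq_of_orderOf_eq (hk.trans hw₁q.symm) m₁,
      zpowers_eq_of_orderOf_eq (hk.trans hw₂q.symm) m₂]
    exact mem_zpowers w₂
  set u := w₁ * w₂ with hu
  have hw₁₂ : Commute w₁ w₂ := hw₁c w₂ hw₂M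
  have hw₁pow : w₁ ^ q = 1 := by rw [← hw₁q]; exact pow_orderOf_eq_one w₁
  have hw₂pow : w₂ ^ q = 1 := by rw [← hw₂q]; exact pow_orderOf_eq_one w₂
  have hu1 : u ≠ 1 := fun h1 => hnot (by
    rw [eq_inv_of_mul_eq_one_right h1]; exact inv_mem (mem_zpowers w₁))
  have huq : orderOf u = q :=
    orderOf_eq_prime (by rw [hu, hw₁₂.mul_pow, hw₁pow, hw₂pow, one_mul]) hu1
  -- `n₁ n₂` and `w₁ n₁ n₂` are both `q`-th roots of `u`, so tidiness puts `w₁` in `Cyc(u)` and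
  -- `⟨w₁⟩ = ⟨u⟩`.
  have hpow : ∀ x : G, x ^ q = u → x ∈ cyc G u := fun x hx =>
    mem_cyc_of_mem_zpowers (z := x) (by rw [← hx]; exact pow_mem (mem_zpowers x) q) (mem_zpowers x)
  have f₁ : n₁ * n₂ ∈ cyc G u := hpow _ (by rw [hcomm.mul_pow, hn₂q])
  have f₂ : w₁ * (n₁ * n₂) ∈ cyc G u := hpow _ (by
    rw [((hw₁c n₁ hn₁M).mul_right (hw₁c n₂ hn₂M)).mul_pow, hcomm.mul_pow, hn₂q, hw₁pow, one_mul])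
  have f₃ := h.tidy.mul_mem f₂ (inv_mem_cyc f₁)
  rw [mul_inv_cancel_right] at f₃
  have f₄ := _root_.mem_zpowers_of_mem_cyc h.hq huq hw₁pow f₃
  have f₅ : u ∈ zpowers w₁ := by
    rw [zpowers_eq_of_orderOf_eq (hw₁q.trans huq.symm) f₄]; exact mem_zpowers u
  refine hnot ?_
  have : w₂ = w₁⁻¹ * u := by rw [hu, inv_mul_cancel_left]
  rw [this]
  exact mul_mem (inv_mem (mem_zpowers w₁)) f₅

/-- There is an element `y` of order `q` normalising `R` and a central element `w` of order `q` of
the `q`-core such that all commutators with `y` lie in `⟨w⟩`. -/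
theorem exists_commutator_mem_zpowers (h : FrattiniPair p q R) :
    ∃ y ∈ normalizer (R : Set G), orderOf y = q ∧
      (∃ a ∈ pCore q G, (∀ m ∈ pCore q G, Commute a m) ∧ a ^ q = 1 ∧ (a * y) ^ q ≠ 1) ∧
      ∃ w ∈ pCore q G, orderOf w = q ∧ (∀ m ∈ pCore q G, Commute w m) ∧ Commute y w ∧
        ∀ m ∈ pCore q G, m * y * m⁻¹ * y⁻¹ ∈ zpowers w := by
  have hMn := pCore_normal q G
  obtain ⟨y₀, hy₀R, hy₀⟩ := h.exists_orderOf_eq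
  obtain ⟨a, ha, haq, hac⟩ := h.exists_central
  have ha1 : a ≠ 1 := by
    rintro rfl
    rw [orderOf_one] at haq
    exact h.hq.ne_one haq.symm
  obtain ⟨g, hg, hne⟩ := h.exists_conj_mul_pow_ne_one hy₀ hy₀R ha hac ha1
  set y := g * y₀ * g⁻¹ with hy
  have hgR := le_normalizer hg
  have hyR : y ∈ normalizer (R : Set G) := mul_mem (mul_mem hgR hy₀R) (inv_mem hgR)
  have hyq : orderOf y = q := (orderOf_conj g y₀).trans hy₀
  have hypow : y ^ q = 1 := by rw [← hyq]; exact pow_orderOf_eq_one y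
  have hy1 : y ≠ 1 := by
    intro h1
    rw [h1, orderOf_one] at hyq
    exact h.hq.ne_one hyq.symm
  refine ⟨y, hyR, hyq, ⟨a, ha, hac, by rw [← haq]; exact pow_orderOf_eq_one a, hne⟩, ?_⟩
  let W : Subgroup G := pCore q G ⊓ centralizer (pCore q G : Set G)
  have hWn : W.Normal := inferInstance
  have haW : a ∈ W := ⟨ha, mem_centralizer_iff.2 fun m hm => (hac m hm).eq.symm⟩
  have hWc : ∀ u ∈ W, ∀ m ∈ pCore q G, Commute u m := fun u hu m hm =>
    (mem_centralizer_iff.1 hu.2 m hm).symm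
  have hzW : (a * y) ^ q ∈ W := by
    rw [← QuotientGroup.eq_one_iff, QuotientGroup.mk_pow, QuotientGroup.mk_mul,
      (QuotientGroup.eq_one_iff a).2 haW, one_mul, ← QuotientGroup.mk_pow, hypow]
    rfl
  obtain ⟨k, hk⟩ := (IsPElt.of_mem_pCore hzW.1).exists_orderOf_eq h.hq hne
  -- As `w` is a power of `a y`, `a y ∈ Cyc(w)`. Since `a` and `w` are central in `O_q`, `[m, y] =
  -- [m, a y]` also lies in `Cyc(w)`, which meets `O_q` only in `⟨w⟩`.
  set w := ((a * y) ^ q) ^ k with hw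
  have hwW : w ∈ W := pow_mem hzW k
  have hwz : w ∈ zpowers (a * y) := pow_mem (pow_mem (mem_zpowers _) q) k
  have hzc : a * y ∈ cyc G w := mem_cyc_of_mem_zpowers hwz (mem_zpowers _)
  have hyw : Commute y w := by
    have h1 : Commute (a * y) w := (commute_of_mem_cyc hzc).symm
    have h2 := (hac w hwW.1).inv_left.mul_left h1
    rwa [inv_mul_cancel_left] at h2
  refine ⟨w, hwW.1, hk, hWc w hwW, hyw, fun m hm => ?_⟩
  obtain ⟨x, hx, hxO⟩ := h.not_le
  obtain ⟨F, hF⟩ := h.exists_commutator_eq (IsPElt.of_orderOf_eq hyq) hy1 hyR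
  obtain ⟨r, hr⟩ := F.surjective ⟨x, hx⟩
  have hrx : (r : G) * y * (r : G)⁻¹ * y⁻¹ = x := by rw [← hF, hr]
  have hcm : m * y * m⁻¹ * y⁻¹ ∈ pCore q G := by
    have := mul_mem hm (hMn.conj_mem _ (inv_mem hm) y)
    simpa [mul_assoc] using this
  refine h.mem_zpowers_of_mem_cyc hyR r.2 (by rw [hrx]; exact hxO) hk (hWc w hwW) hyw hcm ?_
  have h1 := h.tidy.mul_mem (conj_mem_cyc hzc (hWc w hwW m hm).symm) (inv_mem_cyc hzc)
  have h2 : m * (a * y) * m⁻¹ * (a * y)⁻¹ = m * y * m⁻¹ * y⁻¹ := by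
    calc m * (a * y) * m⁻¹ * (a * y)⁻¹ = (m * a) * y * m⁻¹ * y⁻¹ * a⁻¹ := by group
      _ = a * (m * y * m⁻¹ * y⁻¹) * a⁻¹ := by rw [← (hac m hm).eq]; group
      _ = m * y * m⁻¹ * y⁻¹ := by rw [(hac _ hcm).eq, mul_inv_cancel_right]
  rwa [h2] at h1

end FrattiniPair

end Frattini

/-! ### The `q`-core is a Klein four-group -/

section Frattini

variable {G : Type*} [Group G]

namespace FrattiniPair

variable [Finite G] {p q : ℕ} {R : Subgroup G}

/-- Let `C` be the centraliser of `y` in `O_q`. The commutators with `y` lie in a group of order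
`q`, so `|O_q| ≤ q |C|`. Elements of `C ∩ r C r⁻¹` are centralised by `[r, y] = x`, hence trivial,
so `|C| ^ 2 ≤ |O_q|`. -/
theorem card_core_le (h : FrattiniPair p q R) {y w : G} (hyR : y ∈ normalizer (R : Set G))
    (hyq : orderOf y = q) (hwq : orderOf w = q)
    (hcomm : ∀ m ∈ pCore q G, m * y * m⁻¹ * y⁻¹ ∈ zpowers w) : Nat.card (pCore q G) ≤ q ^ 2 := by
  have hMn := pCore_normal q G
  have hy1 : y ≠ 1 := by
    intro h1
    rw [h1, orderOf_one] at hyq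
    exact h.hq.ne_one hyq.symm
  obtain ⟨x, hx, hxO⟩ := h.not_le
  obtain ⟨F, hF⟩ := h.exists_commutator_eq (IsPElt.of_orderOf_eq hyq) hy1 hyR
  obtain ⟨r, hrx⟩ : ∃ r : G, r * y * r⁻¹ * y⁻¹ = x := by
    obtain ⟨r, hr⟩ := F.surjective ⟨x, hx⟩
    exact ⟨r, by rw [← hF, hr]⟩
  set M := pCore q G
  let C : Subgroup G := M ⊓ centralizer {y}
  have hC : ∀ c ∈ C, Commute y c := fun c hc => (mem_centralizer_singleton_iff.1 hc.2).symm
  have h1 : Nat.card M ≤ q * Nat.card C := by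
    rw [card_eq_card_quotient_mul_card_subgroup (C.subgroupOf M),
      Nat.card_congr (subgroupOfEquivOfLe (inf_le_left : C ≤ M)).toEquiv]
    refine Nat.mul_le_mul_right _ ?_
    rw [← hwq, ← Nat.card_zpowers]
    let ψ : M ⧸ C.subgroupOf M → zpowers w := fun c => ⟨_, hcomm c.out c.out.2⟩
    refine Nat.card_le_card_of_injective ψ fun c d hcd => ?_
    rw [← QuotientGroup.out_eq' c, ← QuotientGroup.out_eq' d, QuotientGroup.eq, mem_subgroupOf]
    have h2 : (c.out : G) * y * (c.out : G)⁻¹ * y⁻¹ = d.out * y * (d.out : G)⁻¹ * y⁻¹ :=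
      congrArg Subtype.val hcd
    rw [mul_left_inj] at h2
    refine ⟨Subgroup.mul_mem _ (inv_mem c.out.2) d.out.2, mem_centralizer_singleton_iff.2 ?_⟩
    calc ((c.out : G)⁻¹ * d.out) * y
        = (c.out : G)⁻¹ * (d.out * y * (d.out : G)⁻¹) * d.out := by group
      _ = y * ((c.out : G)⁻¹ * d.out) := by rw [← h2]; group
  have h2 : Nat.card C * Nat.card C ≤ Nat.card M := by
    rw [← Nat.card_prod]
    let ψ : C × C → M := fun z => ⟨z.1 * (r * z.2 * r⁻¹),
      mul_mem z.1.2.1 (hMn.conj_mem _ z.2.2.1 r)⟩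
    refine Nat.card_le_card_of_injective ψ ?_
    rintro ⟨⟨c, hc⟩, ⟨d, hd⟩⟩ ⟨⟨c', hc'⟩, ⟨d', hd'⟩⟩ hcd
    have h3 : c * (r * d * r⁻¹) = c' * (r * d' * r⁻¹) := congrArg Subtype.val hcd
    have h4 : c'⁻¹ * c = r * (d' * d⁻¹) * r⁻¹ := by
      calc c'⁻¹ * c = c'⁻¹ * (c * (r * d * r⁻¹)) * (r * d * r⁻¹)⁻¹ := by group
        _ = r * (d' * d⁻¹) * r⁻¹ := by rw [h3]; group
    have h5 := mul_mem (inv_mem hc') hc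
    have h6 : Commute (r * y * r⁻¹) (c'⁻¹ * c) := by
      rw [h4]
      exact (hC _ (mul_mem hd' (inv_mem hd))).map (MulAut.conj r).toMonoidHom
    have h7 : c'⁻¹ * c = 1 := h.fix x hx hxO _ h5.1 (hrx ▸ h6.mul_left (hC _ h5).inv_left)
    have h8 : d' * d⁻¹ = 1 := by rw [h7] at h4; exact (conj_eq_one_iff.1 h4.symm)
    rw [inv_mul_eq_one] at h7
    rw [mul_inv_eq_one] at h8
    subst h7 h8
    rfl
  have h3 : 0 < Nat.card C := Nat.card_pos
  nlinarith

/-- The `q`-core is a Klein four-group and `p = 3`. -/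
theorem eq_two_and_eq_three (h : FrattiniPair p q R) :
    q = 2 ∧ p = 3 ∧ Nat.card (pCore q G) = 4 ∧ ∀ m ∈ pCore q G, m ^ 2 = 1 := by
  have hfq : Fact q.Prime := ⟨h.hq⟩
  have hfp : Fact p.Prime := ⟨h.hp⟩
  have hMn := pCore_normal q G
  obtain ⟨y, hyR, hyq, ⟨a, ha, hac, haq, hay⟩, w, hw, hwq, hwc, hyw, hcomm⟩ :=
    h.exists_commutator_mem_zpowers
  have hcard := h.card_core_le hyR hyq hwq hcomm
  have hypow : y ^ q = 1 := by rw [← hyq]; exact pow_orderOf_eq_one y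
  have hwpow : w ^ q = 1 := by rw [← hwq]; exact pow_orderOf_eq_one w
  have hy1 : y ≠ 1 := by
    intro h1
    rw [h1, orderOf_one] at hyq
    exact h.hq.ne_one hyq.symm
  obtain ⟨x, hx, hxO⟩ := h.not_le
  obtain ⟨F, hF⟩ := h.exists_commutator_eq (IsPElt.of_orderOf_eq hyq) hy1 hyR
  obtain ⟨r, hr⟩ := F.surjective ⟨x, hx⟩
  have hrx : (r : G) * y * (r : G)⁻¹ * y⁻¹ = x := by rw [← hF, hr]
  have hnot := h.conj_notMem_zpowers hyR r.2 (by rw [hrx]; exact hxO) hw hwq hyw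
  -- `W` consists of the central elements of `O_q` of order dividing `q`. It contains `w` and `r w
  -- r⁻¹ ∉ ⟨w⟩`, so its order is at least `q ^ 2` and it equals `O_q`.
  let W : Subgroup G :=
    { carrier := {u | u ∈ pCore q G ∧ (∀ m ∈ pCore q G, Commute u m) ∧ u ^ q = 1}
      mul_mem' := fun {u v} hu hv => ⟨mul_mem hu.1 hv.1,
        fun m hm => (hu.2.1 m hm).mul_left (hv.2.1 m hm), by
          rw [(hu.2.1 v hv.1).mul_pow, hu.2.2, hv.2.2, one_mul]⟩
      one_mem' := ⟨one_mem _, fun m _ => Commute.one_left m, one_pow q⟩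
      inv_mem' := fun {u} hu => ⟨inv_mem hu.1, fun m hm => (hu.2.1 m hm).inv_left, by
        rw [inv_pow, hu.2.2, inv_one]⟩ }
  have hwW : w ∈ W := ⟨hw, hwc, hwpow⟩
  have hwrW : (r : G) * w * (r : G)⁻¹ ∈ W := by
    refine ⟨hMn.conj_mem w hw r, fun m hm => ?_, by rw [conj_pow, hwpow, mul_one, mul_inv_cancel]⟩
    have h1 := (hwc _ (hMn.conj_mem m hm (r : G)⁻¹)).map (MulAut.conj (r : G)).toMonoidHom
    have h2 : (MulAut.conj (r : G)).toMonoidHom ((r : G)⁻¹ * m * (r : G)⁻¹⁻¹) = m := by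
      change (r : G) * ((r : G)⁻¹ * m * (r : G)⁻¹⁻¹) * (r : G)⁻¹ = m
      group
    rw [h2] at h1
    exact h1
  have hWM : W ≤ pCore q G := fun u hu => hu.1
  have hlt : q < Nat.card W := by
    rw [← hwq, ← Nat.card_zpowers]
    refine lt_of_le_of_ne (card_le_of_le (zpowers_le.2 hwW)) fun h1 => hnot ?_
    have h2 := eq_of_le_of_card_ge (zpowers_le.2 hwW) h1.ge
    rw [h2]; exact hwrW
  obtain ⟨n, hn⟩ := IsPGroup.iff_card.1 (isPGroup_pCore (G := G) q)
  obtain ⟨k, hk⟩ := IsPGroup.iff_card.1 ((isPGroup_pCore (G := G) q).to_le hWM)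
  have hk2 : 2 ≤ k := by
    by_contra hk2
    have : q ^ k ≤ q ^ 1 := Nat.pow_le_pow_right h.hq.pos (by omega)
    rw [pow_one] at this
    omega
  have hWeq : W = pCore q G := by
    refine eq_of_le_of_card_ge hWM (hcard.trans ?_)
    rw [hk]; exact Nat.pow_le_pow_right h.hq.pos hk2
  have hcardM : Nat.card (pCore q G) = q ^ 2 := le_antisymm hcard (by
    rw [← hWeq, hk]; exact Nat.pow_le_pow_right h.hq.pos hk2)
  -- `[a, y] ∈ ⟨w⟩` commutes with `a` and `y`, so for odd `q` the class-two formula gives `(a y) ^ q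
  -- = a ^ q y ^ q = 1`, contrary to the choice of `a`.
  have hq2 : q = 2 := by
    by_contra hq2
    have hodd := h.hq.odd_of_ne_two hq2
    set u := a * y * a⁻¹ * y⁻¹ with hu
    have huw : u ∈ zpowers w := hcomm a ha
    obtain ⟨l, hl⟩ := inv_mem huw
    dsimp only at hl
    have huq : u⁻¹ ^ q = 1 := by
      rw [← hl, ← zpow_natCast, ← zpow_mul, mul_comm, zpow_mul, zpow_natCast, hwpow, one_zpow]
    have hya : Commute u⁻¹ y := by rw [← hl]; exact hyw.symm.zpow_left l
    have hua : Commute u⁻¹ a := by rw [← hl]; exact (hwc a ha).zpow_left l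
    have hz : y * a = a * y * u⁻¹ := by
      rw [mul_assoc, ← hya.eq, ← mul_assoc, ← hua.eq, hu]; group
    have h1 := (mul_pow_of_central hz hua hya q).2
    obtain ⟨j, hj⟩ := hodd
    have h2 : q * (q - 1) / 2 = q * j := by
      rw [hj, Nat.add_sub_cancel, mul_comm 2 j, ← mul_assoc, Nat.mul_div_cancel _ (by norm_num)]
    rw [haq, hypow, h2, pow_mul, huq, one_pow, one_mul, one_mul] at h1
    exact hay h1
  subst hq2
  refine ⟨rfl, ?_, hcardM, fun m hm => (hWeq.ge hm).2.2⟩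
  -- `⟨x⟩` fixes only `1` among the four elements of the core, so `4 ≡ 1` modulo `p`.
  have hact : IsPGroup p (zpowers x) := (h.isPGroup.isPElt hx).isPGroup_zpowers
  let φ : zpowers x →* MulAut (pCore 2 G) :=
    (MulAut.conjNormal (H := pCore 2 G)).comp (zpowers x).subtype
  let act : MulAction (zpowers x) (pCore 2 G) := MulAction.compHom _ φ
  have hmod := hact.card_modEq_card_fixedPoints (pCore 2 G)
  have hfix : MulAction.fixedPoints (zpowers x) (pCore 2 G) = {1} := by
    ext m
    rw [Set.mem_singleton_iff]
    constructor
    · intro hm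
      have h1 : x * (m : G) * x⁻¹ = m := congrArg Subtype.val (hm ⟨x, mem_zpowers x⟩)
      exact Subtype.ext (h.fix x hx hxO m m.2 (mul_inv_eq_iff_eq_mul.1 h1))
    · rintro rfl g
      exact map_one (φ g)
  rw [hcardM, hfix, Nat.card_unique] at hmod
  have h3 : p ∣ 3 := (Nat.modEq_iff_dvd' (by norm_num)).1 hmod.symm
  exact (Nat.prime_dvd_prime_iff_eq h.hp Nat.prime_three).1 h3

end FrattiniPair

end Frattini

/-! ### The quotient `S₄` -/

section Frattini

variable {G : Type*} [Group G] [Finite G] {R : Subgroup G}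

namespace FrattiniPair

theorem isKleinFour (h : FrattiniPair 3 2 R) : IsKleinFour (pCore 2 G) where
  card_four := h.eq_two_and_eq_three.2.2.1
  exponent_two := by
    obtain ⟨-, -, h4, h2⟩ := h.eq_two_and_eq_three
    have hd : Monoid.exponent (pCore 2 G) ∣ 2 :=
      Monoid.exponent_dvd_of_forall_pow_eq_one fun m => Subtype.ext (by simpa using h2 m m.2)
    refine ((Nat.dvd_prime Nat.prime_two).1 hd).resolve_left fun h1 => ?_
    have := Monoid.exp_eq_one_iff.1 h1
    rw [Nat.card_unique] at h4
    norm_num at h4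

/-- The only normal subgroup of `G` inside `N(R)` avoiding the `2`-core is the `3`-core. -/
theorem normalCore_normalizer (h : FrattiniPair 3 2 R) :
    (normalizer (R : Set G)).normalCore = pCore 3 G := by
  set H := (normalizer (R : Set G)).normalCore
  have hHN : H ≤ normalizer (R : Set G) := normalCore_le _
  have hHM : Disjoint H (pCore 2 G) :=
    disjoint_def.2 fun hx hm => h.eq_one_of_mem_normalizer hm (hHN hx)
  have hcomm : ∀ x ∈ H, ∀ m ∈ pCore 2 G, Commute x m := fun x hx m hm =>
    commute_of_normal_of_disjoint _ _ inferInstance inferInstance hHM x m hx hm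
  apply le_antisymm
  · refine le_pCore inferInstance (isPGroup_of_forall h.hp h.hq h.hpq h.primes ?_)
    intro t ht ht2
    by_contra ht1
    obtain ⟨x, hx, hxO⟩ := h.not_le
    obtain ⟨F, hF⟩ := h.exists_commutator_eq ht2 ht1 (hHN ht)
    obtain ⟨r, hr⟩ := F.surjective ⟨x, hx⟩
    have hrx : (r : G) * t * (r : G)⁻¹ * t⁻¹ = x := by rw [← hF, hr]
    obtain ⟨w, hw, hwo, -⟩ := h.exists_central
    have hxH : x ∈ H := by
      rw [← hrx]
      exact mul_mem ((normalCore_normal _).conj_mem t ht r) (inv_mem ht)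
    have := h.fix x hx hxO w hw (hcomm x hxH w hw)
    rw [this, orderOf_one] at hwo
    norm_num at hwo
  · exact normal_le_normalCore.2 (h.core_le.trans le_normalizer)

omit [Finite G] in
theorem isComplement (h : FrattiniPair 3 2 R) :
    IsComplement' (pCore 2 G) (normalizer (R : Set G)) := by
  refine isComplement'_of_disjoint_and_mul_eq_univ
    (disjoint_def.2 fun hm hx => h.eq_one_of_mem_normalizer hm hx) ?_
  rw [← normal_mul, sup_comm, h.sup_eq]; rfl

omit [Finite G] in
-- Both `y` and an element of `R` outside `O_3` remain nontrivial modulo `O_3`.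
theorem six_dvd_relIndex (h : FrattiniPair 3 2 R) {y : G} (hy : orderOf y = 2) {U : Subgroup G}
    (hyU : y ∈ U) (hRU : R ≤ U) : 6 ∣ (pCore 3 G).relIndex U := by
  have hn : ((pCore 3 G).subgroupOf U).Normal := inferInstance
  have key : ∀ (r : ℕ) (hr : r.Prime) (x : G), x ∈ U → IsPElt r x → x ∉ pCore 3 G →
      r ∣ (pCore 3 G).relIndex U := by
    intro r hr x hxU hx hxO
    set x' : U ⧸ (pCore 3 G).subgroupOf U := QuotientGroup.mk ⟨x, hxU⟩
    have hx' : IsPElt r x' := ((isPElt_coe (x := (⟨x, hxU⟩ : U))).1 hx).mk _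
    have hx1 : x' ≠ 1 := fun h1 => hxO (mem_subgroupOf.1 ((QuotientGroup.eq_one_iff _).1 h1))
    obtain ⟨n, hn⟩ := hx'.exists_orderOf_eq hr hx1
    rw [← hn]
    exact orderOf_dvd_natCard _
  obtain ⟨x, hx, hxO⟩ := h.not_le
  have h2 := key 2 Nat.prime_two y hyU (IsPElt.of_orderOf_eq hy) fun hyO => by
    have := (IsPElt.of_orderOf_eq hy).eq_one_of_ne Nat.prime_two Nat.prime_three (by norm_num)
      (IsPElt.of_mem_pCore hyO)
    rw [this, orderOf_one] at hy
    norm_num at hy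
  have h3 := key 3 Nat.prime_three x (hRU hx) (h.isPGroup.isPElt hx) hxO
  exact Nat.Coprime.mul_dvd_of_dvd_of_dvd (by norm_num : Nat.Coprime 2 3) h2 h3

/-- The action on the four cosets of `N(R)` has kernel `O_3`, which bounds the index by `24`;
conversely `6` divides the index of `O_3` in `N(R)`. -/
theorem index_core (h : FrattiniPair 3 2 R) :
    (pCore 3 G).index = 24 ∧ Nonempty ((G ⧸ pCore 3 G) ≃* Equiv.Perm (Fin 4)) := by
  obtain ⟨y, hyR, hy⟩ := h.exists_orderOf_eq
  set N := normalizer (R : Set G)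
  have hNi : N.index = 4 := by
    rw [h.isComplement.index_eq_card]; exact h.eq_two_and_eq_three.2.2.1
  have hON : pCore 3 G ≤ N := h.core_le.trans le_normalizer
  have h24 : 24 ∣ (pCore 3 G).index := by
    rw [← relIndex_mul_index hON, hNi]
    exact Nat.mul_dvd_mul_right (h.six_dvd_relIndex hy hyR le_normalizer) 4
  have e : G ⧸ N ≃ Fin 4 := Finite.equivFinOfCardEq hNi
  let ρ : G →* Equiv.Perm (Fin 4) :=
    (e.permCongrHom.toMonoidHom).comp (MulAction.toPermHom G (G ⧸ N))
  have hker : ρ.ker = pCore 3 G := by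
    rw [← h.normalCore_normalizer, normalCore_eq_ker]
    ext g
    simp only [ρ, MonoidHom.mem_ker, MonoidHom.comp_apply]
    exact e.permCongrHom.map_eq_one_iff
  have h24' : (pCore 3 G).index ≤ 24 := by
    rw [← hker, index_ker]
    refine (Nat.card_le_card_of_injective _ Subtype.val_injective).trans ?_
    rw [Nat.card_perm, Nat.card_fin]; rfl
  have hidx : (pCore 3 G).index = 24 :=
    le_antisymm h24' (Nat.le_of_dvd (Nat.pos_of_ne_zero index_ne_zero_of_finite) h24)
  refine ⟨hidx, ?_⟩
  let ρ' : G ⧸ pCore 3 G →* Equiv.Perm (Fin 4) := (QuotientGroup.kerLift ρ).comp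
    (QuotientGroup.quotientMulEquivOfEq hker.symm).toMonoidHom
  have hinj : Function.Injective ρ' :=
    (QuotientGroup.kerLift_injective ρ).comp (MulEquiv.injective _)
  refine ⟨MulEquiv.ofBijective ρ' ((Nat.bijective_iff_injective_and_card _).2 ⟨hinj, ?_⟩)⟩
  rw [← index_eq_card, hidx, Nat.card_perm, Nat.card_fin]; rfl

theorem exists_isFrobenius (h : FrattiniPair 3 2 R) :
    ∃ (T : Sylow 3 (G ⧸ pCore 2 G)) (A : Subgroup (G ⧸ pCore 2 G)),
      IsFrobenius (T : Subgroup (G ⧸ pCore 2 G)) A ∧ Nat.card A = 2 := by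
  obtain ⟨y, hyR, hy⟩ := h.exists_orderOf_eq
  have hy1 : y ≠ 1 := by
    rintro rfl
    rw [orderOf_one] at hy
    norm_num at hy
  set N := normalizer (R : Set G) with hN
  refine exists_isFrobenius_card_two (S := R) (t := y) (isPGroup_pCore 2) h.isPGroup ?_ hyR ?_
    (fun hyM => hy1 (h.eq_one_of_mem_normalizer hyM hyR))
    (fun x hx hyx => h.eq_one_of_commute (IsPElt.of_orderOf_eq hy) hy1 hyR hx hyx) ?_
  · rintro rfl
    obtain ⟨x, hx, hxO⟩ := h.not_le
    rw [mem_bot] at hx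
    exact hxO (hx ▸ one_mem _)
  · rw [← hy, pow_orderOf_eq_one]; exact one_mem _
  -- The index of `O_3` in `N(R)` is `24 / 4 = 6` and already divides its index in `R ⊔ ⟨y⟩`; so the
  -- latter is all of `N(R)`.
  · have hUN : R ⊔ zpowers y ≤ N := sup_le le_normalizer (zpowers_le.2 hyR)
    have hOU : pCore 3 G ≤ R ⊔ zpowers y := h.core_le.trans le_sup_left
    have h1 := h.six_dvd_relIndex hy (U := R ⊔ zpowers y) (mem_sup_right (mem_zpowers y)) le_sup_left
    have h2 : (pCore 3 G).relIndex N = 6 := by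
      have h3 := relIndex_mul_index (hOU.trans hUN)
      rw [h.index_core.1, h.isComplement.index_eq_card, h.eq_two_and_eq_three.2.2.1] at h3
      omega
    have h3 := relIndex_mul_relIndex _ _ _ hOU hUN
    rw [h2] at h3
    have h4 : (R ⊔ zpowers y).relIndex N = 1 := by
      obtain ⟨k, hk⟩ := h1
      rw [hk, mul_assoc] at h3
      exact Nat.eq_one_of_mul_eq_one_left (Nat.eq_of_mul_eq_mul_left (by norm_num : 0 < 6) (by omega : 6 * (k * (R ⊔ zpowers y).relIndex N) = 6 * 1))
    rw [relIndex_eq_one] at h4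
    rw [sup_assoc, eq_top_iff, ← h.sup_eq, sup_comm (pCore 2 G)]
    exact sup_le_sup_right h4 _

/-- A central `3`-element lies in `O_3 ≤ R` and is fixed by `y`; a central `2`-element lies in `O_2`
and is fixed by some `x ∈ R` outside `O_3`. Both actions are free. -/
theorem center_eq_bot (h : FrattiniPair 3 2 R) : center G = ⊥ := by
  obtain ⟨y, hyR, hy⟩ := h.exists_orderOf_eq
  have hy1 : y ≠ 1 := by
    rintro rfl
    rw [orderOf_one] at hy
    norm_num at hy
  have hc : ∀ g ∈ center G, ∀ x, Commute g x := fun g hg x => (mem_center_iff.1 hg x).symm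
  rw [eq_bot_iff]
  refine mem_of_parts h.hp h.hq h.hpq h.primes (fun g hg hg3 => ?_) fun g hg hg2 => ?_
  · refine mem_bot.2 (h.eq_one_of_commute (IsPElt.of_orderOf_eq hy) hy1 hyR (h.core_le ?_)
      (hc g hg y).symm)
    exact mem_pCore_of_commutator h.hp (E := center G) inferInstance
      (fun c hc' e he => hc e he c |>.symm) hg hg3
  · obtain ⟨x, hx, hxO⟩ := h.not_le
    exact mem_bot.2 (h.fix x hx hxO g (h.mem_of_commute g hg2 fun r _ => hc g hg r) (hc g hg x).symm)

end FrattiniPair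

end Frattini

/-! ### From tidiness to the list of groups -/

section Forward

variable {G : Type*} [Group G] [Finite G] {p q : ℕ}

/-- The `p`-part of an element of the preimage `L` of `O_p(G / F)` serves, because `L` becomes a
`p`-group modulo `O_q`, as `F` does. -/
theorem exists_mk_mem_pCore_aux (hp : p.Prime) (hq : q.Prime) (hpq : p ≠ q)
    (hG : ∀ r : ℕ, r.Prime → r ∣ Nat.card G → r = p ∨ r = q)
    {F : Subgroup G} [F.Normal] (hF : F = pCore p G ⊔ pCore q G) (h : pCore p (G ⧸ F) ≠ ⊥) :
    ∃ x : G, IsPElt p x ∧ x ∉ pCore p G ∧ (x : G ⧸ pCore q G) ∈ pCore p (G ⧸ pCore q G) := by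
  obtain ⟨c, hc, hc1⟩ := (pCore p (G ⧸ F)).bot_or_exists_ne_one.resolve_left h
  obtain ⟨g, rfl⟩ := QuotientGroup.mk_surjective c
  set L := (pCore p (G ⧸ F)).comap (QuotientGroup.mk' F) with hL
  have hgL : g ∈ L := hc
  obtain ⟨a, b, hab, ha, hb⟩ := exists_pow_mul_pow hp hq hpq hG g
  have hbF : g ^ b ∈ F := (QuotientGroup.eq_one_iff _).1
    ((IsPElt.of_mem_pCore (show ((g ^ b : G) : G ⧸ F) ∈ pCore p _ from pow_mem hgL b)).eq_one_of_ne
      hp hq hpq (hb.mk F))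
  refine ⟨g ^ a, ha, fun haO => hc1 ((QuotientGroup.eq_one_iff _).2 ?_), ?_⟩
  · rw [hab]
    exact mul_mem (hF ▸ mem_sup_left haO) hbF
  · have hP : IsPGroup p (L.map (QuotientGroup.mk' (pCore q G))) := by
      refine isPGroup_of_isPElt ?_
      rintro _ ⟨l, hl, rfl⟩
      obtain ⟨k, hk⟩ := IsPElt.of_mem_pCore (mem_comap.1 hl)
      have hlF : l ^ p ^ k ∈ F := (QuotientGroup.eq_one_iff _).1 (by rw [← hk]; rfl)
      obtain ⟨u, hu, v, hv, huv⟩ := mem_sup_of_normal_right.1 (hF ▸ hlF)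
      obtain ⟨j, hj⟩ := IsPElt.of_mem_pCore hu
      refine ⟨k + j, ?_⟩
      have : QuotientGroup.mk' (pCore q G) (l ^ p ^ k) = QuotientGroup.mk' (pCore q G) u := by
        rw [← huv, map_mul, (QuotientGroup.ker_mk' (pCore q G)).ge hv, mul_one]
      rw [pow_add, pow_mul, ← map_pow, this, ← map_pow, hj, map_one]
    exact le_pCore (Normal.map inferInstance _ (QuotientGroup.mk'_surjective _)) hP
      (mem_map_of_mem _ (pow_mem hgL a))

/-- If `G` is not the product of its cores, then one of the cores does not cover the corresponding
core of the quotient by the other one. -/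
theorem exists_mk_mem_pCore (hp : p.Prime) (hq : q.Prime) (hpq : p ≠ q)
    (hG : ∀ r : ℕ, r.Prime → r ∣ Nat.card G → r = p ∨ r = q) {z : G}
    (hz : z ∉ pCore p G ⊔ pCore q G) :
    (∃ x : G, IsPElt p x ∧ x ∉ pCore p G ∧ (x : G ⧸ pCore q G) ∈ pCore p (G ⧸ pCore q G)) ∨
      ∃ x : G, IsPElt q x ∧ x ∉ pCore q G ∧ (x : G ⧸ pCore p G) ∈ pCore q (G ⧸ pCore p G) := by
  have hnt : Nontrivial (G ⧸ pCore p G ⊔ pCore q G) :=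
    ⟨⟨z, 1, fun h => hz ((QuotientGroup.eq_one_iff _).1 h)⟩⟩
  rcases exists_mem_pCore_ne_one hp hq hpq
    (card_quotient_primes hG (pCore p G ⊔ pCore q G)) with h | h
  · exact Or.inl (exists_mk_mem_pCore_aux hp hq hpq hG rfl h)
  · refine Or.inr (exists_mk_mem_pCore_aux hq hp hpq.symm (fun r hr hd => (hG r hr hd).symm)
      (sup_comm _ _) h)

omit [Finite G] in
theorem QuatTriple.quatCore {y a b : G} (h : QuatTriple y a b) (hT : IsTidy G)
    (hG : ∀ r : ℕ, r.Prime → r ∣ Nat.card G → r = 2 ∨ r = 3) (hc : pCore 2 G = closure {a, b})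
    (hy : IsPElt 3 y) : QuatCore y a b where
  toQuatTriple := h
  tidy := hT
  primes := hG
  core := hc
  isPElt := hy

/-- The trichotomy is applied to `p`-elements acting on `O_q`. Those acting trivially lie in `O_p`;
so either all `p`-elements lie in `O_p`, or some do not and those act freely, or the core is
quaternion. -/
theorem IsTidy.cases_of_mem_pCore (hT : IsTidy G) (hp : p.Prime) (hq : q.Prime) (hpq : p ≠ q)
    (hG : ∀ r : ℕ, r.Prime → r ∣ Nat.card G → r = p ∨ r = q)
    (hM : ∀ x : G, IsPElt q x → x ∈ pCore q G) :
    Group.IsNilpotent G ∨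
      (IsPGroup p (hypercenter G) ∧ ∃ (R : Sylow q (G ⧸ hypercenter G))
        (A : Subgroup (G ⧸ hypercenter G)), IsFrobenius (R : Subgroup (G ⧸ hypercenter G)) A) ∨
      (q = 2 ∧ p = 3 ∧ ∃ y a b : G, QuatCore y a b) := by
  have htriv : ∀ x : G, IsPElt p x → (∀ m ∈ pCore q G, Commute x m) → x ∈ pCore p G := by
    intro x hx hxM
    refine mem_pCore_of_central hp (C := centralizer (pCore q G : Set G)) (M := pCore q G)
      inferInstance inferInstance (fun c hc m _ hm => (mem_centralizer_iff.1 hc m hm).symm)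
      (fun c _ => ?_) (mem_centralizer_iff.2 fun m hm => (hxM m hm).symm) hx
    obtain ⟨i, j, hij, ⟨k, hi⟩, hj⟩ := exists_pow_mul_pow hp hq hpq hG c
    refine ⟨k, ?_⟩
    rw [hij, ((Commute.refl c).pow_pow i j).mul_pow, hi, one_mul]
    exact pow_mem (hM _ hj) _
  by_cases hQ : q = 2 ∧ p = 3 ∧ ∃ y a b : G, QuatCore y a b
  · exact Or.inr (Or.inr hQ)
  have hfix : ∀ x : G, IsPElt p x → x ∉ pCore p G → ∀ m ∈ pCore q G, Commute x m → m = 1 := by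
    intro x hx hxO
    rcases hT.action_cases hq hp hpq.symm (isPGroup_pCore q) hx
      (fun n hn => (pCore_normal q G).conj_mem n hn x) with h | h | ⟨h1, h2, a, b, h3, h4⟩
    · exact h
    · exact (hxO (htriv x hx h)).elim
    · subst h1 h2
      exact (hQ ⟨rfl, rfl, x, a, b, h4.quatCore hT (fun r hr hd => (hG r hr hd).symm) h3 hx⟩).elim
  by_cases hP : ∀ x : G, IsPElt p x → x ∈ pCore p G
  · exact Or.inl (isNilpotent_of_mem_pCore hp hq hpq hG hP hM)
  · push Not at hP
    obtain ⟨y, hy, hyO⟩ := hP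
    exact Or.inr (Or.inl (isFrobenius_quotient_hypercenter hp hq hpq hG hM hfix hy hyO))

/-- Unless the trichotomy on `O_q` meets its quaternion exception, the subgroup supplied by the
Frattini argument acts freely outside `O_p`, and the Frattini analysis fixes the primes. -/
theorem IsTidy.cases_of_notMem_pCore (hT : IsTidy G) (hp : p.Prime) (hq : q.Prime) (hpq : p ≠ q)
    (hG : ∀ r : ℕ, r.Prime → r ∣ Nat.card G → r = p ∨ r = q) {x z : G} (hx : IsPElt p x)
    (hxO : x ∉ pCore p G) (hxK : (x : G ⧸ pCore q G) ∈ pCore p (G ⧸ pCore q G))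
    (hz : IsPElt q z) (hzO : z ∉ pCore q G) :
    q = 2 ∧ p = 3 ∧ ((∃ y a b : G, QuatCore y a b) ∨ ∃ R : Subgroup G, FrattiniPair p q R) := by
  obtain ⟨R, hR, hxR, hOR, hsup, hHH, htriv⟩ := exists_frattini_subgroup hp hq hpq hG hx hxK
  by_cases hQ : q = 2 ∧ p = 3 ∧ ∃ y a b : G, QuatCore y a b
  · exact ⟨hQ.1, hQ.2.1, Or.inl hQ.2.2⟩
  have hF : FrattiniPair p q R :=
    { tidy := hT, hp := hp, hq := hq, hpq := hpq, primes := hG, isPGroup := hR, core_le := hOR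
      sup_eq := hsup, mem_of_commute := hHH
      fix := by
        intro x hxR hxO
        rcases hT.action_cases hq hp hpq.symm (isPGroup_pCore q) (hR.isPElt hxR)
          (fun n hn => (pCore_normal q G).conj_mem n hn x) with h | h | ⟨h1, h2, a, b, h3, h4⟩
        · exact h
        · exact (hxO (htriv x hxR h)).elim
        · subst h1 h2
          exact (hQ ⟨rfl, rfl, x, a, b, h4.quatCore hT (fun r hr hd => (hG r hr hd).symm) h3
            (hR.isPElt hxR)⟩).elim
      not_le := ⟨x, hxR, hxO⟩
      core_ne_bot := fun hbot => hxO (htriv x hxR fun m hm => by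
        rw [hbot, mem_bot] at hm
        exact hm ▸ Commute.one_right x)
      exists_not_mem := ⟨z, hz, hzO⟩ }
  exact ⟨hF.eq_two_and_eq_three.1, hF.eq_two_and_eq_three.2.1, Or.inr ⟨R, hF⟩⟩

end Forward

/-! ### The converse: nilpotent groups, Frobenius quotients and `S₄` -/

section Reverse

variable {G : Type*} [Group G] {r s : ℕ}

theorem perm_four_eq_one_of_commute : ∀ σ τ : Equiv.Perm (Fin 4), σ ^ 8 = 1 → τ ^ 3 = 1 →
    σ * τ = τ * σ → σ ≠ 1 → τ = 1 := by decide +kernel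

set_option synthInstance.maxSize 1000 in
theorem specialLinearGroup_eq_one_of_commute :
    ∀ σ τ : Matrix.SpecialLinearGroup (Fin 2) (ZMod 3), σ ^ 8 = 1 → τ ^ 3 = 1 →
      σ * τ = τ * σ → σ ^ 2 ≠ 1 → τ = 1 := by decide +kernel

theorem specialLinearGroup_unique_involution :
    ∀ σ τ : Matrix.SpecialLinearGroup (Fin 2) (ZMod 3), σ ^ 2 = 1 → τ ^ 2 = 1 →
      σ ≠ 1 → τ ≠ 1 → σ = τ := by decide +kernel

theorem quaternionGroup_unique_involution :
    ∀ σ τ : QuaternionGroup 2, σ ^ 2 = 1 → τ ^ 2 = 1 → σ ≠ 1 → τ ≠ 1 → σ = τ := by decide +kernel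

/-- `⟨σ⟩` has index two, so it contains `u`, `v` or `u⁻¹ * v`. -/
theorem quaternionGroup_inv_mul_eq_pow :
    ∀ σ u v : QuaternionGroup 2, σ ^ 2 ≠ 1 → (∃ i : Fin 4, u = σ ^ (i : ℕ)) ∨
      (∃ i : Fin 4, v = σ ^ (i : ℕ)) ∨ ∃ i : Fin 4, u⁻¹ * v = σ ^ (i : ℕ) := by decide +kernel

/-- One of `σ`, `τ`, `σ * τ` lies in any given subgroup of index two, which thus contains an element
of order four. -/
theorem quaternionGroup_exists_sq_ne_one :
    ∀ σ : QuaternionGroup 2, σ ^ 2 ≠ 1 → ∃ τ, τ ^ 2 ≠ 1 ∧ (σ * τ) ^ 2 ≠ 1 := by decide +kernel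

theorem quaternionGroup_exists_involution :
    ∃ σ : QuaternionGroup 2, σ ^ 2 = 1 ∧ σ ≠ 1 := by decide +kernel

/-- In a Frobenius group every element outside the kernel is conjugate into the complement by an
element of the kernel. -/
theorem IsFrobenius.exists_conj [Finite G] {N A : Subgroup G} (h : IsFrobenius N A) {g : G}
    (hg : g ∉ N) : ∃ n ∈ N, ∃ a ∈ A, a ≠ 1 ∧ g = n * a * n⁻¹ := by
  have hN := h.normal
  obtain ⟨⟨⟨n, hn⟩, ⟨a, ha⟩⟩, rfl⟩ := h.isComplement.2 g
  dsimp only at hg ⊢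
  have ha1 : a ≠ 1 := by
    rintro rfl
    exact hg (by simpa using hn)
  -- `m ↦ [m, a]` is injective because `a` acts freely on `N`, hence surjective; solving `[m, a] =
  -- n` gives `n a = m a m⁻¹`.
  let f : N → N := fun m => ⟨m * (a * (m : G)⁻¹ * a⁻¹),
    mul_mem m.2 (hN.conj_mem _ (inv_mem m.2) a)⟩
  have hf : Function.Injective f := by
    intro m m' hm
    have h1 : (m : G) * (a * (m : G)⁻¹ * a⁻¹) = m' * (a * (m' : G)⁻¹ * a⁻¹) :=
      congrArg Subtype.val hm
    have h2 := h.fixedPointFree a ha ha1 ((m' : G)⁻¹ * m) (mul_mem (inv_mem m'.2) m.2) (by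
      have h3 : a * (m : G)⁻¹ = (m : G)⁻¹ * m' * (a * (m' : G)⁻¹) := by
        have := congrArg (fun t => (m : G)⁻¹ * t * a) h1
        simpa [mul_assoc] using this
      have h4 : (a * (m : G)⁻¹)⁻¹ = ((m : G)⁻¹ * m' * (a * (m' : G)⁻¹))⁻¹ := by rw [h3]
      have h5 : (m : G) * a⁻¹ = m' * a⁻¹ * ((m' : G)⁻¹ * m) := by
        simpa [mul_assoc] using h4
      calc a * ((m' : G)⁻¹ * m) * a⁻¹ = a * (m' : G)⁻¹ * (m * a⁻¹) := by group
        _ = (m' : G)⁻¹ * m := by rw [h5]; group)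
    exact Subtype.ext (inv_mul_eq_one.1 h2).symm
  obtain ⟨m, hm⟩ := (Finite.injective_iff_surjective.1 hf) ⟨n, hn⟩
  refine ⟨m, m.2, a, ha, ha1, ?_⟩
  have h1 : (m : G) * (a * (m : G)⁻¹ * a⁻¹) = n := congrArg Subtype.val hm
  rw [← h1]
  group

/-- If `g` were nontrivial modulo `Z`, it would be conjugate there into the complement and fix no
nontrivial element of the kernel, while the image of `x` is such an element. -/
theorem mem_of_commute_of_isFrobenius [Finite G] (hr : r.Prime) (hs : s.Prime) (hrs : r ≠ s)
    {Z : Subgroup G} [Z.Normal] (hZ : IsPGroup s Z) {R : Sylow r (G ⧸ Z)} {A : Subgroup (G ⧸ Z)}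
    (h : IsFrobenius (R : Subgroup (G ⧸ Z)) A) {x g : G} (hx : IsPElt r x) (hx1 : x ≠ 1)
    (hg : IsPElt s g) (hxg : Commute x g) : g ∈ Z := by
  have hxZ : (x : G ⧸ Z) ≠ 1 := fun h1 =>
    hx1 (hx.eq_one_of_ne hr hs hrs (hZ.isPElt ((QuotientGroup.eq_one_iff _).1 h1)))
  have hxR : (x : G ⧸ Z) ∈ (R : Subgroup (G ⧸ Z)) :=
    (hx.mk Z).mem_of_sylow_normal hr R h.normal
  rw [← QuotientGroup.eq_one_iff]
  by_contra hg1
  obtain ⟨n, hn, a, ha, ha1, hga⟩ := h.exists_conj (g := (g : G ⧸ Z)) fun hgR =>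
    hg1 ((hg.mk Z).eq_one_of_ne hs hr hrs.symm (R.isPGroup'.isPElt hgR))
  have hc : (x : G ⧸ Z) * g = g * x := congrArg (QuotientGroup.mk' Z) hxg.eq
  have h1 := h.fixedPointFree a ha ha1 (n⁻¹ * x * n) (mul_mem (mul_mem (inv_mem hn) hxR) hn) (by
    rw [hga] at hc
    calc a * (n⁻¹ * x * n) * a⁻¹ = n⁻¹ * (n * a * n⁻¹ * x) * n * a⁻¹ := by group
      _ = n⁻¹ * x * n := by rw [← hc]; group)
  refine hxZ ?_
  calc (x : G ⧸ Z) = n * (n⁻¹ * x * n) * n⁻¹ := by group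
    _ = 1 := by rw [h1]; group

/-- Elements of order prime to that of the hypercentre centralise the hypercentre. -/
theorem commute_of_mem_hypercenter (hr : r.Prime) (hs : s.Prime) (hrs : r ≠ s)
    (hZ : IsPGroup s (hypercenter G)) {y z : G} (hy : IsPElt r y) (hz : z ∈ hypercenter G) :
    Commute y z := by
  obtain ⟨n, hn⟩ := mem_hypercenter.1 hz
  clear hz
  induction n generalizing z with
  | zero =>
    rw [Subgroup.upperCentralSeries_zero, mem_bot] at hn
    exact hn ▸ Commute.one_right y
  | succ n ih =>
    have h1 : z⁻¹ * (y * z * y⁻¹) ∈ Subgroup.upperCentralSeries G n := by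
      have := Subgroup.mem_upperCentralSeries_succ_iff.1 (inv_mem hn) y
      rwa [commutatorElement_def, inv_inv, mul_assoc, mul_assoc, ← mul_assoc y] at this
    exact commute_of_commutator_commute hs hr hrs.symm hy
      (hZ.isPElt (mem_hypercenter.2 ⟨n, h1⟩)) (ih h1)

theorem IsPElt.pow_eq_one_of_pow_mul {x : G} {m n : ℕ} (hx : IsPElt r x)
    (hn : r.Coprime n) (h : x ^ (m * n) = 1) : x ^ m = 1 :=
  (hx.pow m).eq_one_of_pow hn (by rw [← pow_mul, h])

variable [Finite G] {p q : ℕ}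

theorem isTidy_of_isNilpotent (hp : p.Prime) (hq : q.Prime) (hpq : p ≠ q)
    (hG : ∀ r : ℕ, r.Prime → r ∣ Nat.card G → r = p ∨ r = q)
    (hP : ∀ P : Sylow p G, IsTidy (P : Subgroup G)) (hQ : ∀ Q : Sylow q G, IsTidy (Q : Subgroup G))
    (h : Group.IsNilpotent G) : IsTidy G := by
  have key : ∀ r : ℕ, r.Prime → ∀ g : G, IsPElt r g → g ∈ pCore r G := fun r hr g hg =>
    mem_pCore_of_isNilpotent hr (E := ⊤) inferInstance inferInstance (mem_top g) hg
  refine isTidy_of_isPElt hp hq hpq hG fun x _ hx a b ha hb => ?_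
  rcases hx with hx | hx
  · exact mul_mem_cyc_of_normal hp hq hpq hG hP (pCore q G) (isPGroup_pCore q) hx
      (fun g hg _ => key q hq g hg) ha hb
  · exact mul_mem_cyc_of_normal hq hp hpq.symm (fun r hr hd => (hG r hr hd).symm) hQ (pCore p G)
      (isPGroup_pCore p) hx (fun g hg _ => key p hp g hg) ha hb

/-- A `q`-element commuting with a nontrivial `p`-element lies in the hypercentre. All `p`-elements
lie in `O_p`, since they centralise the hypercentre and map into the Frobenius kernel. -/
theorem isTidy_of_isFrobenius_hypercenter (hp : p.Prime) (hq : q.Prime) (hpq : p ≠ q)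
    (hG : ∀ r : ℕ, r.Prime → r ∣ Nat.card G → r = p ∨ r = q)
    (hP : ∀ P : Sylow p G, IsTidy (P : Subgroup G)) (hQ : ∀ Q : Sylow q G, IsTidy (Q : Subgroup G))
    (hZ : IsPGroup q (hypercenter G)) {R : Sylow p (G ⧸ hypercenter G)}
    {A : Subgroup (G ⧸ hypercenter G)} (h : IsFrobenius (R : Subgroup (G ⧸ hypercenter G)) A) :
    IsTidy G := by
  refine isTidy_of_isPElt hp hq hpq hG fun x hx1 hx a b ha hb => ?_
  rcases hx with hx | hx
  · exact mul_mem_cyc_of_normal hp hq hpq hG hP (hypercenter G) hZ hx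
      (fun g hg hc => mem_of_commute_of_isFrobenius hp hq hpq hZ h hx hx1 hg hc) ha hb
  · refine mul_mem_cyc_of_normal hq hp hpq.symm (fun r hr hd => (hG r hr hd).symm) hQ (pCore p G)
      (isPGroup_pCore p) hx (fun g hg _ => ?_) ha hb
    have hR := h.normal
    refine mem_pCore_of_central hp (M := hypercenter G)
      (C := (R : Subgroup (G ⧸ hypercenter G)).comap (QuotientGroup.mk' _) ⊓
        centralizer (hypercenter G : Set G)) inferInstance inferInstance
      (fun c hc m _ hm => (mem_centralizer_iff.1 hc.2 m hm).symm) (fun c hc => ?_)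
      ⟨(hg.mk _).mem_of_sylow_normal hp R h.normal, mem_centralizer_iff.2 fun z hz =>
        (commute_of_mem_hypercenter hp hq hpq hZ hg hz).symm⟩ hg
    obtain ⟨k, hk⟩ := R.isPGroup'.isPElt (mem_comap.1 hc.1)
    exact ⟨k, (QuotientGroup.eq_one_iff _).1 (by rw [← hk]; rfl)⟩

/-- In `S₄` no nontrivial `2`-element commutes with a nontrivial `3`-element, which confines the
`3`-elements commuting with a `2`-element to `O_3`; the Frobenius quotient by `O_2` deals with the
other prime. -/
theorem isTidy_of_perm_four (hG : ∀ r : ℕ, r.Prime → r ∣ Nat.card G → r = 2 ∨ r = 3)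
    (hP : ∀ P : Sylow 2 G, IsTidy (P : Subgroup G)) (hQ : ∀ Q : Sylow 3 G, IsTidy (Q : Subgroup G))
    (e : (G ⧸ pCore 3 G) ≃* Equiv.Perm (Fin 4)) {R : Sylow 3 (G ⧸ pCore 2 G)}
    {A : Subgroup (G ⧸ pCore 2 G)} (h : IsFrobenius (R : Subgroup (G ⧸ pCore 2 G)) A) :
    IsTidy G := by
  have h24 : ∀ σ : Equiv.Perm (Fin 4), σ ^ 24 = 1 := fun σ => by
    have := pow_card_eq_one' (x := σ)
    rwa [Nat.card_perm, Nat.card_fin] at this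
  refine isTidy_of_isPElt Nat.prime_two Nat.prime_three (by norm_num) hG fun x hx1 hx a b ha hb => ?_
  rcases hx with hx | hx
  · refine mul_mem_cyc_of_normal Nat.prime_two Nat.prime_three (by norm_num) hG hP (pCore 3 G)
      (isPGroup_pCore 3) hx (fun g hg hc => ?_) ha hb
    rw [← QuotientGroup.eq_one_iff]
    refine e.map_eq_one_iff.1 (perm_four_eq_one_of_commute (e x) (e g)
      (((hx.mk _).map e.toMonoidHom).pow_eq_one_of_pow_mul (n := 3) (by norm_num)
        (h24 _)) (((hg.mk _).map e.toMonoidHom).pow_eq_one_of_pow_mul (n := 8)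
        (by norm_num) (h24 _)) ?_ fun h1 => hx1 ?_)
    · rw [← map_mul, ← map_mul]
      exact congrArg (fun t : G => e (t : G ⧸ pCore 3 G)) hc.eq
    · exact hx.eq_one_of_ne Nat.prime_two Nat.prime_three (by norm_num)
        (IsPElt.of_mem_pCore ((QuotientGroup.eq_one_iff _).1 (e.map_eq_one_iff.1 h1)))
  · exact mul_mem_cyc_of_normal Nat.prime_three Nat.prime_two (by norm_num)
      (fun r hr hd => (hG r hr hd).symm) hQ (pCore 2 G) (isPGroup_pCore 2) hx
      (fun g hg hc => mem_of_commute_of_isFrobenius Nat.prime_three Nat.prime_two (by norm_num)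
        (isPGroup_pCore 2) h hx hx1 hg hc) ha hb

end Reverse

/-! ### The converse: quaternion cores -/

section ReverseQuaternion

variable {G : Type*} [Group G] [Finite G]

/-- A unique involution lies in a common cyclic subgroup with every element. -/
theorem mem_cyc_of_unique_involution (hG : ∀ r : ℕ, r.Prime → r ∣ Nat.card G → r = 2 ∨ r = 3) {x : G}
    (hx : orderOf x = 2) (huniq : ∀ y : G, orderOf y = 2 → y = x) (g : G) : g ∈ cyc G x := by
  obtain ⟨a, b, hab, ha, hb⟩ := exists_pow_mul_pow Nat.prime_two Nat.prime_three (by norm_num) hG g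
  by_cases h1 : g ^ a = 1
  · rw [h1, one_mul] at hab
    have hc : Commute x g := (mul_inv_eq_iff_eq_mul.1 (huniq _ ((orderOf_conj g x).trans hx))).symm
    exact mem_cyc_of_coprime Nat.prime_two Nat.prime_three (by norm_num) (IsPElt.of_orderOf_eq hx)
      (hab ▸ hb) hc
  · obtain ⟨n, hn⟩ := ha.exists_orderOf_eq Nat.prime_two h1
    refine mem_cyc_of_mem_zpowers (z := g) ?_ (mem_zpowers g)
    rw [← huniq _ hn]
    exact pow_mem (pow_mem (mem_zpowers g) a) n

omit [Finite G] in
theorem IsPElt.sq_notMem_pCore {x : G} (hx : IsPElt 2 x) (h : x ^ 2 ≠ 1) : x ^ 2 ∉ pCore 3 G :=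
  fun h1 => h ((hx.pow 2).eq_one_of_ne Nat.prime_two Nat.prime_three (by norm_num)
    (IsPElt.of_mem_pCore h1))

/-- In a group with a unique involution, tidiness is governed by the `2`-elements of order
greater than two and the `3`-elements. -/
theorem isTidy_of_unique_involution (hG : ∀ r : ℕ, r.Prime → r ∣ Nat.card G → r = 2 ∨ r = 3)
    (hP : ∀ P : Sylow 2 G, IsTidy (P : Subgroup G)) (hQ : ∀ Q : Sylow 3 G, IsTidy (Q : Subgroup G))
    (huniq : ∀ x y : G, orderOf x = 2 → orderOf y = 2 → y = x)
    (h₂ : ∀ x g : G, IsPElt 2 x → x ^ 2 ≠ 1 → IsPElt 3 g → Commute x g → g ∈ pCore 3 G)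
    (h₃ : ∀ x g : G, IsPElt 3 x → x ≠ 1 → IsPElt 2 g → Commute x g → g ∈ pCore 2 G) :
    IsTidy G := by
  refine isTidy_of_isPElt Nat.prime_two Nat.prime_three (by norm_num) hG fun x hx1 hx a b ha hb => ?_
  rcases hx with hx | hx
  · by_cases hx2 : x ^ 2 = 1
    · have ho := orderOf_eq_prime hx2 hx1
      -- The cyclicizer of the unique involution is all of `G`.
      exact mem_cyc_of_unique_involution hG ho (fun y hy => huniq x y ho hy) _
    · exact mul_mem_cyc_of_normal Nat.prime_two Nat.prime_three (by norm_num) hG hP (pCore 3 G)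
        (isPGroup_pCore 3) hx (fun g hg hc => h₂ x g hx hx2 hg hc) ha hb
  · exact mul_mem_cyc_of_normal Nat.prime_three Nat.prime_two (by norm_num)
      (fun r hr hd => (hG r hr hd).symm) hQ (pCore 2 G) (isPGroup_pCore 2) hx
      (fun g hg hc => h₃ x g hx hx1 hg hc) ha hb

theorem sq_eq_one_and_ne_one_of_orderOf {H : Type*} [Group H] {x : H} (hx : orderOf x = 2) :
    x ^ 2 = 1 ∧ x ≠ 1 :=
  ⟨hx ▸ pow_orderOf_eq_one x, fun h => by rw [h, orderOf_one] at hx; norm_num at hx⟩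

theorem specialLinearGroup_eq_one_of_isPElt {σ τ : Matrix.SpecialLinearGroup (Fin 2) (ZMod 3)}
    (hσ : IsPElt 2 σ) (hτ : IsPElt 3 τ) (hc : Commute σ τ) (h : σ ^ 2 ≠ 1) : τ = 1 := by
  have h24 : ∀ ρ : Matrix.SpecialLinearGroup (Fin 2) (ZMod 3), ρ ^ 24 = 1 := fun ρ =>
    card_specialLinearGroup_two_three ▸ pow_card_eq_one'
  exact specialLinearGroup_eq_one_of_commute σ τ
    (hσ.pow_eq_one_of_pow_mul (n := 3) (by norm_num) (h24 σ))
    (hτ.pow_eq_one_of_pow_mul (n := 8) (by norm_num) (h24 τ)) hc.eq h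

/-- The normal quaternion Sylow subgroup contains a single involution, and in `SL₂(3)` a `3`-element
commuting with a `2`-element of order at least four is trivial. -/
theorem isTidy_of_specialLinearGroup
    (hG : ∀ r : ℕ, r.Prime → r ∣ Nat.card G → r = 2 ∨ r = 3)
    (hP : ∀ P : Sylow 2 G, IsTidy (P : Subgroup G)) (hQ : ∀ Q : Sylow 3 G, IsTidy (Q : Subgroup G))
    {T : Sylow 2 G} (hT : (T : Subgroup G) = pCore 2 G) (f : pCore 2 G ≃* QuaternionGroup 2)
    (e : (G ⧸ pCore 3 G) ≃* Matrix.SpecialLinearGroup (Fin 2) (ZMod 3)) : IsTidy G := by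
  have hmem : ∀ g : G, IsPElt 2 g → g ∈ pCore 2 G := fun g hg =>
    hT ▸ hg.mem_of_sylow_normal Nat.prime_two T (hT ▸ inferInstance)
  refine isTidy_of_unique_involution hG hP hQ (fun x y hx hy => ?_) (fun x g hx hx2 hg hc => ?_)
    fun _ g _ _ hg _ => hmem g hg
  · obtain ⟨hx2, hx1⟩ := sq_eq_one_and_ne_one_of_orderOf hx
    obtain ⟨hy2, hy1⟩ := sq_eq_one_and_ne_one_of_orderOf hy
    let x' : pCore 2 G := ⟨x, hmem x (IsPElt.of_orderOf_eq hx)⟩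
    let y' : pCore 2 G := ⟨y, hmem y (IsPElt.of_orderOf_eq hy)⟩
    have := quaternionGroup_unique_involution (f y') (f x')
      (by rw [← map_pow, f.map_eq_one_iff]; exact Subtype.ext hy2)
      (by rw [← map_pow, f.map_eq_one_iff]; exact Subtype.ext hx2)
      (fun h => hy1 (congrArg Subtype.val (f.map_eq_one_iff.1 h)))
      (fun h => hx1 (congrArg Subtype.val (f.map_eq_one_iff.1 h)))
    exact congrArg Subtype.val (f.injective this)
  · rw [← QuotientGroup.eq_one_iff]
    refine e.map_eq_one_iff.1 (specialLinearGroup_eq_one_of_isPElt (σ := e x)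
      ((hx.mk _).map e.toMonoidHom) ((hg.mk _).map e.toMonoidHom)
      ((hc.map (QuotientGroup.mk' (pCore 3 G))).map e.toMonoidHom) fun h1 => ?_)
    rw [← map_pow, e.map_eq_one_iff, ← QuotientGroup.mk_pow, QuotientGroup.eq_one_iff] at h1
    exact hx.sq_notMem_pCore hx2 h1

omit [Finite G] in
/-- A `3`-element that normalises a quaternion group of order eight and centralises an element of
order four centralises the whole group. -/
theorem commute_of_commute_of_quaternion {Q : Subgroup G} [Q.Normal] (hQ : IsPGroup 2 Q)
    (f : Q ≃* QuaternionGroup 2) {x g : G} (hx : x ∈ Q) (hx2 : x ^ 2 ≠ 1) (hg : IsPElt 3 g)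
    (hc : Commute x g) {n : G} (hn : n ∈ Q) : Commute g n := by
  have hgn : g * n * g⁻¹ ∈ Q := Normal.conj_mem inferInstance n hn g
  have hpow : ∀ (u : Q) (i : Fin 4), f u = f ⟨x, hx⟩ ^ (i : ℕ) → (u : G) = x ^ (i : ℕ) := by
    intro u i h
    rw [← map_pow] at h
    exact congrArg Subtype.val (f.injective h)
  rcases quaternionGroup_inv_mul_eq_pow (f ⟨x, hx⟩) (f ⟨n, hn⟩) (f ⟨g * n * g⁻¹, hgn⟩)
    (fun h => hx2 (by
      rw [← map_pow, f.map_eq_one_iff] at h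
      exact congrArg Subtype.val h)) with ⟨i, h⟩ | ⟨i, h⟩ | ⟨i, h⟩
  · have : n = x ^ (i : ℕ) := hpow _ i h
    rw [this]
    exact (hc.pow_left i).symm
  · have : g * n * g⁻¹ = x ^ (i : ℕ) := hpow _ i h
    have h1 : n = x ^ (i : ℕ) := by
      have h2 : g * n = x ^ (i : ℕ) * g := mul_inv_eq_iff_eq_mul.1 this
      rw [(hc.pow_left i).eq] at h2
      exact mul_left_cancel h2
    rw [h1]
    exact (hc.pow_left i).symm
  · rw [← map_inv, ← map_mul] at h
    have h1 : n⁻¹ * (g * n * g⁻¹) = x ^ (i : ℕ) := hpow _ i h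
    refine commute_of_commutator_commute Nat.prime_two Nat.prime_three (by norm_num) hg ?_ ?_
    · rw [h1]
      exact (hQ.isPElt hx).pow i
    · rw [h1]
      exact (hc.pow_left i).symm

theorem isTidy_of_isTildeGL23 (hG : ∀ r : ℕ, r.Prime → r ∣ Nat.card G → r = 2 ∨ r = 3)
    (hP : ∀ P : Sylow 2 G, IsTidy (P : Subgroup G)) (hQ : ∀ Q : Sylow 3 G, IsTidy (Q : Subgroup G))
    (f : pCore 2 G ≃* QuaternionGroup 2) (ht : IsTildeGL23 (G ⧸ pCore 3 G))
    {R : Sylow 3 (G ⧸ pCore 2 G)} {A : Subgroup (G ⧸ pCore 2 G)}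
    (h : IsFrobenius (R : Subgroup (G ⧸ pCore 2 G)) A) : IsTidy G := by
  obtain ⟨N, hNn, hNi, ⟨e⟩, hsplit⟩ := ht
  have hFQ : ∀ x g : G, IsPElt 3 x → x ≠ 1 → IsPElt 2 g → Commute x g → g ∈ pCore 2 G :=
    fun x g hx hx1 hg hc => mem_of_commute_of_isFrobenius Nat.prime_three Nat.prime_two (by norm_num)
      (isPGroup_pCore 2) h hx hx1 hg hc
  have hmk : ∀ x : G, IsPElt 2 x → (x : G ⧸ pCore 3 G) = 1 → x = 1 := fun x hx h1 =>
    hx.eq_one_of_ne Nat.prime_two Nat.prime_three (by norm_num)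
      (IsPElt.of_mem_pCore ((QuotientGroup.eq_one_iff _).1 h1))
  have hinv : ∀ x : G, orderOf x = 2 → (x : G ⧸ pCore 3 G) ∈ N := by
    intro x hx
    obtain ⟨hx2, hx1⟩ := sq_eq_one_and_ne_one_of_orderOf hx
    by_contra hxN
    have hcard : orderOf (x : G ⧸ pCore 3 G) = 2 :=
      orderOf_eq_prime (by rw [← QuotientGroup.mk_pow, hx2]; rfl)
        fun h1 => hx1 (hmk x (IsPElt.of_orderOf_eq hx) h1)
    -- An involution outside `N` would generate a complement.
    refine hsplit ⟨zpowers (x : G ⧸ pCore 3 G), ?_⟩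
    refine isComplement'_of_disjoint_and_mul_eq_univ (disjoint_def.2 fun {z} hz hzx => ?_) ?_
    · obtain ⟨n, rfl⟩ := hzx
      rcases Int.even_or_odd' n with ⟨k, rfl | rfl⟩
      · dsimp only
        rw [zpow_mul, zpow_ofNat, ← hcard, pow_orderOf_eq_one, one_zpow]
      · dsimp only at hz
        rw [zpow_add, zpow_mul, zpow_ofNat, ← hcard, pow_orderOf_eq_one, one_zpow, one_mul,
          zpow_one] at hz
        exact (hxN hz).elim
    · refine Set.eq_univ_of_forall fun z => ?_
      by_cases hz : z ∈ N
      · exact ⟨z, hz, 1, one_mem _, mul_one z⟩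
      · refine ⟨z * (x : G ⧸ pCore 3 G)⁻¹, (mul_mem_iff_of_index_two hNi).2 ?_, x,
          mem_zpowers _, by simp⟩
        simp [hz, hxN]
  have hSL : ∀ x y : G, orderOf x = 2 → orderOf y = 2 →
      (y : G ⧸ pCore 3 G) = (x : G ⧸ pCore 3 G) := by
    intro x y hx hy
    have key : ∀ (z : G) (hz : orderOf z = 2), (e ⟨z, hinv z hz⟩) ^ 2 = 1 ∧ e ⟨z, hinv z hz⟩ ≠ 1 := by
      intro z hz
      obtain ⟨hz2, hz1⟩ := sq_eq_one_and_ne_one_of_orderOf hz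
      refine ⟨?_, fun h1 => hz1 (hmk z (IsPElt.of_orderOf_eq hz)
        (congrArg Subtype.val (e.map_eq_one_iff.1 h1)))⟩
      rw [← map_pow, e.map_eq_one_iff]
      exact Subtype.ext (congrArg (QuotientGroup.mk' (pCore 3 G)) hz2)
    have := specialLinearGroup_unique_involution _ _ (key y hy).1 (key x hx).1 (key y hy).2
      (key x hx).2
    exact congrArg Subtype.val (e.injective this)
  obtain ⟨v, hv⟩ : ∃ v ∈ pCore 2 G, orderOf v = 2 := by
    obtain ⟨σ, hσ2, hσ1⟩ := quaternionGroup_exists_involution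
    refine ⟨f.symm σ, (f.symm σ).2, orderOf_eq_prime ?_ fun h1 => hσ1 ?_⟩
    · rw [← coe_pow, ← map_pow, hσ2, map_one, coe_one]
    · exact f.symm.map_eq_one_iff.1 (Subtype.ext h1)
  have huniq : ∀ x : G, orderOf x = 2 → x = v := by
    intro x hx
    -- Involutions agree modulo `O_3`, and the discrepancy `v⁻¹ x ∈ O_3` commutes with `v ∈ O_2`; so
    -- its square is trivial, and so is it.
    have hc : v⁻¹ * x ∈ pCore 3 G := QuotientGroup.eq.1 (hSL x v hx hv.2)
    have hcv : Commute v (v⁻¹ * x) :=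
      commute_of_mem_pCore Nat.prime_two Nat.prime_three (by norm_num) hv.1 hc
    have hx2 := (sq_eq_one_and_ne_one_of_orderOf hx).1
    have hv2 := (sq_eq_one_and_ne_one_of_orderOf hv.2).1
    have h1 : (v⁻¹ * x) ^ 2 = 1 := by
      have h2 := hcv.mul_pow 2
      rwa [mul_inv_cancel_left, hx2, hv2, one_mul, eq_comm] at h2
    exact (inv_mul_eq_one.1 ((IsPElt.of_mem_pCore hc).eq_one_of_pow (by norm_num) h1)).symm
  refine isTidy_of_unique_involution hG hP hQ (fun x y hx hy => (huniq y hy).trans (huniq x hx).symm)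
    (fun x g hx hx2 hg hc => ?_) hFQ
  by_cases hg1 : g = 1
  · exact hg1 ▸ one_mem _
  have hxO := hFQ g x hg hg1 hx hc.symm
  -- Some element of order four of `O_2` maps into the index-two subgroup `N ≅ SL₂(3)`. As `g`
  -- centralises one element of order four of `O_2`, it centralises this one too, and the
  -- computation in `SL₂(3)` applies.
  obtain ⟨n, hn, hn2, hnN⟩ : ∃ n ∈ pCore 2 G, n ^ 2 ≠ 1 ∧ (n : G ⧸ pCore 3 G) ∈ N := by
    by_cases hxN : (x : G ⧸ pCore 3 G) ∈ N
    · exact ⟨x, hxO, hx2, hxN⟩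
    obtain ⟨τ, hτ, hστ⟩ := quaternionGroup_exists_sq_ne_one (f ⟨x, hxO⟩) (fun h1 => hx2 (by
      rw [← map_pow, f.map_eq_one_iff] at h1
      exact congrArg Subtype.val h1))
    have hj2 : ((f.symm τ : pCore 2 G) : G) ^ 2 ≠ 1 := fun h1 => hτ (by
      rw [← f.symm.map_eq_one_iff, map_pow]
      exact Subtype.ext h1)
    by_cases hjN : ((f.symm τ : G) : G ⧸ pCore 3 G) ∈ N
    · exact ⟨_, (f.symm τ).2, hj2, hjN⟩
    · refine ⟨x * f.symm τ, mul_mem hxO (f.symm τ).2, fun h1 => hστ ?_, ?_⟩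
      · rw [← f.symm.map_eq_one_iff, map_pow, map_mul, f.symm_apply_apply]
        exact Subtype.ext h1
      · rw [QuotientGroup.mk_mul]
        exact (mul_mem_iff_of_index_two hNi).2 (by simp [hxN, hjN])
  have hgn : Commute g n := commute_of_commute_of_quaternion (isPGroup_pCore 2) f hxO hx2 hg hc hn
  have hgN : (g : G ⧸ pCore 3 G) ∈ N := by
    refine zpowers_le.2 ?_ ((hg.mk (pCore 3 G)).mem_zpowers_pow (n := 2) (by norm_num))
    rw [pow_two]
    exact (mul_mem_iff_of_index_two hNi).2 Iff.rfl
  have hn' := IsPElt.of_mem_pCore hn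
  rw [← QuotientGroup.eq_one_iff]
  have h3 := specialLinearGroup_eq_one_of_isPElt (σ := e ⟨n, hnN⟩) (τ := e ⟨g, hgN⟩)
    ((isPElt_coe.1 (hn'.mk (pCore 3 G))).map e.toMonoidHom)
    ((isPElt_coe.1 (hg.mk (pCore 3 G))).map e.toMonoidHom)
    (by
      have : Commute (⟨n, hnN⟩ : N) ⟨g, hgN⟩ :=
        Subtype.ext (hgn.symm.map (QuotientGroup.mk' (pCore 3 G))).eq
      exact this.map e.toMonoidHom)
    fun h1 => hn'.sq_notMem_pCore hn2 ((QuotientGroup.eq_one_iff _).1 (by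
      rw [← map_pow, e.map_eq_one_iff] at h1
      exact congrArg Subtype.val h1))
  exact congrArg Subtype.val (e.map_eq_one_iff.1 h3)

end ReverseQuaternion

/-! ### Assembly of the theorem -/

section Main

theorem QuatCore.cases {G : Type*} [Group G] [Finite G] {y a b : G} (h : QuatCore y a b) :
    ((∃ T : Sylow 2 G, (T : Subgroup G) = pCore 2 G) ∧
      Nonempty (pCore 2 G ≃* QuaternionGroup 2) ∧
      Nonempty ((G ⧸ pCore 3 G) ≃* Matrix.SpecialLinearGroup (Fin 2) (ZMod 3)) ∧
      IsInternalProd (hypercenter G) (centerOf (pCore 2 G)) (pCore 3 G)) ∨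
    (Nonempty (pCore 2 G ≃* QuaternionGroup 2) ∧ IsTildeGL23 (G ⧸ pCore 3 G) ∧
      (∃ (R : Sylow 3 (G ⧸ pCore 2 G)) (A : Subgroup (G ⧸ pCore 2 G)),
        IsFrobenius (R : Subgroup (G ⧸ pCore 2 G)) A ∧ Nat.card A = 2) ∧
      hypercenter G = center G ∧ center G = centerOf (pCore 2 G)) := by
  by_cases h2 : ∀ t, IsPElt 2 t → h.perm t = 1
  · exact Or.inl (h.of_even h2)
  · push Not at h2
    obtain ⟨t, ht, hpt⟩ := h2
    exact Or.inr (h.of_odd ht hpt)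

end Main

theorem theorem4p7 {G : Type*} [Group G] [Finite G] {p q : ℕ}
    (hp : p.Prime) (hq : q.Prime) (hpq : p ≠ q)
    (hG : ∀ r : ℕ, r.Prime → r ∣ Nat.card G → r = p ∨ r = q) :
    IsTidy G ↔
      ((∀ P : Sylow p G, IsTidy (P : Subgroup G)) ∧
       (∀ Q : Sylow q G, IsTidy (Q : Subgroup G))) ∧
      (
       Group.IsNilpotent G ∨
       (∃ r s : ℕ, ((r = p ∧ s = q) ∨ (r = q ∧ s = p)) ∧
          IsPGroup s (hypercenter G) ∧
          ∃ (R : Sylow r (G ⧸ hypercenter G)) (A : Subgroup (G ⧸ hypercenter G)),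
            IsFrobenius (R : Subgroup (G ⧸ hypercenter G)) A) ∨
       (({p, q} : Set ℕ) = {2, 3} ∧
          IsKleinFour (pCore 2 G) ∧
          Nonempty ((G ⧸ pCore 3 G) ≃* Equiv.Perm (Fin 4)) ∧
          (∃ (R : Sylow 3 (G ⧸ pCore 2 G)) (A : Subgroup (G ⧸ pCore 2 G)),
            IsFrobenius (R : Subgroup (G ⧸ pCore 2 G)) A ∧ Nat.card A = 2) ∧
          Subgroup.center G = ⊥) ∨
       (({p, q} : Set ℕ) = {2, 3} ∧
          (∃ T : Sylow 2 G, (T : Subgroup G) = pCore 2 G) ∧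
          Nonempty (pCore 2 G ≃* QuaternionGroup 2) ∧
          Nonempty ((G ⧸ pCore 3 G) ≃* Matrix.SpecialLinearGroup (Fin 2) (ZMod 3)) ∧
          IsInternalProd (hypercenter G) (centerOf (pCore 2 G)) (pCore 3 G)) ∨
       (({p, q} : Set ℕ) = {2, 3} ∧
          Nonempty (pCore 2 G ≃* QuaternionGroup 2) ∧
          IsTildeGL23 (G ⧸ pCore 3 G) ∧
          (∃ (R : Sylow 3 (G ⧸ pCore 2 G)) (A : Subgroup (G ⧸ pCore 2 G)),
            IsFrobenius (R : Subgroup (G ⧸ pCore 2 G)) A ∧ Nat.card A = 2) ∧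
          hypercenter G = Subgroup.center G ∧
          Subgroup.center G = centerOf (pCore 2 G))) := by
  have hG' : ∀ r : ℕ, r.Prime → r ∣ Nat.card G → r = q ∨ r = p := fun r hr hd => (hG r hr hd).symm
  constructor
  · intro hT
    refine ⟨⟨fun P => hT.subgroup P, fun Q => hT.subgroup Q⟩, ?_⟩
    suffices hcases : Group.IsNilpotent G ∨
        (∃ r s : ℕ, ((r = p ∧ s = q) ∨ (r = q ∧ s = p)) ∧ IsPGroup s (hypercenter G) ∧
          ∃ (R : Sylow r (G ⧸ hypercenter G)) (A : Subgroup (G ⧸ hypercenter G)),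
            IsFrobenius (R : Subgroup (G ⧸ hypercenter G)) A) ∨
        (({p, q} : Set ℕ) = {2, 3} ∧ ∃ R : Subgroup G, FrattiniPair 3 2 R) ∨
        (({p, q} : Set ℕ) = {2, 3} ∧ ∃ y a b : G, QuatCore y a b) by
      refine hcases.imp_right (Or.imp_right (Or.imp ?_ ?_))
      · rintro ⟨h23, R, h⟩
        exact ⟨h23, h.isKleinFour, h.index_core.2, h.exists_isFrobenius, h.center_eq_bot⟩
      · rintro ⟨h23, y, a, b, h⟩
        exact h.cases.imp (And.intro h23) (And.intro h23)
    by_cases hq' : ∀ x : G, IsPElt q x → x ∈ pCore q G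
    · rcases hT.cases_of_mem_pCore hp hq hpq hG hq' with h | ⟨h1, h2⟩ | ⟨rfl, rfl, h⟩
      · exact Or.inl h
      · exact Or.inr (Or.inl ⟨q, p, Or.inr ⟨rfl, rfl⟩, h1, h2⟩)
      · exact Or.inr (Or.inr (Or.inr ⟨(Set.pair_comm _ _), h⟩))
    by_cases hp' : ∀ x : G, IsPElt p x → x ∈ pCore p G
    · rcases hT.cases_of_mem_pCore hq hp hpq.symm hG' hp' with h | ⟨h1, h2⟩ | ⟨rfl, rfl, h⟩
      · exact Or.inl h
      · exact Or.inr (Or.inl ⟨p, q, Or.inl ⟨rfl, rfl⟩, h1, h2⟩)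
      · exact Or.inr (Or.inr (Or.inr ⟨rfl, h⟩))
    push Not at hp' hq'
    obtain ⟨y, hy, hyO⟩ := hp'
    obtain ⟨z, hz, hzO⟩ := hq'
    -- In a `q`-element `u v` with `u ∈ O_p` and `v ∈ O_q`, the factor `u` is trivial modulo `O_q`;
    -- so `z` lies outside `O_p O_q`.
    have hzF : z ∉ pCore p G ⊔ pCore q G := fun hzF => hzO (by
      obtain ⟨u, hu, v, hv, rfl⟩ := mem_sup_of_normal_right.1 hzF
      have h1 : (u * v : G ⧸ pCore q G) = u := by
        rw [(QuotientGroup.eq_one_iff v).2 hv, mul_one]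
      have h2 : IsPElt q (u : G ⧸ pCore q G) := h1 ▸ hz.mk (pCore q G)
      have h3 := ((IsPElt.of_mem_pCore hu).mk (pCore q G)).eq_one_of_ne hp hq hpq h2
      exact mul_mem ((QuotientGroup.eq_one_iff u).1 h3) hv)
    rcases exists_mk_mem_pCore hp hq hpq hG hzF with ⟨x, hx, hxO, hxK⟩ | ⟨x, hx, hxO, hxK⟩
    · obtain ⟨rfl, rfl, h | h⟩ := hT.cases_of_notMem_pCore hp hq hpq hG hx hxO hxK hz hzO
      · exact Or.inr (Or.inr (Or.inr ⟨(Set.pair_comm _ _), h⟩))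
      · exact Or.inr (Or.inr (Or.inl ⟨(Set.pair_comm _ _), h⟩))
    · obtain ⟨rfl, rfl, h | h⟩ := hT.cases_of_notMem_pCore hq hp hpq.symm hG' hx hxO hxK hy hyO
      · exact Or.inr (Or.inr (Or.inr ⟨rfl, h⟩))
      · exact Or.inr (Or.inr (Or.inl ⟨rfl, h⟩))
  · rintro ⟨⟨hP, hQ⟩, h⟩
    have h23 : ({p, q} : Set ℕ) = {2, 3} →
        (∀ r : ℕ, r.Prime → r ∣ Nat.card G → r = 2 ∨ r = 3) ∧
        (∀ P : Sylow 2 G, IsTidy (P : Subgroup G)) ∧ ∀ Q : Sylow 3 G, IsTidy (Q : Subgroup G) := by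
      intro h
      have h2 : p = 2 ∨ p = 3 := by simpa [h] using (Set.mem_insert p {q})
      have h3 : q = 2 ∨ q = 3 := by simpa [h] using (Set.mem_insert_of_mem p (Set.mem_singleton q))
      rcases h2 with rfl | rfl <;> rcases h3 with rfl | rfl
      · exact (hpq rfl).elim
      · exact ⟨hG, hP, hQ⟩
      · exact ⟨hG', hQ, hP⟩
      · exact (hpq rfl).elim
    rcases h with h | ⟨r, s, hrs, hZ, R, A, h⟩ | ⟨h, -, ⟨e⟩, ⟨R, A, hF, -⟩, -⟩ |
      ⟨h, ⟨T, hT⟩, ⟨f⟩, ⟨e⟩, -⟩ | ⟨h, ⟨f⟩, ht, ⟨R, A, hF, -⟩, -⟩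
    · exact isTidy_of_isNilpotent hp hq hpq hG hP hQ h
    · rcases hrs with ⟨rfl, rfl⟩ | ⟨rfl, rfl⟩
      · exact isTidy_of_isFrobenius_hypercenter hp hq hpq hG hP hQ hZ h
      · exact isTidy_of_isFrobenius_hypercenter hq hp hpq.symm hG' hQ hP hZ h
    · obtain ⟨h1, h2, h3⟩ := h23 h
      exact isTidy_of_perm_four h1 h2 h3 e hF
    · obtain ⟨h1, h2, h3⟩ := h23 h
      exact isTidy_of_specialLinearGroup h1 h2 h3 hT f e
    · obtain ⟨h1, h2, h3⟩ := h23 h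
      exact isTidy_of_isTildeGL23 h1 h2 h3 f ht hF
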